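/- Let $(c_1,c_2)\in\mathbb{R}^2$ and $\lambda\in\mathbb{C}\setminus\{0\}$, and consider on $(0,\infty)$ the differential equation $$\tau_2(c_1,c_2)y=\Big[\frac{d^4}{dr^4}+c_1\Big(\frac1{r^2}\frac{d^2}{dr^2}+\frac{d^2}{dr^2}\frac1{r^2}\Big)+\frac{c_2}{r^4}\Big]y=\lambda y .\qquad(*)$$ With $\sqrt{\cdot}$ the principal branch of the complex square root (argument in $(-\pi,\pi]$), put $$\alpha_{1}=\tfrac32-\tfrac12\sqrt{5-4c_1+4\sqrt{1-4c_1+c_1^2-c_2}},\qquad \alpha_{4}=\tfrac32+\tfrac12\sqrt{5-4c_1+4\sqrt{1-4c_1+c_1^2-c_2}},$$ $$\alpha_{2}=\tfrac32-\tfrac12\sqrt{5-4c_1-4\sqrt{1-4c_1+c_1^2-c_2}},\qquad \alpha_{3}=\tfrac32+\tfrac12\sqrt{5-4c_1-4\sqrt{1-4c_1+c_1^2-c_2}}.$$ For $k\in\mathbb{N}_0$ define the lines and parabolas $$\mathbb{L}_k=\Big\{(c_1,c_2)\in\mathbb{R}^2: c_2=\tfrac{-9-24c_1-128c_1k^2+160k^2-256k^4}{16}\Big\},$$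 $$\mathbb{P}_k=\big\{(c_1,c_2)\in\mathbb{R}^2: c_2=1-4c_1+c_1^2+16c_1k^2-20k^2+64k^4\big\}.$$ For $\{i,j,l,m\}=\{1,2,3,4\}$ let $$F_i(r)=r^{\alpha_i}\,{}_0F_3\Big(1+\tfrac{\alpha_i-\alpha_j}4,\,1+\tfrac{\alpha_i-\alpha_l}4,\,1+\tfrac{\alpha_i-\alpha_m}4\,\Big|\,\tfrac{\lambda r^4}{256}\Big),\qquad {}_0F_3(a,b,c\,|\,z)=\sum_{n\ge0}\frac{z^n}{(a)_n(b)_n(c)_n\,n!},$$ and for $z\neq0$ let $$G^{p,0}_{0,4}(b_1,b_2,b_3,b_4\,|\,z)=\frac1{2\pi i}\int_L\frac{\prod_{j=1}^{p}\Gamma(b_j-s)}{\prod_{j=p+1}^{4}\Gamma(1-b_j+s)}\,z^s\,ds$$ be Meijer's $G$-function, where $z^s$ has its principal value and $L$ is a loop beginning and ending at $+\infty$ and encircling all poles of $\Gamma(b_j-s)$, $1\le j\le p$, once in the negative direction. Write $G^{p}_{ijlm}(z)=G^{p,0}_{0,4}\big(\tfrac{\alpha_i}4,\tfrac{\alpha_j}4,\tfrac{\alpha_l}4,\tfrac{\alpha_m}4\,\big|\,z\big)$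 and $z_r=\lambda r^4/256$. By a fundamental system of solutions of $(*)$ we mean a basis of the complex vector space of solutions of $(*)$ on $(0,\infty)$. (a) If $(c_1,c_2)$ lies on exactly one line $\mathbb{L}_k$ and on none of the parabolas, then a fundamental system of solutions of $(*)$ is $$G^{2}_{1423}(z_r),\ F_2(r),\ F_3(r),\ F_4(r)\quad\text{if } c_1>\tfrac54-4k^2,$$ $$F_1(r),\ G^{2}_{2314}(z_r),\ F_3(r),\ F_4(r)\quad\text{if } c_1<\tfrac54-4k^2.$$ (b) If $(c_1,c_2)$ lies on exactly one parabola $\mathbb{P}_k$ and on none of the lines, then a fundamental system of solutions of $(*)$ is $$G^{2}_{1324}(z_r),\ G^{2}_{2413}(z_r),\ F_3(r),\ F_4(r)\quad\text{if } k\ge1 \text{ and } c_1>\tfrac54-8k^2,$$ $$G^{2}_{1234}(z_r),\ F_2(r),\ G^{2}_{3412}(z_r),\ F_4(r)\quad\text{if } k=0 \text{ or } c_1<\tfrac54-8k^2.$$ (c) If $(c_1,c_2)$ lies on exactly two distinct lines and on none of the parabolas, then a fundamental system of solutions of $(*)$ is $$G^{2}_{1423}(z_r),\ G^{2}_{2314}(z_r),\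 F_3(r),\ F_4(r).$$ (d) If $(c_1,c_2)$ lies on at least one line and on at least one parabola, then a fundamental system of solutions of $(*)$ is $$G^{4}_{1234}(z_r),\ G^{3}_{2341}(-z_r),\ G^{2}_{3412}(z_r),\ F_4(r).$$ -/

import Mathlib

noncomputable section

namespace EulerFour

/-- The principal branch of the complex square root (argument in `(-π, π]`). -/
def csqrt (z : ℂ) : ℂ := z ^ (1 / 2 : ℂ)

/-- The inner root `√(1 - 4c₁ + c₁² - c₂)`. -/
def innerRoot (c₁ c₂ : ℝ) : ℂ := csqrt (1 - 4 * c₁ + c₁ ^ 2 - c₂)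

/-- The four characteristic exponents `alpha₁, …, alpha₄` are the roots of
`z(z-1)(z-2)(z-3) + c₁ [z(z-1) + (z-2)(z-3)] + c₂`. -/
def alpha₁ (c₁ c₂ : ℝ) : ℂ := 3 / 2 - 1 / 2 * csqrt (5 - 4 * c₁ + 4 * innerRoot c₁ c₂)

/-- A characteristic exponent, see `alpha₁`. -/
def alpha₂ (c₁ c₂ : ℝ) : ℂ := 3 / 2 - 1 / 2 * csqrt (5 - 4 * c₁ - 4 * innerRoot c₁ c₂)

/-- A characteristic exponent, see `alpha₁`. -/
def alpha₃ (c₁ c₂ : ℝ) : ℂ := 3 / 2 + 1 / 2 * csqrt (5 - 4 * c₁ - 4 * innerRoot c₁ c₂)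

/-- A characteristic exponent, see `alpha₁`. -/
def alpha₄ (c₁ c₂ : ℝ) : ℂ := 3 / 2 + 1 / 2 * csqrt (5 - 4 * c₁ + 4 * innerRoot c₁ c₂)

/-- The lines `𝕃ₖ` in the `(c₁, c₂)`-plane. -/
def lineL (k : ℕ) : Set (ℝ × ℝ) :=
  {c | c.2 = (-9 - 24 * c.1 - 128 * c.1 * k ^ 2 + 160 * k ^ 2 - 256 * k ^ 4) / 16}

/-- The parabolas `ℙₖ` in the `(c₁, c₂)`-plane. -/
def parabolaP (k : ℕ) : Set (ℝ × ℝ) :=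
  {c | c.2 = 1 - 4 * c.1 + c.1 ^ 2 + 16 * c.1 * k ^ 2 - 20 * k ^ 2 + 64 * k ^ 4}

/-- The generalized hypergeometric function `₀F₃(a, b, c | z) = ∑ zⁿ / ((a)ₙ (b)ₙ (c)ₙ n!)`
(for `a, b, c` not in `{0, -1, -2, …}`). -/
def hyp0F3 (a b c z : ℂ) : ℂ :=
  ∑' n : ℕ, z ^ n / ((ascPochhammer ℂ n).eval a * (ascPochhammer ℂ n).eval b *
    (ascPochhammer ℂ n).eval c * (n.factorial : ℂ))

/-- The integrand `∏_{j ≤ m} Γ(bⱼ - s) / ∏_{j > m} Γ(1 - bⱼ + s) · z ^ s` of Meijer's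
`G^{m,0}_{0,4}`, with the principal branch of `z ^ s`. (`Complex.Gamma` is `0` at its poles, so
`(Complex.Gamma w)⁻¹` is the entire reciprocal Gamma function.) -/
def meijerIntegrand (m : ℕ) (b : Fin 4 → ℂ) (z s : ℂ) : ℂ :=
  (∏ j : Fin 4, if (j : ℕ) < m then Complex.Gamma (b j - s)
    else (Complex.Gamma (1 - b j + s))⁻¹) * z ^ s

/-- A size beyond which the contour passes all the poles `bⱼ + n`, `n ∈ ℕ`. -/
def meijerBound (b : Fin 4 → ℂ) : ℝ := 1 + ∑ j, ‖b j‖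

/-- Meijer's `G`-function `G^{m,0}_{0,4}(b₁, b₂, b₃, b₄ | z)`, `z ≠ 0`, on its principal branch:
`(2πi)⁻¹ ∫_L` of the integrand, where `L` is the loop that begins and ends at `+∞` and encircles
all poles of `Γ(bⱼ - s)`, `j ≤ m`, once in the negative direction. With `M = meijerBound b`, the
loop runs from `+∞ - iM` to `-M - iM`, on to `-M + iM`, and back to `+∞ + iM`. -/
def meijerG (m : ℕ) (b : Fin 4 → ℂ) (z : ℂ) : ℂ :=
  (2 * Real.pi * Complex.I)⁻¹ *
    (-(∫ x in Set.Ioi (-meijerBound b),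
        meijerIntegrand m b z (x - meijerBound b * Complex.I))
      + (∫ t in (-meijerBound b)..(meijerBound b),
        meijerIntegrand m b z (-meijerBound b + t * Complex.I) * Complex.I)
      + ∫ x in Set.Ioi (-meijerBound b),
        meijerIntegrand m b z (x + meijerBound b * Complex.I))

/-- The differential expression
`τ₂(c₁,c₂) = d⁴/dr⁴ + c₁ (r⁻² d²/dr² + d²/dr² r⁻²) + c₂ r⁻⁴`. -/
def tau₂ (c₁ c₂ : ℝ) (y : ℝ → ℂ) (r : ℝ) : ℂ :=
  iteratedDeriv 4 y r
    + c₁ * (1 / (r : ℂ) ^ 2 * iteratedDeriv 2 y r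
      + iteratedDeriv 2 (fun t : ℝ => 1 / (t : ℂ) ^ 2 * y t) r)
    + c₂ / (r : ℂ) ^ 4 * y r

/-- `y` is a (classical) solution of `τ₂(c₁,c₂) y = lam y` on `(0,∞)`. -/
def IsSolution (c₁ c₂ : ℝ) (lam : ℂ) (y : ℝ → ℂ) : Prop :=
  ContDiffOn ℝ 4 y (Set.Ioi 0) ∧ ∀ r : ℝ, 0 < r → tau₂ c₁ c₂ y r = lam * y r

/-- `y` is a fundamental system of solutions of `τ₂(c₁,c₂) y = lam y` on `(0,∞)`: a basis of the
space of solutions. -/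
structure IsFundamentalSystem (c₁ c₂ : ℝ) (lam : ℂ) (y : Fin 4 → ℝ → ℂ) : Prop where
  isSolution : ∀ j, IsSolution c₁ c₂ lam (y j)
  linearIndependent : LinearIndependent ℂ fun j => (Set.Ioi (0 : ℝ)).domRestrict (y j)
  spanning : ∀ u : ℝ → ℂ, IsSolution c₁ c₂ lam u →
    ∃ a : Fin 4 → ℂ, ∀ r : ℝ, 0 < r → u r = ∑ j, a j * y j r

/-- `r ↦ r^a ₀F₃(1 + (a-b)/4, 1 + (a-c)/4, 1 + (a-d)/4 | lam r⁴ / 256)`. -/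
def hypSol (lam a b c d : ℂ) (r : ℝ) : ℂ :=
  (r : ℂ) ^ a *
    hyp0F3 (1 + (a - b) / 4) (1 + (a - c) / 4) (1 + (a - d) / 4) (lam * (r : ℂ) ^ 4 / 256)

/-- `r ↦ G^{m,0}_{0,4}(a/4, b/4, c/4, d/4 | lam r⁴ / 256)`. -/
def meijerSol (m : ℕ) (lam a b c d : ℂ) (r : ℝ) : ℂ :=
  meijerG m ![a / 4, b / 4, c / 4, d / 4] (lam * (r : ℂ) ^ 4 / 256)

end EulerFour

end

/-! In the variable `w = log z_r = log (lam / 256) + 4 log r` the equation becomes `∏ⱼ (d/dw - αⱼ/4)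
h = e^w h`, since `r⁴ τ₂ = ∏ⱼ (θ - αⱼ)` with `θ = r d/dr = 4 d/dw`. All functions in question become
entire in `w`, so the shift `T h = h(· + 2πi)` is available, and linear independence is read off
from its generalized eigenvectors.

Write `bⱼ = αⱼ/4`. The series `F_j` is an eigenvector of `T` with eigenvalue `e^{2πi bⱼ}`. A Meijer
function is a loop integral of a gamma weight against `e^{ws}`. By the reflection formula, `T -
e^{2πi bᵢ}` moves `Γ(bᵢ - s)` from the numerator into the denominator, up to a nonzero constant and
a translation by `πi` (`monodromySub_meijerTransform`). With no gamma function left in the numerator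
the integral vanishes (`meijerTransform_empty`); with the single factor `Γ(b_p - s)` it does not,
provided that no `b_k - b_p` is a positive integer, because the first residue dominates as `w → -∞`
(`exists_meijerTransform_ne_zero`). Hence `m` numerator exponents congruent modulo `ℤ`, one of them
a maximal `b_p`, give a generalized eigenvector of exact rank `m`.

In each case the four functions are ordered so that the rank of each is one more than the number of
later functions with the same eigenvalue. Applying the factors `T - μⱼ` successively then isolates
one coefficient at a time (`eq_zero_of_isJordan`), and four independent solutions of a fourth-order
linear equation span the solution space.

The rest is arithmetic of principal square roots. With `A = α₄ - α₁` and `B = α₃ - α₂`, the line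
`𝕃ₖ` means that `A` or `B` equals `4k`, and the parabola `ℙₖ` means that `A + B` or `A - B` equals
`8k`. The inequalities on `c₁` decide which alternative holds (`root_eq_of_mem_lineL`,
`root_relation_of_mem_parabolaP`). -/

namespace EulerFour

open MeasureTheory Set Filter Topology

/-! ### Exponential transforms and loop integrals -/

/-- The transform `w ↦ ∫ F e^{w γ} dμ` of a weight `F` along a map `γ`. -/
noncomputable def expTransform {X : Type*} [MeasurableSpace X] (μ : Measure X) (γ F : X → ℂ)
    (w : ℂ) : ℂ :=
  ∫ x, F x * Complex.exp (w * γ x) ∂μ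

/-- The weight `F` decays faster than every exponential of `γ`. -/
structure ExpIntegrable {X : Type*} [MeasurableSpace X] (μ : Measure X) (γ F : X → ℂ) : Prop where
  meas_exponent : AEStronglyMeasurable γ μ
  meas_weight : AEStronglyMeasurable F μ
  integrable_exp : ∀ K : ℝ, Integrable (fun x => ‖F x‖ * Real.exp (K * ‖γ x‖)) μ

theorem norm_exp_mul_le (w s : ℂ) : ‖Complex.exp (w * s)‖ ≤ Real.exp (‖w‖ * ‖s‖) := by
  rw [Complex.norm_exp]
  exact Real.exp_le_exp.2 ((Complex.re_le_norm _).trans (norm_mul_le _ _))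

theorem norm_le_exp_norm (s : ℂ) : ‖s‖ ≤ Real.exp ‖s‖ := by
  linarith [Real.add_one_le_exp ‖s‖]

namespace ExpIntegrable

variable {X : Type*} [MeasurableSpace X] {μ : Measure X} {γ F : X → ℂ}

theorem aestronglyMeasurable (h : ExpIntegrable μ γ F) (w : ℂ) :
    AEStronglyMeasurable (fun x => F x * Complex.exp (w * γ x)) μ :=
  h.meas_weight.mul (Complex.continuous_exp.comp_aestronglyMeasurable
    (h.meas_exponent.const_mul w))

theorem integrable (h : ExpIntegrable μ γ F) (w : ℂ) :
    Integrable (fun x => F x * Complex.exp (w * γ x)) μ := by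
  refine (h.integrable_exp ‖w‖).mono' (h.aestronglyMeasurable w) (ae_of_all _ fun x => ?_)
  rw [norm_mul]
  gcongr
  exact norm_exp_mul_le _ _

/-- The extra factor costs one unit of exponential rate, by `‖γ‖ ≤ e^{‖γ‖}`; as every rate is
allowed, the class is closed under differentiation in `w`. -/
theorem exponent_mul (h : ExpIntegrable μ γ F) : ExpIntegrable μ γ (fun x => γ x * F x) := by
  refine ⟨h.meas_exponent, h.meas_exponent.mul h.meas_weight, fun K => ?_⟩
  refine (h.integrable_exp (K + 1)).mono' ?_ (ae_of_all _ fun x => ?_)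
  · exact (h.meas_exponent.mul h.meas_weight).norm.mul
      (Real.continuous_exp.comp_aestronglyMeasurable (h.meas_exponent.norm.const_mul K))
  · rw [Real.norm_of_nonneg (by positivity), norm_mul, add_mul, one_mul, Real.exp_add]
    have := norm_le_exp_norm (γ x)
    calc ‖γ x‖ * ‖F x‖ * Real.exp (K * ‖γ x‖)
        ≤ Real.exp ‖γ x‖ * ‖F x‖ * Real.exp (K * ‖γ x‖) := by gcongr
      _ = _ := by ring

theorem add {G : X → ℂ} (hF : ExpIntegrable μ γ F) (hG : ExpIntegrable μ γ G) :
    ExpIntegrable μ γ (fun x => F x + G x) := by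
  refine ⟨hF.meas_exponent, hF.meas_weight.add hG.meas_weight, fun K => ?_⟩
  refine ((hF.integrable_exp K).add (hG.integrable_exp K)).mono' ?_ (ae_of_all _ fun x => ?_)
  · exact (hF.meas_weight.add hG.meas_weight).norm.mul
      (Real.continuous_exp.comp_aestronglyMeasurable (hF.meas_exponent.norm.const_mul K))
  · rw [Real.norm_of_nonneg (by positivity), Pi.add_apply, ← add_mul]
    gcongr
    exact norm_add_le _ _

theorem const_mul (hF : ExpIntegrable μ γ F) (c : ℂ) :
    ExpIntegrable μ γ (fun x => c * F x) := by
  refine ⟨hF.meas_exponent, hF.meas_weight.const_mul c, fun K => ?_⟩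
  simpa only [norm_mul, mul_assoc] using (hF.integrable_exp K).const_mul ‖c‖

/-- Differentiation under the integral sign: for `z` in the unit ball about `w`, the rate `‖w‖ + 1`
dominates. -/
theorem hasDerivAt (h : ExpIntegrable μ γ F) (w : ℂ) :
    HasDerivAt (expTransform μ γ F) (expTransform μ γ (fun x => γ x * F x) w) w := by
  refine (hasDerivAt_integral_of_dominated_loc_of_deriv_le
    (bound := fun x => ‖γ x * F x‖ * Real.exp ((‖w‖ + 1) * ‖γ x‖)) (Metric.ball_mem_nhds w one_pos)
    (Eventually.of_forall h.aestronglyMeasurable) (h.integrable w)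
    (F' := fun z x => γ x * F x * Complex.exp (z * γ x))
    (h.exponent_mul.aestronglyMeasurable w) (ae_of_all _ fun x z hz => ?_)
    (h.exponent_mul.integrable_exp _) (ae_of_all _ fun x z _ => ?_)).2
  · rw [norm_mul]
    gcongr
    refine (norm_exp_mul_le _ _).trans (Real.exp_le_exp.2 ?_)
    gcongr
    have := norm_sub_norm_le z w
    rw [mem_ball_iff_norm] at hz
    linarith
  · have hz : HasDerivAt (fun z => z * γ x) (γ x) z := by
      simpa using (hasDerivAt_id z).mul_const (γ x)
    exact (hz.cexp.const_mul (F x)).congr_deriv (by ring)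

end ExpIntegrable

/-- The integral of `f` along the loop from `+∞ - iM` via `a - iM` and `a + iM` to `+∞ + iM`. -/
noncomputable def loopIntegral (a M : ℝ) (f : ℂ → ℂ) : ℂ :=
  -(∫ x in Ioi a, f (x - M * Complex.I)) + (∫ t in (-M)..M, f (a + t * Complex.I) * Complex.I)
    + ∫ x in Ioi a, f (x + M * Complex.I)

/-- The transform `w ↦ ∫_L F(s) e^{ws} ds` along the loop of `loopIntegral`. -/
noncomputable def loopTransform (a M : ℝ) (F : ℂ → ℂ) (w : ℂ) : ℂ :=
  loopIntegral a M fun s => F s * Complex.exp (w * s)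

/-- `F` decays faster than every exponential along the loop of `loopIntegral`. -/
structure LoopIntegrable (a M : ℝ) (F : ℂ → ℂ) : Prop where
  lower : ExpIntegrable (volume.restrict (Ioi a)) (fun x : ℝ => x - M * Complex.I)
    (fun x => F (x - M * Complex.I))
  left : ExpIntegrable (volume.restrict (Ioc (-M) M)) (fun t : ℝ => a + t * Complex.I)
    (fun t => F (a + t * Complex.I))
  upper : ExpIntegrable (volume.restrict (Ioi a)) (fun x : ℝ => x + M * Complex.I)
    (fun x => F (x + M * Complex.I))

theorem loopTransform_eq {a M : ℝ} (hM : 0 ≤ M) (F : ℂ → ℂ) (w : ℂ) :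
    loopTransform a M F w =
      -expTransform (volume.restrict (Ioi a)) (fun x : ℝ => x - M * Complex.I)
          (fun x => F (x - M * Complex.I)) w
        + expTransform (volume.restrict (Ioc (-M) M)) (fun t : ℝ => a + t * Complex.I)
          (fun t => F (a + t * Complex.I)) w * Complex.I
        + expTransform (volume.restrict (Ioi a)) (fun x : ℝ => x + M * Complex.I)
          (fun x => F (x + M * Complex.I)) w := by
  simp only [loopTransform, loopIntegral, expTransform]
  rw [intervalIntegral.integral_of_le (by linarith), integral_mul_const]

namespace LoopIntegrable

variable {a M : ℝ} {F G : ℂ → ℂ}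

theorem id_mul (h : LoopIntegrable a M F) : LoopIntegrable a M (fun s => s * F s) :=
  ⟨h.lower.exponent_mul, h.left.exponent_mul, h.upper.exponent_mul⟩

theorem add (hF : LoopIntegrable a M F) (hG : LoopIntegrable a M G) :
    LoopIntegrable a M (fun s => F s + G s) :=
  ⟨hF.lower.add hG.lower, hF.left.add hG.left, hF.upper.add hG.upper⟩

theorem const_mul (hF : LoopIntegrable a M F) (c : ℂ) : LoopIntegrable a M (fun s => c * F s) :=
  ⟨hF.lower.const_mul c, hF.left.const_mul c, hF.upper.const_mul c⟩

theorem hasDerivAt (hM : 0 ≤ M) (h : LoopIntegrable a M F) (w : ℂ) :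
    HasDerivAt (loopTransform a M F) (loopTransform a M (fun s => s * F s) w) w := by
  rw [loopTransform_eq hM, funext (loopTransform_eq hM F)]
  exact ((h.lower.hasDerivAt w).neg.add ((h.left.hasDerivAt w).mul_const _)).add
    (h.upper.hasDerivAt w)

end LoopIntegrable

theorem expTransform_add {X : Type*} [MeasurableSpace X] {μ : Measure X} {γ F G : X → ℂ}
    (hF : ExpIntegrable μ γ F) (hG : ExpIntegrable μ γ G) (w : ℂ) :
    expTransform μ γ (fun x => F x + G x) w = expTransform μ γ F w + expTransform μ γ G w := by
  simp only [expTransform, add_mul]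
  exact integral_add (hF.integrable w) (hG.integrable w)

theorem expTransform_const_mul {X : Type*} [MeasurableSpace X] (μ : Measure X) (γ F : X → ℂ)
    (c w : ℂ) : expTransform μ γ (fun x => c * F x) w = c * expTransform μ γ F w := by
  simp only [expTransform, mul_assoc]
  exact integral_const_mul _ _

theorem loopTransform_add {a M : ℝ} (hM : 0 ≤ M) {F G : ℂ → ℂ} (hF : LoopIntegrable a M F)
    (hG : LoopIntegrable a M G) (w : ℂ) :
    loopTransform a M (fun s => F s + G s) w = loopTransform a M F w + loopTransform a M G w := by
  simp only [loopTransform_eq hM, expTransform_add hF.lower hG.lower,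
    expTransform_add hF.left hG.left, expTransform_add hF.upper hG.upper]
  ring

theorem loopIntegral_const_mul (a M : ℝ) (f : ℂ → ℂ) (c : ℂ) :
    loopIntegral a M (fun s => c * f s) = c * loopIntegral a M f := by
  simp only [loopIntegral, mul_assoc, integral_const_mul, intervalIntegral.integral_const_mul]
  ring

theorem loopTransform_const_mul (a M : ℝ) (F : ℂ → ℂ) (c w : ℂ) :
    loopTransform a M (fun s => c * F s) w = c * loopTransform a M F w := by
  simp only [loopTransform, mul_assoc, loopIntegral_const_mul]

/-- Two integrands that agree on the loop have the same integral. -/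
theorem loopIntegral_congr {a M : ℝ} {f g : ℂ → ℂ} (hM : 0 ≤ M)
    (h : ∀ s : ℂ, (s.im = -M ∨ s.im = M ∨ (s.re = a ∧ |s.im| ≤ M)) → f s = g s) :
    loopIntegral a M f = loopIntegral a M g := by
  have h1 : ∀ x : ℝ, f (x - M * Complex.I) = g (x - M * Complex.I) := fun x =>
    h _ (Or.inl (by simp))
  have h2 : ∀ x : ℝ, f (x + M * Complex.I) = g (x + M * Complex.I) := fun x =>
    h _ (Or.inr (Or.inl (by simp)))
  have h3 : ∫ t in (-M)..M, f (a + t * Complex.I) * Complex.I =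
      ∫ t in (-M)..M, g (a + t * Complex.I) * Complex.I := by
    refine intervalIntegral.integral_congr fun t ht => ?_
    rw [uIcc_of_le (by linarith)] at ht
    rw [h _ (Or.inr (Or.inr ⟨by simp, by simpa [abs_le] using ht⟩))]
  simp only [loopIntegral, h1, h2, h3]

theorem loopIntegral_comp_sub_one (a M : ℝ) (f : ℂ → ℂ) :
    loopIntegral a M (fun s => f (s - 1)) = loopIntegral (a - 1) M f := by
  have h : ∀ g : ℝ → ℂ, ∫ x in Ioi a, g (x - 1) = ∫ x in Ioi (a - 1), g x := fun g => by
    rw [← integral_indicator measurableSet_Ioi, ← integral_indicator measurableSet_Ioi,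
      ← integral_sub_right_eq_self ((Ioi (a - 1)).indicator g) (1 : ℝ)]
    congr 1 with x
    simp [indicator]
  have h1 := h fun x => f (x - M * Complex.I)
  have h2 := h fun x => f (x + M * Complex.I)
  push_cast at h1 h2
  simp only [loopIntegral, ← h1, ← h2, Complex.ofReal_sub, Complex.ofReal_one]
  simp only [sub_right_comm, add_sub_right_comm]

end EulerFour

/-! ### Cauchy's theorem and residues on rectangles -/

namespace EulerFour

open MeasureTheory Set Filter Topology

/-- The integral of `f` over the positively oriented boundary of `[a, a'] × [-M, M]`. -/
noncomputable def rectIntegral (a a' M : ℝ) (f : ℂ → ℂ) : ℂ :=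
  (∫ x in a..a', f (x - M * Complex.I)) - (∫ x in a..a', f (x + M * Complex.I))
    + (∫ t in (-M)..M, f (a' + t * Complex.I) * Complex.I)
    - ∫ t in (-M)..M, f (a + t * Complex.I) * Complex.I

/-- The parts of the rays beyond `a'` cancel. The loop runs clockwise and the rectangle
counterclockwise, whence the minus sign. -/
theorem loopIntegral_sub_loopIntegral {a a' M : ℝ} (h : a ≤ a') {f : ℂ → ℂ}
    (hl : IntegrableOn (fun x : ℝ => f (x - M * Complex.I)) (Ioi a))
    (hu : IntegrableOn (fun x : ℝ => f (x + M * Complex.I)) (Ioi a)) :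
    loopIntegral a M f - loopIntegral a' M f = -rectIntegral a a' M f := by
  rw [loopIntegral, loopIntegral, rectIntegral,
    ← intervalIntegral.integral_Ioi_sub_Ioi hl h, ← intervalIntegral.integral_Ioi_sub_Ioi hu h]
  ring

theorem rectIntegral_eq_zero {a a' M : ℝ} (h : a ≤ a') (hM : 0 ≤ M) {f : ℂ → ℂ}
    (hf : DifferentiableOn ℂ f (Icc a a' ×ℂ Icc (-M) M)) : rectIntegral a a' M f = 0 := by
  have := Complex.integral_boundary_rect_eq_zero_of_differentiableOn f (⟨a, -M⟩ : ℂ) ⟨a', M⟩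
    (by simpa only [uIcc_of_le h, uIcc_of_le (by linarith : -M ≤ M)] using hf)
  rw [rectIntegral, ← this]
  simp only [intervalIntegral.integral_mul_const, smul_eq_mul, Complex.ofReal_neg, neg_mul,
    ← sub_eq_add_neg]
  ring

theorem log_sub_log_neg_I_mul {z : ℂ} (hre : 0 < z.re) :
    Complex.log z - Complex.log (-Complex.I * z) = Real.pi / 2 * Complex.I := by
  have hz : z ≠ 0 := fun h => by simp [h] at hre
  have harg := Complex.abs_arg_lt_pi_div_two_iff.2 (Or.inl hre)
  rw [abs_lt] at harg
  rw [(Complex.log_mul_eq_add_log_iff (neg_ne_zero.2 Complex.I_ne_zero) hz).2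
    (by rw [Complex.arg_neg_I]; constructor <;> linarith [Real.pi_pos]), Complex.log_neg_I]
  ring

/-- The constant `c` rotates the segment into the right half-plane, where the principal logarithm is
a primitive without a cut. -/
theorem integral_inv_segment {x y : ℝ} {u v c : ℂ} (hc : c ≠ 0)
    (hre : ∀ t ∈ uIcc x y, 0 < (c * (u + t * v)).re) :
    ∫ t in x..y, (u + t * v)⁻¹ * v =
      Complex.log (c * (u + y * v)) - Complex.log (c * (u + x * v)) := by
  have hne : ∀ t ∈ uIcc x y, u + t * v ≠ 0 := fun t ht h0 => by simpa [h0] using hre t ht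
  refine intervalIntegral.integral_eq_sub_of_hasDerivAt
    (f := fun t : ℝ => Complex.log (c * (u + t * v))) (fun t ht => ?_)
    (ContinuousOn.intervalIntegrable ?_)
  · have h1 : HasDerivAt (fun s : ℝ => c * (u + s * v)) (c * v) t := by
      have := (((Complex.ofRealCLM.hasDerivAt (x := t)).mul_const v).const_add u).const_mul c
      simpa using this
    refine (h1.clog_real (Or.inl (hre t ht))).congr_deriv ?_
    have := hne t ht
    field_simp
  · refine ContinuousOn.mul (ContinuousOn.inv₀ (by fun_prop) hne) continuousOn_const

/-- Each side gets its own rotation from `1, i, -1, -i`. At every corner two neighbouring logarithms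
differ by `πi/2`, and the four jumps add up to `2πi`. -/
theorem rectIntegral_inv {a a' M : ℝ} {p : ℂ} (h1 : a < p.re) (h2 : p.re < a') (h3 : |p.im| < M) :
    rectIntegral a a' M (fun s => (s - p)⁻¹) = 2 * Real.pi * Complex.I := by
  rw [abs_lt] at h3
  have hle : a ≤ a' := by linarith
  have hMM : -M ≤ M := by linarith
  have e1 := integral_inv_segment (x := a) (y := a') (u := -(M * Complex.I) - p) (v := 1)
    Complex.I_ne_zero (fun t _ => by simp; linarith)
  have e2 := integral_inv_segment (x := a) (y := a') (u := M * Complex.I - p) (v := 1)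
    (neg_ne_zero.2 Complex.I_ne_zero) (fun t _ => by simp; linarith)
  have e3 := integral_inv_segment (x := -M) (y := M) (u := a' - p) (v := Complex.I)
    one_ne_zero (fun t _ => by simp; linarith)
  have e4 := integral_inv_segment (x := -M) (y := M) (u := a - p) (v := Complex.I)
    (neg_ne_zero.2 one_ne_zero) (fun t _ => by simp; linarith)
  have k1 := log_sub_log_neg_I_mul (z := Complex.I * (-(M * Complex.I) - p + a')) (by
    simp; linarith)
  have k2 := log_sub_log_neg_I_mul (z := a' - p + M * Complex.I) (by simp; linarith)
  have k3 := log_sub_log_neg_I_mul (z := -Complex.I * (M * Complex.I - p + a)) (by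
    simp; linarith)
  have k4 := log_sub_log_neg_I_mul (z := -(a - p + (-M) * Complex.I)) (by simp; linarith)
  rw [rectIntegral]
  have i1 : ∀ x : ℝ, (x - M * Complex.I - p) = (-(M * Complex.I) - p + x * 1) := fun x => by ring
  have i2 : ∀ x : ℝ, (x + M * Complex.I - p) = (M * Complex.I - p + x * 1) := fun x => by ring
  have i3 : ∀ b t : ℝ, (b + t * Complex.I - p) = (b - p + t * Complex.I) := fun b t => by ring
  simp only [i1, i2, i3]
  simp only [mul_one] at e1 e2 ⊢
  rw [e1, e2, e3, e4]
  have r1 : -Complex.I * (Complex.I * (-(M * Complex.I) - p + a')) =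
      1 * (a' - p + (-M) * Complex.I) := by
    linear_combination (-(-(M * Complex.I) - p + a')) * Complex.I_mul_I
  have r3 : -Complex.I * (-Complex.I * (M * Complex.I - p + a)) =
      -1 * (a - p + M * Complex.I) := by
    linear_combination ((M * Complex.I - p + a)) * Complex.I_mul_I
  have r2 : -Complex.I * (a' - p + M * Complex.I) = -Complex.I * (M * Complex.I - p + a') := by ring
  have r4 : -Complex.I * -(a - p + (-M) * Complex.I) = Complex.I * (-(M * Complex.I) - p + a) := by
    ring
  have r5 : -(a - p + (-M) * Complex.I) = -1 * (a - p + (-M) * Complex.I) := by ring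
  rw [r1] at k1
  rw [r2] at k2
  rw [r3] at k3
  rw [r4, r5] at k4
  simp only [one_mul] at k1 ⊢
  push_cast
  linear_combination k1 + k2 + k3 + k4

/-- **Residue theorem** for a simple pole in a rectangle. -/
theorem rectIntegral_div {a a' M : ℝ} {p : ℂ} (h1 : a < p.re) (h2 : p.re < a') (h3 : |p.im| < M)
    {H f : ℂ → ℂ} (hH : DifferentiableOn ℂ H (Icc a a' ×ℂ Icc (-M) M))
    (hf : ∀ s ≠ p, f s = H s * (s - p)⁻¹) :
    rectIntegral a a' M f = 2 * Real.pi * Complex.I * H p := by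
  have h3' := abs_lt.1 h3
  have hle : a ≤ a' := by linarith
  have hMM : -M ≤ M := by linarith
  have hmem : Icc a a' ×ℂ Icc (-M) M ∈ 𝓝 p := by
    refine mem_of_superset ((isOpen_Ioo.reProdIm isOpen_Ioo).mem_nhds
      (⟨⟨h1, h2⟩, h3'⟩ : p ∈ Ioo a a' ×ℂ Ioo (-M) M)) ?_
    exact inter_subset_inter (preimage_mono Ioo_subset_Icc_self) (preimage_mono Ioo_subset_Icc_self)
  -- `H(s)/(s - p)` is the holomorphic difference quotient plus `H(p)/(s - p)`. The former
  -- integrates to zero, the latter to `2πi H(p)`.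
  have hd : DifferentiableOn ℂ (dslope H p) (Icc a a' ×ℂ Icc (-M) M) :=
    (Complex.differentiableOn_dslope hmem).2 hH
  have hsplit : ∀ s ≠ p, f s = dslope H p s + H p * (s - p)⁻¹ := fun s hs => by
    have : s - p ≠ 0 := sub_ne_zero.2 hs
    rw [hf s hs, dslope_of_ne _ hs, slope_def_field]
    field_simp
    ring
  have hz := rectIntegral_eq_zero hle (by linarith) hd
  have hi := rectIntegral_inv h1 h2 h3
  have hcont := hd.continuousOn
  have hor : ∀ m ∈ Icc (-M) M, m ≠ p.im →
      (∫ x in a..a', f (x + m * Complex.I)) = (∫ x in a..a', dslope H p (x + m * Complex.I))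
        + H p * ∫ x in a..a', (x + m * Complex.I - p)⁻¹ := fun m hm hmp => by
    have hne : ∀ x : ℝ, (x : ℂ) + m * Complex.I ≠ p := fun x hx => hmp (by simp [← hx])
    rw [← intervalIntegral.integral_const_mul, ← intervalIntegral.integral_add]
    · exact intervalIntegral.integral_congr fun x _ => hsplit _ (hne x)
    · refine ContinuousOn.intervalIntegrable (hcont.comp (by fun_prop) fun x hx => ?_)
      rw [uIcc_of_le hle] at hx
      simp [Complex.mem_reProdIm, hx.1, hx.2, hm.1, hm.2]
    · refine ContinuousOn.intervalIntegrable (continuousOn_const.mul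
        (ContinuousOn.inv₀ (by fun_prop) fun x _ => sub_ne_zero.2 (hne x)))
  have ver : ∀ m ∈ Icc a a', m ≠ p.re →
      (∫ t in (-M)..M, f (m + t * Complex.I) * Complex.I) =
        (∫ t in (-M)..M, dslope H p (m + t * Complex.I) * Complex.I)
        + H p * ∫ t in (-M)..M, (m + t * Complex.I - p)⁻¹ * Complex.I := fun m hm hmp => by
    have hne : ∀ t : ℝ, (m : ℂ) + t * Complex.I ≠ p := fun t ht => hmp (by simp [← ht])
    rw [← intervalIntegral.integral_const_mul, ← intervalIntegral.integral_add]
    · refine intervalIntegral.integral_congr fun t _ => ?_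
      simp only [hsplit _ (hne t)]
      ring
    · refine ContinuousOn.intervalIntegrable ((hcont.comp (by fun_prop) fun t ht => ?_).mul
        continuousOn_const)
      rw [uIcc_of_le hMM] at ht
      simp [Complex.mem_reProdIm, ht.1, ht.2, hm.1, hm.2]
    · refine ContinuousOn.intervalIntegrable (continuousOn_const.mul ((ContinuousOn.inv₀
        (by fun_prop) fun x _ => sub_ne_zero.2 (hne x)).mul continuousOn_const))
  have v1 := ver a ⟨le_rfl, hle⟩ h1.ne
  have v2 := ver a' ⟨hle, le_rfl⟩ h2.ne'
  have u1 := hor (-M) ⟨le_rfl, hMM⟩ h3'.1.ne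
  have u2 := hor M ⟨hMM, le_rfl⟩ h3'.2.ne'
  simp only [Complex.ofReal_neg, neg_mul, ← sub_eq_add_neg] at u1
  simp only [rectIntegral] at hz hi ⊢
  rw [u1, u2, v1, v2]
  linear_combination hz + H p * hi

end EulerFour

/-! ### The gamma weight: recursion, reflection and decay -/

namespace EulerFour

open MeasureTheory Set Filter Topology

/-- The product of `Γ(bⱼ - s)` over `j ∈ σ` and of `1 / Γ(1 - bⱼ + s)` over `j ∉ σ`. -/
noncomputable def gammaWeight (σ : Finset (Fin 4)) (b : Fin 4 → ℂ) (s : ℂ) : ℂ :=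
  ∏ j, if j ∈ σ then Complex.Gamma (b j - s) else (Complex.Gamma (1 - b j + s))⁻¹

/-- This is `Γ(z + 1) = z Γ(z)` in each factor; a numerator factor contains `-s`, which produces one
sign per element of `σ`. Under the loop integral the recursion becomes the differential equation. -/
theorem gammaWeight_shift {σ : Finset (Fin 4)} {b : Fin 4 → ℂ} {s : ℂ} (h : ∀ j ∈ σ, s ≠ b j) :
    (∏ j, (s - b j)) * gammaWeight σ b s = (-1) ^ σ.card * gammaWeight σ b (s - 1) := by
  have hc : (-1 : ℂ) ^ σ.card = ∏ j : Fin 4, if j ∈ σ then -1 else 1 := by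
    rw [Finset.prod_ite_mem, Finset.univ_inter, Finset.prod_const]
  rw [hc, gammaWeight, gammaWeight, ← Finset.prod_mul_distrib, ← Finset.prod_mul_distrib]
  refine Finset.prod_congr rfl fun j _ => ?_
  split_ifs with hj
  · have h1 := Complex.Gamma_add_one (b j - s) (sub_ne_zero.2 (h j hj).symm)
    rw [show b j - (s - 1) = b j - s + 1 by ring, h1]
    ring
  · have h1 := Complex.one_div_Gamma_eq_self_mul_one_div_Gamma_add_one (s - b j)
    rw [show 1 - b j + s = s - b j + 1 by ring, show 1 - b j + (s - 1) = s - b j by ring, h1]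
    ring

theorem differentiableAt_gammaWeight {σ : Finset (Fin 4)} {b : Fin 4 → ℂ} {s : ℂ}
    (h : ∀ j ∈ σ, ∀ n : ℕ, s ≠ b j + n) : DifferentiableAt ℂ (gammaWeight σ b) s := by
  unfold gammaWeight
  refine DifferentiableAt.fun_finsetProd fun j _ => ?_
  split_ifs with hj
  · refine DifferentiableAt.fun_comp' (g := Complex.Gamma) (f := fun s => b j - s) s
      (Complex.differentiableAt_Gamma _ fun n hn => h j hj n ?_) (by fun_prop)
    linear_combination -hn
  · exact DifferentiableAt.fun_comp' (g := fun z => (Complex.Gamma z)⁻¹)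
      (f := fun s => 1 - b j + s) s (Complex.differentiable_one_div_Gamma _) (by fun_prop)

/-- The difference of exponentials is `-2i sin(π(b - s)) e^{πi(b + s)}`, and the reflection formula
absorbs the sine into `Γ(b - s)`. -/
theorem Gamma_mul_exp_sub_exp {b s : ℂ} (h : ∀ n : ℕ, s ≠ b + n) :
    Complex.Gamma (b - s) * (Complex.exp (2 * Real.pi * Complex.I * s)
        - Complex.exp (2 * Real.pi * Complex.I * b)) =
      -2 * Real.pi * Complex.I * Complex.exp (Real.pi * Complex.I * b)
        * ((Complex.Gamma (1 - b + s))⁻¹ * Complex.exp (Real.pi * Complex.I * s)) := by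
  have hpi : (Real.pi : ℂ) ≠ 0 := Complex.ofReal_ne_zero.2 Real.pi_ne_zero
  have h0 : Complex.Gamma (b - s) ≠ 0 := Complex.Gamma_ne_zero fun n hn => h n (by
    linear_combination -hn)
  have hexp : Complex.exp (2 * Real.pi * Complex.I * s)
      - Complex.exp (2 * Real.pi * Complex.I * b) =
      -(2 * Complex.I * Complex.sin (Real.pi * (b - s)) * Complex.exp (Real.pi * Complex.I * b)
        * Complex.exp (Real.pi * Complex.I * s)) := by
    rw [Complex.sin, show 2 * Real.pi * Complex.I * s = Real.pi * Complex.I * s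
      + Real.pi * Complex.I * s by ring, show 2 * Real.pi * Complex.I * b = Real.pi * Complex.I * b
      + Real.pi * Complex.I * b by ring, show -(Real.pi * (b - s)) * Complex.I =
      Real.pi * Complex.I * s - Real.pi * Complex.I * b by ring,
      show Real.pi * (b - s) * Complex.I = Real.pi * Complex.I * b - Real.pi * Complex.I * s by ring]
    simp only [Complex.exp_add, Complex.exp_sub]
    have e1 := Complex.exp_ne_zero (Real.pi * Complex.I * s)
    have e2 := Complex.exp_ne_zero (Real.pi * Complex.I * b)
    field_simp
    linear_combination (Complex.exp (Real.pi * Complex.I * s) ^ 2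
      - Complex.exp (Real.pi * Complex.I * b) ^ 2) * Complex.I_mul_I
  have hrefl := Complex.Gamma_mul_Gamma_one_sub (b - s)
  rw [show 1 - (b - s) = 1 - b + s by ring] at hrefl
  rw [hexp]
  -- A value `0` of `Complex.Gamma` marks a pole; there the sine vanishes too, and both sides are
  -- zero.
  rcases eq_or_ne (Complex.Gamma (1 - b + s)) 0 with hz | hz
  · have : Complex.sin (Real.pi * (b - s)) = 0 := by
      rw [hz, mul_zero] at hrefl
      rcases div_eq_zero_iff.1 hrefl.symm with h | h
      · exact absurd h hpi
      · exact h
    rw [hz, this]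
    simp
  · have hs : Complex.sin (Real.pi * (b - s)) ≠ 0 := fun hs => by
      rw [hs, div_zero] at hrefl
      exact mul_ne_zero h0 hz hrefl
    rw [eq_div_iff hs] at hrefl
    generalize Complex.sin (Real.pi * (b - s)) = S at *
    field_simp
    linear_combination -hrefl

theorem gammaWeight_mul_exp_sub_exp {σ : Finset (Fin 4)} {b : Fin 4 → ℂ} {i : Fin 4} (hi : i ∈ σ)
    {s : ℂ} (h : ∀ n : ℕ, s ≠ b i + n) :
    gammaWeight σ b s * (Complex.exp (2 * Real.pi * Complex.I * s)
        - Complex.exp (2 * Real.pi * Complex.I * b i)) =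
      -2 * Real.pi * Complex.I * Complex.exp (Real.pi * Complex.I * b i)
        * (gammaWeight (σ.erase i) b s * Complex.exp (Real.pi * Complex.I * s)) := by
  have hrest : ∀ j ∈ Finset.univ.erase i,
      (if j ∈ σ then Complex.Gamma (b j - s) else (Complex.Gamma (1 - b j + s))⁻¹) =
      if j ∈ σ.erase i then Complex.Gamma (b j - s) else (Complex.Gamma (1 - b j + s))⁻¹ :=
    fun j hj => by simp [Finset.ne_of_mem_erase hj]
  rw [gammaWeight, gammaWeight, ← Finset.mul_prod_erase _ _ (Finset.mem_univ i),
    ← Finset.mul_prod_erase Finset.univ (fun j => if j ∈ σ.erase i then Complex.Gamma (b j - s)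
      else (Complex.Gamma (1 - b j + s))⁻¹) (Finset.mem_univ i), Finset.prod_congr rfl hrest]
  simp only [hi, if_true, Finset.mem_erase, ne_eq, not_true_eq_false, false_and, if_false]
  linear_combination (∏ x ∈ Finset.univ.erase i, if ¬x = i ∧ x ∈ σ then Complex.Gamma (b x - s)
      else (Complex.Gamma (1 - b x + s))⁻¹) * Gamma_mul_exp_sub_exp h

/-- No Stirling formula is needed: far to the right one step of the recursion divides the weight by
`∏ ‖s - bⱼ‖ ≥ e^K`, so a bound on a compact piece propagates by induction over unit strips. -/
theorem norm_gammaWeight_le {σ : Finset (Fin 4)} {b : Fin 4 → ℂ} {a : ℝ} {Y : Set ℝ}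
    (hY : IsCompact Y)
    (h : ∀ s : ℂ, a ≤ s.re → s.im ∈ Y → ∀ j ∈ σ, ∀ n : ℕ, s ≠ b j + n) (K : ℝ) :
    ∃ C, ∀ s : ℂ, a ≤ s.re → s.im ∈ Y → ‖gammaWeight σ b s‖ ≤ C * Real.exp (-K * s.re) := by
  -- Beyond `X` every `‖s - bⱼ‖` is at least `e^{|K|}`, hence the product of the four is at least
  -- `e^K`.
  set X := max a (∑ j, ‖b j‖ + Real.exp |K|) with hX
  have hcompact : IsCompact (Icc a (X + 1) ×ℂ Y) := isCompact_Icc.reProdIm hY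
  have hcont : ContinuousOn (fun s : ℂ => ‖gammaWeight σ b s‖ * Real.exp (K * s.re))
      (Icc a (X + 1) ×ℂ Y) := by
    refine ContinuousOn.mul (ContinuousOn.norm fun s hs => ?_) (by fun_prop)
    exact (differentiableAt_gammaWeight (h s hs.1.1 hs.2)).continuousAt.continuousWithinAt
  obtain ⟨C, hC⟩ := hcompact.exists_bound_of_continuousOn hcont
  have key : ∀ n : ℕ, ∀ s : ℂ, a ≤ s.re → s.im ∈ Y → s.re ≤ X + 1 + n →
      ‖gammaWeight σ b s‖ * Real.exp (K * s.re) ≤ C := by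
    intro n
    induction n with
    | zero =>
      intro s hs hsY hle
      exact (le_abs_self _).trans (hC s ⟨⟨hs, by simpa using hle⟩, hsY⟩)
    | succ n ih =>
      intro s hs hsY hle
      rcases le_or_gt s.re (X + 1) with hlt | hgt
      · exact (le_abs_self _).trans (hC s ⟨⟨hs, hlt⟩, hsY⟩)
      have hXa : a ≤ X := le_max_left _ _
      have hi := ih (s - 1) (by simp; linarith) (by simpa using hsY)
        (by push_cast at hle; simp; linarith)
      have hfac : ∀ j, Real.exp |K| ≤ ‖s - b j‖ := fun j => by
        have h1 : ∑ j, ‖b j‖ + Real.exp |K| ≤ X := le_max_right _ _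
        have h2 : ‖b j‖ ≤ ∑ j, ‖b j‖ :=
          Finset.single_le_sum (f := fun j => ‖b j‖) (fun _ _ => norm_nonneg _) (Finset.mem_univ j)
        have h3 := (Complex.re_le_norm s)
        have h4 := norm_sub_norm_le s (b j)
        linarith
      have hprod : Real.exp K ≤ ∏ j, ‖s - b j‖ := by
        have h1 : ∏ _j : Fin 4, Real.exp |K| ≤ ∏ j, ‖s - b j‖ :=
          Finset.prod_le_prod (fun _ _ => (Real.exp_pos _).le) fun j _ => hfac j
        refine le_trans ?_ h1
        rw [Finset.prod_const, Finset.card_univ, Fintype.card_fin, ← Real.exp_nat_mul]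
        refine Real.exp_le_exp.2 ?_
        have := le_abs_self K
        have := abs_nonneg K
        push_cast
        linarith
      have hshift := congrArg norm (gammaWeight_shift (σ := σ) (b := b) (s := s)
        fun j hj hb => h s hs hsY j hj 0 (by simpa using hb))
      simp only [norm_mul, norm_prod, norm_pow, norm_neg, norm_one, one_pow, one_mul] at hshift
      have hre : K * s.re = K + K * (s - 1).re := by simp; ring
      calc ‖gammaWeight σ b s‖ * Real.exp (K * s.re)
          = Real.exp K * ‖gammaWeight σ b s‖ * Real.exp (K * (s - 1).re) := by
            rw [hre, Real.exp_add]; ring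
        _ ≤ (∏ j, ‖s - b j‖) * ‖gammaWeight σ b s‖ * Real.exp (K * (s - 1).re) := by gcongr
        _ ≤ C := by rw [hshift]; exact hi
  refine ⟨C, fun s hs hsY => ?_⟩
  obtain ⟨n, hn⟩ := exists_nat_ge (s.re - (X + 1))
  have := key n s hs hsY (by linarith)
  rw [neg_mul, Real.exp_neg, ← div_eq_mul_inv, le_div_iff₀ (Real.exp_pos _)]
  exact this

theorem expIntegrable_ray {a c : ℝ} {F : ℂ → ℂ}
    (hF : ContinuousOn (fun x : ℝ => F (x + c * Complex.I)) (Ioi a))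
    (h : ∀ K : ℝ, ∃ C, ∀ x : ℝ, a ≤ x → ‖F (x + c * Complex.I)‖ ≤ C * Real.exp (-K * x)) :
    ExpIntegrable (volume.restrict (Ioi a)) (fun x : ℝ => x + c * Complex.I)
      (fun x => F (x + c * Complex.I)) := by
  have hγ : Continuous fun x : ℝ => (x : ℂ) + c * Complex.I := by fun_prop
  have hm := hF.aestronglyMeasurable measurableSet_Ioi (μ := volume)
  refine ⟨hγ.aestronglyMeasurable, hm, fun K => ?_⟩
  -- On the ray the norm of the exponent is at most `x` plus a constant, so the rate `|K| + 1`
  -- leaves an integrable `e^{-x}`.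
  obtain ⟨C, hC⟩ := h (|K| + 1)
  have hint : Integrable (fun x : ℝ => C * Real.exp (|K| * (2 * |a| + |c|)) * Real.exp (-x))
      (volume.restrict (Ioi a)) := (integrableOn_exp_neg_Ioi a).const_mul _
  refine hint.mono' (hm.norm.mul (by fun_prop)) ?_
  refine (ae_restrict_iff' measurableSet_Ioi).2 (ae_of_all _ fun x hx => ?_)
  have hx' : a < x := hx
  rw [Real.norm_of_nonneg (by positivity)]
  have hn : ‖(x : ℂ) + c * Complex.I‖ ≤ x + (2 * |a| + |c|) := by
    have h1 : ‖(x : ℂ) + c * Complex.I‖ ≤ |x| + |c| := by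
      refine (norm_add_le _ _).trans (by simp)
    have h2 : |x| ≤ x + 2 * |a| := by
      rcases abs_cases x with h | h <;> rcases abs_cases a with h' | h' <;> linarith
    linarith
  have hexp : Real.exp (K * ‖(x : ℂ) + c * Complex.I‖) ≤
      Real.exp (|K| * (x + (2 * |a| + |c|))) := by
    refine Real.exp_le_exp.2 ?_
    calc K * ‖(x : ℂ) + c * Complex.I‖ ≤ |K| * ‖(x : ℂ) + c * Complex.I‖ := by
          gcongr; exact le_abs_self K
      _ ≤ _ := by gcongr
  calc ‖F (x + c * Complex.I)‖ * Real.exp (K * ‖(x : ℂ) + c * Complex.I‖)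
      ≤ (C * Real.exp (-(|K| + 1) * x)) * Real.exp (|K| * (x + (2 * |a| + |c|))) :=
        mul_le_mul (hC x hx'.le) hexp (Real.exp_pos _).le ((norm_nonneg _).trans (hC x hx'.le))
    _ = C * Real.exp (|K| * (2 * |a| + |c|)) * Real.exp (-x) := by
        rw [mul_assoc, mul_assoc, ← Real.exp_add, ← Real.exp_add]
        ring_nf

theorem expIntegrable_segment {a M : ℝ} {F : ℂ → ℂ}
    (hF : ContinuousOn (fun t : ℝ => F (a + t * Complex.I)) (Icc (-M) M)) :
    ExpIntegrable (volume.restrict (Ioc (-M) M)) (fun t : ℝ => a + t * Complex.I)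
      (fun t => F (a + t * Complex.I)) := by
  have hγ : Continuous fun t : ℝ => (a : ℂ) + t * Complex.I := by fun_prop
  refine ⟨hγ.aestronglyMeasurable,
    (hF.mono Ioc_subset_Icc_self).aestronglyMeasurable measurableSet_Ioc, fun K => ?_⟩
  exact ((hF.norm.mul (by fun_prop)).integrableOn_Icc).mono_set Ioc_subset_Icc_self

/-- The gamma weight decays faster than every exponential along a loop that avoids its poles. -/
theorem loopIntegrable_gammaWeight {σ : Finset (Fin 4)} {b : Fin 4 → ℂ} {a M : ℝ}
    (hM : 0 ≤ M) (h1 : ∀ s : ℂ, |s.im| = M → ∀ j ∈ σ, ∀ n : ℕ, s ≠ b j + n)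
    (h2 : ∀ s : ℂ, s.re = a → ∀ j ∈ σ, ∀ n : ℕ, s ≠ b j + n) :
    LoopIntegrable a M (gammaWeight σ b) := by
  have ray : ∀ c : ℝ, |c| = M → ExpIntegrable (volume.restrict (Ioi a))
      (fun x : ℝ => x + c * Complex.I) (fun x => gammaWeight σ b (x + c * Complex.I)) := by
    intro c hc
    refine expIntegrable_ray (fun x _ => ?_) fun K => ?_
    · exact ((differentiableAt_gammaWeight (h1 _ (by simpa using hc))).continuousAt.comp
        (f := fun x : ℝ => (x : ℂ) + c * Complex.I) (by fun_prop)).continuousWithinAt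
    · obtain ⟨C, hC⟩ := norm_gammaWeight_le (σ := σ) (b := b) (a := a) (Y := {c})
        isCompact_singleton (fun s _ hs => h1 s (by rw [mem_singleton_iff.1 hs, hc])) K
      exact ⟨C, fun x hx => by simpa using hC (x + c * Complex.I) (by simpa using hx) (by simp)⟩
  refine ⟨?_, expIntegrable_segment fun t _ => ?_, ray M (abs_of_nonneg hM)⟩
  · simpa [sub_eq_add_neg] using ray (-M) (by rw [abs_neg, abs_of_nonneg hM])
  · exact ((differentiableAt_gammaWeight (h2 _ (by simp))).continuousAt.comp
        (f := fun t : ℝ => (a : ℂ) + t * Complex.I) (by fun_prop)).continuousWithinAt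

end EulerFour

/-! ### Meijer's function as an entire function of the logarithm -/

namespace EulerFour

open MeasureTheory Set Filter Topology

theorem ExpIntegrable.exp_mul {X : Type*} [MeasurableSpace X] {μ : Measure X} {γ F : X → ℂ}
    (h : ExpIntegrable μ γ F) (c : ℂ) :
    ExpIntegrable μ γ (fun x => Complex.exp (c * γ x) * F x) := by
  have hm : AEStronglyMeasurable (fun x => Complex.exp (c * γ x) * F x) μ :=
    (Complex.continuous_exp.comp_aestronglyMeasurable
      (h.meas_exponent.const_mul c)).mul h.meas_weight
  refine ⟨h.meas_exponent, hm, fun K => ?_⟩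
  refine (h.integrable_exp (K + ‖c‖)).mono' (hm.norm.mul
    (Real.continuous_exp.comp_aestronglyMeasurable (h.meas_exponent.norm.const_mul K)))
    (ae_of_all _ fun x => ?_)
  rw [Real.norm_of_nonneg (by positivity), norm_mul, add_mul, Real.exp_add]
  calc ‖Complex.exp (c * γ x)‖ * ‖F x‖ * Real.exp (K * ‖γ x‖)
      ≤ Real.exp (‖c‖ * ‖γ x‖) * ‖F x‖ * Real.exp (K * ‖γ x‖) := by
        gcongr; exact norm_exp_mul_le _ _
    _ = _ := by ring

theorem LoopIntegrable.exp_mul {a M : ℝ} {F : ℂ → ℂ} (h : LoopIntegrable a M F) (c : ℂ) :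
    LoopIntegrable a M (fun s => Complex.exp (c * s) * F s) :=
  ⟨h.lower.exp_mul c, h.left.exp_mul c, h.upper.exp_mul c⟩

theorem loopTransform_exp_mul (a M : ℝ) (F : ℂ → ℂ) (c w : ℂ) :
    loopTransform a M (fun s => Complex.exp (c * s) * F s) w = loopTransform a M F (w + c) := by
  unfold loopTransform
  congr 1 with s
  rw [add_mul, Complex.exp_add]
  ring

theorem loopTransform_congr {a M : ℝ} {F G : ℂ → ℂ} (hM : 0 ≤ M)
    (h : ∀ s : ℂ, (s.im = -M ∨ s.im = M ∨ (s.re = a ∧ |s.im| ≤ M)) → F s = G s) (w : ℂ) :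
    loopTransform a M F w = loopTransform a M G w :=
  loopIntegral_congr hM fun s hs => by rw [h s hs]

/-- The operator `d/dw - c`. -/
noncomputable def derivSub (c : ℂ) (h : ℂ → ℂ) : ℂ → ℂ := fun w => deriv h w - c * h w

/-- The operator `h ↦ h(· + 2πi) - μ h`. -/
noncomputable def monodromySub (μ : ℂ) (h : ℂ → ℂ) : ℂ → ℂ :=
  fun w => h (w + 2 * Real.pi * Complex.I) - μ * h w

theorem derivSub_loopTransform {a M : ℝ} (hM : 0 ≤ M) {F : ℂ → ℂ} (hF : LoopIntegrable a M F)
    (c : ℂ) : derivSub c (loopTransform a M F) = loopTransform a M (fun s => (s - c) * F s) := by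
  funext w
  have h : (fun s => (s - c) * F s) = fun s => s * F s + -c * F s := by
    funext s; ring
  rw [derivSub, (hF.hasDerivAt hM w).deriv, h, loopTransform_add hM hF.id_mul (hF.const_mul _),
    loopTransform_const_mul]
  ring

theorem LoopIntegrable.sub_mul {a M : ℝ} {F : ℂ → ℂ} (hF : LoopIntegrable a M F) (c : ℂ) :
    LoopIntegrable a M (fun s => (s - c) * F s) := by
  have h : (fun s => (s - c) * F s) = fun s => s * F s + -c * F s := by
    funext s; ring
  rw [h]
  exact hF.id_mul.add (hF.const_mul _)

theorem norm_add_one_le_meijerBound (b : Fin 4 → ℂ) (j : Fin 4) : ‖b j‖ + 1 ≤ meijerBound b := by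
  have := Finset.single_le_sum (f := fun j => ‖b j‖) (fun _ _ => norm_nonneg _) (Finset.mem_univ j)
  rw [meijerBound]
  linarith

theorem meijerBound_pos (b : Fin 4 → ℂ) : 0 < meijerBound b := by
  linarith [norm_add_one_le_meijerBound b 0, norm_nonneg (b 0)]

theorem ne_add_nat_of_abs_im_eq {b : Fin 4 → ℂ} {s : ℂ} (hs : |s.im| = meijerBound b) (j : Fin 4)
    (n : ℕ) : s ≠ b j + n := fun h => by
  have h1 : s.im = (b j).im := by simp [h]
  have := norm_add_one_le_meijerBound b j
  have := Complex.abs_im_le_norm (b j)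
  rw [h1] at hs
  linarith

theorem ne_add_nat_of_re_le {b : Fin 4 → ℂ} {s : ℂ} (hs : s.re ≤ -meijerBound b) (j : Fin 4)
    (n : ℕ) : s ≠ b j + n := fun h => by
  have h1 : s.re = (b j).re + n := by simp [h]
  have := norm_add_one_le_meijerBound b j
  have := (abs_le.1 (Complex.abs_re_le_norm (b j))).1
  have : (0 : ℝ) ≤ n := n.cast_nonneg
  linarith

/-- The loop integral of Meijer's function with numerator set `σ`, at the point `e^w`. -/
noncomputable def meijerTransform (σ : Finset (Fin 4)) (b : Fin 4 → ℂ) : ℂ → ℂ :=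
  loopTransform (-meijerBound b) (meijerBound b) (gammaWeight σ b)

theorem loopIntegrable_of_le (σ : Finset (Fin 4)) {b : Fin 4 → ℂ} {a : ℝ}
    (ha : a ≤ -meijerBound b) : LoopIntegrable a (meijerBound b) (gammaWeight σ b) :=
  loopIntegrable_gammaWeight (meijerBound_pos b).le
    (fun _ hs j _ n => ne_add_nat_of_abs_im_eq hs j n)
    (fun _ hs j _ n => ne_add_nat_of_re_le (hs.trans_le ha) j n)

theorem ne_add_nat_of_mem_loop {b : Fin 4 → ℂ} {s : ℂ} (hs : s.im = -meijerBound b ∨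
    s.im = meijerBound b ∨ (s.re = -meijerBound b ∧ |s.im| ≤ meijerBound b)) (j : Fin 4) (n : ℕ) :
    s ≠ b j + n := by
  have hM := (meijerBound_pos b).le
  rcases hs with h | h | h
  · exact ne_add_nat_of_abs_im_eq (by rw [h, abs_neg, abs_of_nonneg hM]) j n
  · exact ne_add_nat_of_abs_im_eq (by rw [h, abs_of_nonneg hM]) j n
  · exact ne_add_nat_of_re_le h.1.le j n

theorem differentiable_meijerTransform (σ : Finset (Fin 4)) (b : Fin 4 → ℂ) :
    Differentiable ℂ (meijerTransform σ b) := fun w =>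
  ((loopIntegrable_of_le σ le_rfl).hasDerivAt (meijerBound_pos b).le w).differentiableAt

/-- Moving the left edge of the loop. -/
theorem loopTransform_sub_loopTransform {a a' M : ℝ} (h : a ≤ a') {F : ℂ → ℂ}
    (hF : LoopIntegrable a M F) (w : ℂ) :
    loopTransform a M F w - loopTransform a' M F w =
      -rectIntegral a a' M fun s => F s * Complex.exp (w * s) :=
  loopIntegral_sub_loopIntegral h (hF.lower.integrable w) (hF.upper.integrable w)

/-- The operators multiply the weight by `∏ⱼ (s - bⱼ)`, which the recursion turns into the weight at
`s - 1`. Translating the variable yields the factor `e^w` and a loop one unit further left. -/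
theorem derivSub_meijerTransform (σ : Finset (Fin 4)) (b : Fin 4 → ℂ) (w : ℂ) :
    derivSub (b 0) (derivSub (b 1) (derivSub (b 2) (derivSub (b 3) (meijerTransform σ b)))) w =
      (-1) ^ σ.card * (Complex.exp w * meijerTransform σ b w) := by
  have hM := (meijerBound_pos b).le
  have h0 := loopIntegrable_of_le σ (le_refl (-meijerBound b))
  have h3 := h0.sub_mul (b 3)
  have h2 := h3.sub_mul (b 2)
  have h1 := h2.sub_mul (b 1)
  rw [meijerTransform, derivSub_loopTransform hM h0, derivSub_loopTransform hM h3,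
    derivSub_loopTransform hM h2, derivSub_loopTransform hM h1]
  have hcongr : loopTransform (-meijerBound b) (meijerBound b) (fun s => (s - b 0) * ((s - b 1)
      * ((s - b 2) * ((s - b 3) * gammaWeight σ b s)))) w =
      loopIntegral (-meijerBound b) (meijerBound b) (fun s => ((-1) ^ σ.card * Complex.exp w)
        * (fun z => gammaWeight σ b z * Complex.exp (w * z)) (s - 1)) := by
    refine loopIntegral_congr hM fun s hs => ?_
    have := gammaWeight_shift (σ := σ) (b := b) (s := s) fun j _ => by
      simpa using ne_add_nat_of_mem_loop hs j 0
    rw [Fin.prod_univ_four] at this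
    have he : Complex.exp (w * s) = Complex.exp w * Complex.exp (w * (s - 1)) := by
      rw [← Complex.exp_add]; ring_nf
    simp only [he]
    linear_combination (Complex.exp w * Complex.exp (w * (s - 1))) * this
  rw [hcongr, loopIntegral_const_mul, loopIntegral_comp_sub_one _ _
    (fun z => gammaWeight σ b z * Complex.exp (w * z)), mul_assoc]
  -- All poles lie to the right of `-meijerBound b`, so the translated loop may be moved back
  -- without residues.
  have hshift := loopTransform_sub_loopTransform (a' := -meijerBound b) (by linarith)
    (loopIntegrable_of_le σ (by linarith : -meijerBound b - 1 ≤ -meijerBound b)) w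
  rw [rectIntegral_eq_zero (by linarith) hM, neg_zero, sub_eq_zero] at hshift
  · change _ * (_ * loopTransform _ _ _ _) = _
    rw [hshift]
  · intro s hs
    refine (DifferentiableAt.mul (differentiableAt_gammaWeight fun j _ n => ?_)
      (by fun_prop)).differentiableWithinAt
    exact ne_add_nat_of_re_le hs.1.2 j n

/-- The shift by `2πi` multiplies the weight by `e^{2πis}`. The reflection identity removes `i` from
the numerator and leaves `e^{πis}`, which is the translation by `πi`. -/
theorem monodromySub_meijerTransform {σ : Finset (Fin 4)} {i : Fin 4} (hi : i ∈ σ)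
    (b : Fin 4 → ℂ) (w : ℂ) :
    monodromySub (Complex.exp (2 * Real.pi * Complex.I * b i)) (meijerTransform σ b) w =
      -2 * Real.pi * Complex.I * Complex.exp (Real.pi * Complex.I * b i)
        * meijerTransform (σ.erase i) b (w + Real.pi * Complex.I) := by
  have hM := (meijerBound_pos b).le
  have h0 := loopIntegrable_of_le σ (le_refl (-meijerBound b))
  rw [monodromySub, meijerTransform, meijerTransform, ← loopTransform_exp_mul,
    ← loopTransform_exp_mul, sub_eq_add_neg, ← neg_mul, ← loopTransform_const_mul,
    ← loopTransform_const_mul, ← loopTransform_add hM (h0.exp_mul _) (h0.const_mul _)]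
  refine loopTransform_congr hM (fun s hs => ?_) w
  have := gammaWeight_mul_exp_sub_exp hi (s := s) (ne_add_nat_of_mem_loop hs i)
  linear_combination this

/-- The integrand is entire, so the left edge of the loop can be pushed to `+∞`, where the integral
tends to zero. -/
theorem meijerTransform_empty (b : Fin 4 → ℂ) : meijerTransform ∅ b = 0 := by
  funext w
  set M := meijerBound b with hMdef
  have hM : 0 < M := meijerBound_pos b
  -- The rate `Re w + 1` beats the growth of `e^{ws}` and leaves `e^{-Re s}`.
  obtain ⟨C, hC⟩ := norm_gammaWeight_le (σ := ∅) (b := b) (a := -M) (Y := Icc (-M) M) isCompact_Icc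
    (fun s _ _ j hj => absurd hj (Finset.notMem_empty j)) (w.re + 1)
  set D := C * Real.exp (|w.im| * M) with hD
  have hbound : ∀ s : ℂ, -M ≤ s.re → s.im ∈ Icc (-M) M →
      ‖gammaWeight ∅ b s * Complex.exp (w * s)‖ ≤ D * Real.exp (-s.re) := fun s h1 h2 => by
    have hle : Real.exp ((w * s).re) ≤ Real.exp (w.re * s.re) * Real.exp (|w.im| * M) := by
      rw [← Real.exp_add, Complex.mul_re]
      refine Real.exp_le_exp.2 ?_
      have : |w.im * s.im| ≤ |w.im| * M := by
        rw [abs_mul]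
        gcongr
        exact abs_le.2 h2
      linarith [(abs_le.1 this).1]
    rw [norm_mul, Complex.norm_exp]
    calc ‖gammaWeight ∅ b s‖ * Real.exp ((w * s).re)
        ≤ (C * Real.exp (-(w.re + 1) * s.re))
            * (Real.exp (w.re * s.re) * Real.exp (|w.im| * M)) :=
          mul_le_mul (hC s h1 h2) hle (Real.exp_pos _).le ((norm_nonneg _).trans (hC s h1 h2))
      _ = D * (Real.exp (-(w.re + 1) * s.re) * Real.exp (w.re * s.re)) := by rw [hD]; ring
      _ = D * Real.exp (-s.re) := by rw [← Real.exp_add]; ring_nf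
  have hray : ∀ a' : ℝ, -M ≤ a' → ∀ c : ℝ, c ∈ Icc (-M) M →
      ‖∫ x in Ioi a', gammaWeight ∅ b (x + c * Complex.I) * Complex.exp (w * (x + c * Complex.I))‖
        ≤ D * Real.exp (-a') := fun a' ha' c hc => by
    rw [← integral_exp_neg_Ioi, ← integral_const_mul]
    refine norm_integral_le_of_norm_le ((integrableOn_exp_neg_Ioi a').const_mul D) ?_
    refine (ae_restrict_iff' measurableSet_Ioi).2 (ae_of_all _ fun x hx => ?_)
    have hx' : a' < x := hx
    simpa using hbound (x + c * Complex.I) (by simp; linarith) (by simpa using hc)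
  have hloop : ∀ a' : ℝ, -M ≤ a' →
      ‖meijerTransform ∅ b w‖ ≤ (2 + 2 * M) * D * Real.exp (-a') := fun a' ha' => by
    have hshift := loopTransform_sub_loopTransform ha' (loopIntegrable_of_le ∅ le_rfl) w
    rw [rectIntegral_eq_zero ha' hM.le, neg_zero, sub_eq_zero] at hshift
    · rw [meijerTransform, hshift, loopTransform, loopIntegral]
      have h1 := hray a' ha' (-M) ⟨le_rfl, by linarith⟩
      have h2 := hray a' ha' M ⟨by linarith, le_rfl⟩
      simp only [Complex.ofReal_neg, neg_mul, ← sub_eq_add_neg] at h1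
      have h3 : ‖∫ t in (-M)..M, gammaWeight ∅ b (a' + t * Complex.I)
          * Complex.exp (w * (a' + t * Complex.I)) * Complex.I‖ ≤
          D * Real.exp (-a') * |M - -M| := by
        refine intervalIntegral.norm_integral_le_of_norm_le_const fun t ht => ?_
        rw [uIoc_of_le (by linarith)] at ht
        rw [norm_mul, Complex.norm_I, mul_one]
        simpa using hbound (a' + t * Complex.I) (by simpa using ha')
          (by simpa using ⟨ht.1.le, ht.2⟩)
      rw [abs_of_nonneg (by linarith)] at h3
      refine (norm_add_le _ _).trans ((add_le_add (norm_add_le _ _) le_rfl).trans ?_)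
      rw [norm_neg]
      linarith
    · intro s _
      exact (DifferentiableAt.mul (differentiableAt_gammaWeight fun j hj =>
        absurd hj (Finset.notMem_empty j)) (by fun_prop)).differentiableWithinAt
  have hlim : Tendsto (fun a' : ℝ => (2 + 2 * M) * D * Real.exp (-a')) atTop (𝓝 0) := by
    simpa using (Real.tendsto_exp_neg_atTop_nhds_zero).const_mul ((2 + 2 * M) * D)
  have := ge_of_tendsto hlim (eventually_atTop.2 ⟨-M, hloop⟩)
  simpa using this

theorem ExpIntegrable.norm_expTransform_le {X : Type*} [MeasurableSpace X] {μ : Measure X}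
    {γ F : X → ℂ} (h : ExpIntegrable μ γ F) {a R : ℝ} (hR : 0 ≤ R) (hγ : ∀ᵐ x ∂μ, a ≤ (γ x).re) :
    ‖expTransform μ γ F (-R)‖ ≤ Real.exp (-R * a) * ∫ x, ‖F x‖ ∂μ := by
  have hint : Integrable (fun x => ‖F x‖) μ := by simpa using h.integrable_exp 0
  rw [← integral_const_mul]
  refine norm_integral_le_of_norm_le (hint.const_mul _) ?_
  filter_upwards [hγ] with x hx
  rw [norm_mul, Complex.norm_exp, mul_comm]
  gcongr
  simp only [neg_mul, Complex.neg_re, Complex.re_ofReal_mul]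
  nlinarith

/-- Moving the loop past `b p` splits off a residue proportional to `e^{w b_p}`, while the remaining
integral is smaller by a factor `O(e^{-R/2})` at `w = -R`. The hypothesis keeps every `1 / Γ(1 - b_k
+ b_p)` in the residue nonzero. -/
theorem exists_meijerTransform_ne_zero {b : Fin 4 → ℂ} {p : Fin 4}
    (h : ∀ k, ∀ n : ℕ, b k ≠ b p + n + 1) : ∃ w, meijerTransform {p} b w ≠ 0 := by
  by_contra! hzero
  set M := meijerBound b with hMdef
  have hM : 0 < M := meijerBound_pos b
  have hbp := norm_add_one_le_meijerBound b p
  have hre := abs_le.1 (Complex.abs_re_le_norm (b p))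
  have him := Complex.abs_im_le_norm (b p)
  -- Halfway between the first pole `b p` and the second, `b p + 1`.
  set a' : ℝ := (b p).re + 1 / 2 with ha'
  have hle : -M ≤ a' := by linarith
  -- The weight without its pole at `b p`, by `Γ(b_p - s) = Γ(b_p - s + 1) / (b_p - s)`.
  set H : ℂ → ℂ := fun s => -Complex.Gamma (b p - s + 1)
    * ∏ k ∈ Finset.univ.erase p, (Complex.Gamma (1 - b k + s))⁻¹ with hH
  have hHp : H (b p) ≠ 0 := by
    simp only [hH, sub_self, zero_add, Complex.Gamma_one]
    refine mul_ne_zero (by norm_num) (Finset.prod_ne_zero_iff.2 fun k _ => inv_ne_zero ?_)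
    exact Complex.Gamma_ne_zero fun n hn => h k n (by linear_combination -hn)
  have hfac : ∀ s ≠ b p, gammaWeight {p} b s = H s * (s - b p)⁻¹ := fun s hs => by
    have hs' : b p - s ≠ 0 := sub_ne_zero.2 hs.symm
    have hs'' : s - b p ≠ 0 := sub_ne_zero.2 hs
    have hrest : ∀ j ∈ Finset.univ.erase p, (if j ∈ ({p} : Finset (Fin 4)) then
        Complex.Gamma (b j - s) else (Complex.Gamma (1 - b j + s))⁻¹) =
        (Complex.Gamma (1 - b j + s))⁻¹ := fun j hj => by simp [Finset.ne_of_mem_erase hj]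
    rw [gammaWeight, ← Finset.mul_prod_erase _ _ (Finset.mem_univ p), Finset.prod_congr rfl hrest]
    simp only [Finset.mem_singleton, if_true, hH]
    rw [Complex.Gamma_add_one _ hs']
    field_simp
    ring
  have hHd : ∀ s : ℂ, s.re ≤ a' → DifferentiableAt ℂ H s := fun s hs => by
    refine DifferentiableAt.mul (DifferentiableAt.neg ?_)
      (DifferentiableAt.fun_finsetProd fun k _ => ?_)
    · refine DifferentiableAt.fun_comp' (g := Complex.Gamma) (f := fun s => b p - s + 1) s
        (Complex.differentiableAt_Gamma _ fun n hn => ?_) (by fun_prop)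
      have := congrArg Complex.re hn
      simp at this
      have : (0 : ℝ) ≤ n := n.cast_nonneg
      linarith
    · exact DifferentiableAt.fun_comp' (g := fun z => (Complex.Gamma z)⁻¹)
        (f := fun s => 1 - b k + s) s (Complex.differentiable_one_div_Gamma _) (by fun_prop)
  have hF : LoopIntegrable a' M (gammaWeight {p} b) := by
    refine loopIntegrable_gammaWeight hM.le (fun s hs j _ n => ne_add_nat_of_abs_im_eq hs j n)
      fun s hs j hj n hn => ?_
    rw [Finset.mem_singleton.1 hj] at hn
    have h1 : (b p).re + 1 / 2 = (b p).re + n := by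
      rw [← ha', ← hs, hn]; simp
    have h2 : (1 : ℝ) = 2 * n := by linarith
    have h3 : (1 : ℕ) = 2 * n := by exact_mod_cast h2
    omega
  obtain ⟨C, hC⟩ : ∃ C : ℝ, ∀ R : ℝ, 0 ≤ R →
      ‖loopTransform a' M (gammaWeight {p} b) (-R)‖ ≤ Real.exp (-R * a') * C := by
    refine ⟨(∫ x in Ioi a', ‖gammaWeight {p} b (x - M * Complex.I)‖)
      + (∫ t in Ioc (-M) M, ‖gammaWeight {p} b (a' + t * Complex.I)‖)
      + ∫ x in Ioi a', ‖gammaWeight {p} b (x + M * Complex.I)‖, fun R hR => ?_⟩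
    rw [loopTransform_eq hM.le]
    refine (norm_add_le _ _).trans ((add_le_add (norm_add_le _ _) le_rfl).trans ?_)
    rw [norm_neg, norm_mul, Complex.norm_I, mul_one]
    have hray : ∀ᵐ x ∂(volume.restrict (Ioi a')), a' ≤ x :=
      (ae_restrict_iff' measurableSet_Ioi).2 (ae_of_all _ fun x hx => (mem_Ioi.1 hx).le)
    refine (add_le_add (add_le_add (hF.lower.norm_expTransform_le (a := a') hR ?_)
      (hF.left.norm_expTransform_le (a := a') hR ?_)) (hF.upper.norm_expTransform_le (a := a') hR ?_)).trans_eq ?_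
    · simpa using hray
    · exact ae_of_all _ fun x => by simp
    · simpa using hray
    · ring
  have hmain : ∀ R : ℝ, 0 ≤ R → 2 * Real.pi * ‖H (b p)‖ ≤ C * Real.exp (-R / 2) := by
    intro R hR
    have h1 := loopTransform_sub_loopTransform hle (loopIntegrable_of_le {p} le_rfl) (-R)
    have h2 : loopTransform (-M) M (gammaWeight {p} b) (-R) = 0 := hzero (-R)
    rw [h2, rectIntegral_div (p := b p) (H := fun s => H s * Complex.exp (-R * s)) (by linarith)
      (by linarith) (by linarith) (fun s hs => ((hHd s hs.1.2).mul
        (by fun_prop)).differentiableWithinAt) (fun s hs => by rw [hfac s hs]; ring)] at h1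
    have h3 := congrArg norm h1
    rw [zero_sub, norm_neg, norm_neg, norm_mul, norm_mul, norm_mul, norm_mul, Complex.norm_I,
      Complex.norm_exp, Complex.norm_real, Real.norm_of_nonneg Real.pi_pos.le] at h3
    have h4 := hC R hR
    have h5 : (-(R : ℂ) * b p).re = -R * (b p).re := by simp
    have h6 : Real.exp (-R * a') = Real.exp (-R / 2) * Real.exp (-R * (b p).re) := by
      rw [← Real.exp_add, ha']; ring_nf
    rw [h3, h5, h6] at h4
    have h7 := Real.exp_pos (-R * (b p).re)
    have h8 : ‖(2 : ℂ)‖ = 2 := by simp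
    rw [h8] at h4
    refine le_of_mul_le_mul_right ?_ h7
    linarith
  have hlim : Tendsto (fun R : ℝ => C * Real.exp (-R / 2)) atTop (𝓝 0) := by
    have h1 : Tendsto (fun R : ℝ => R / 2) atTop atTop := tendsto_id.atTop_div_const two_pos
    simpa [neg_div] using (Real.tendsto_exp_neg_atTop_nhds_zero.comp h1).const_mul C
  have h1 := ge_of_tendsto hlim (eventually_atTop.2 ⟨0, hmain⟩)
  have h2 : 0 < 2 * Real.pi * ‖H (b p)‖ := by
    have := norm_pos_iff.2 hHp
    positivity
  linarith

end EulerFour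

/-! ### The hypergeometric solutions -/

namespace EulerFour

open MeasureTheory Set Filter Topology

theorem derivSub_expTransform {X : Type*} [MeasurableSpace X] {μ : Measure X} {γ F : X → ℂ}
    (hF : ExpIntegrable μ γ F) (c : ℂ) :
    derivSub c (expTransform μ γ F) = expTransform μ γ (fun x => (γ x - c) * F x) := by
  funext w
  have h : (fun x => (γ x - c) * F x) = fun x => γ x * F x + -c * F x := by
    funext x; ring
  rw [derivSub, (hF.hasDerivAt w).deriv, h, expTransform_add hF.exponent_mul (hF.const_mul _),
    expTransform_const_mul]
  ring

theorem ExpIntegrable.sub_mul {X : Type*} [MeasurableSpace X] {μ : Measure X} {γ F : X → ℂ}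
    (hF : ExpIntegrable μ γ F) (c : ℂ) : ExpIntegrable μ γ (fun x => (γ x - c) * F x) := by
  have h : (fun x => (γ x - c) * F x) = fun x => γ x * F x + -c * F x := by
    funext x; ring
  rw [h]
  exact hF.exponent_mul.add (hF.const_mul _)

/-- The denominator of the `n`-th coefficient of `₀F₃`. -/
noncomputable def hypDenom (A B C : ℂ) (n : ℕ) : ℂ :=
  (ascPochhammer ℂ n).eval A * (ascPochhammer ℂ n).eval B * (ascPochhammer ℂ n).eval C
    * (n.factorial : ℂ)

theorem hypDenom_zero (A B C : ℂ) : hypDenom A B C 0 = 1 := by simp [hypDenom]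

theorem hypDenom_succ (A B C : ℂ) (n : ℕ) :
    hypDenom A B C (n + 1) = hypDenom A B C n * ((A + n) * (B + n) * (C + n) * (n + 1)) := by
  simp only [hypDenom, ascPochhammer_succ_eval, Nat.factorial_succ]
  push_cast
  ring

theorem hypDenom_ne_zero {A B C : ℂ} (hA : ∀ n : ℕ, A + n ≠ 0) (hB : ∀ n : ℕ, B + n ≠ 0)
    (hC : ∀ n : ℕ, C + n ≠ 0) (n : ℕ) : hypDenom A B C n ≠ 0 := by
  induction n with
  | zero => simp [hypDenom_zero]
  | succ n ih =>
    rw [hypDenom_succ]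
    exact mul_ne_zero ih (mul_ne_zero (mul_ne_zero (mul_ne_zero (hA n) (hB n)) (hC n))
      (Nat.cast_add_one_ne_zero n))

/-- Ratio test: the last factor `n + 1` alone eventually exceeds `2 e^K`, the other three having
norm at least one. Vanishing denominators are harmless, as their inverses are zero. -/
theorem summable_inv_hypDenom_mul_exp (A B C : ℂ) (K : ℝ) :
    Summable fun n : ℕ => ‖(hypDenom A B C n)⁻¹‖ * Real.exp (K * n) := by
  refine summable_of_ratio_norm_eventually_le (r := 1 / 2) (by norm_num) ?_
  filter_upwards [tendsto_natCast_atTop_atTop.eventually_ge_atTop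
    (‖A‖ + ‖B‖ + ‖C‖ + 1 + 2 * Real.exp K)] with n hn
  have hlow : ∀ Z : ℂ, ‖Z‖ + 1 ≤ n → 1 ≤ ‖Z + n‖ := fun Z hZ => by
    have := norm_sub_norm_le (n : ℂ) (-Z)
    rw [norm_neg, sub_neg_eq_add, Complex.norm_natCast, add_comm (n : ℂ)] at this
    linarith
  have he := Real.exp_pos K
  have nA := norm_nonneg A
  have nB := norm_nonneg B
  have nC := norm_nonneg C
  have hA := hlow A (by linarith)
  have hB := hlow B (by linarith)
  have hC := hlow C (by linarith)
  have hn1 : ‖(n + 1 : ℂ)‖ = n + 1 := by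
    rw [← Nat.cast_add_one, Complex.norm_natCast, Nat.cast_add_one]
  have hq : 2 * Real.exp K ≤ ‖(A + n) * (B + n) * (C + n) * (n + 1)‖ := by
    rw [norm_mul, norm_mul, norm_mul, hn1]
    calc 2 * Real.exp K ≤ 1 * 1 * 1 * (n + 1 : ℝ) := by linarith
      _ ≤ _ := by gcongr
  rw [Real.norm_of_nonneg (by positivity), Real.norm_of_nonneg (by positivity), hypDenom_succ,
    mul_inv, norm_mul, norm_inv ((A + n) * (B + n) * (C + n) * (n + 1))]
  have hexp : Real.exp (K * ↑(n + 1)) = Real.exp (K * n) * Real.exp K := by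
    rw [← Real.exp_add]; push_cast; ring_nf
  have hq' : ‖(A + n) * (B + n) * (C + n) * (n + 1)‖⁻¹ * Real.exp K ≤ 1 / 2 := by
    rw [inv_mul_le_iff₀ (by linarith)]
    linarith
  rw [hexp]
  calc _ = ‖(hypDenom A B C n)⁻¹‖ * Real.exp (K * n)
        * (‖(A + n) * (B + n) * (C + n) * (n + 1)‖⁻¹ * Real.exp K) := by ring
    _ ≤ ‖(hypDenom A B C n)⁻¹‖ * Real.exp (K * n) * (1 / 2) := by gcongr
    _ = _ := by ring

/-- `e^{a(w - w₀)} ₀F₃(1 + a - b, 1 + a - c, 1 + a - d | e^w)`. -/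
noncomputable def hypTransform (w₀ a b c d : ℂ) (w : ℂ) : ℂ :=
  Complex.exp (a * (w - w₀)) * hyp0F3 (1 + a - b) (1 + a - c) (1 + a - d) (Complex.exp w)

theorem expIntegrable_hyp (k a A B C : ℂ) :
    ExpIntegrable (Measure.count : Measure ℕ) (fun n => a + n)
      (fun n => k * (hypDenom A B C n)⁻¹) := by
  refine ⟨(measurable_from_nat).aestronglyMeasurable,
    (measurable_from_nat).aestronglyMeasurable, fun K => ?_⟩
  rw [integrable_count_iff]
  refine ((summable_inv_hypDenom_mul_exp A B C |K|).mul_left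
    (‖k‖ * Real.exp (|K| * ‖a‖))).of_nonneg_of_le (fun n => by positivity) fun n => ?_
  have h1 : Real.exp (K * ‖a + n‖) ≤ Real.exp (|K| * ‖a‖) * Real.exp (|K| * n) := by
    rw [← Real.exp_add, ← mul_add]
    refine Real.exp_le_exp.2 ?_
    have h2 := norm_add_le a (n : ℂ)
    rw [Complex.norm_natCast] at h2
    exact mul_le_mul (le_abs_self K) h2 (norm_nonneg _) (abs_nonneg K)
  rw [Real.norm_of_nonneg (by positivity), norm_mul]
  calc _ ≤ ‖k‖ * ‖(hypDenom A B C n)⁻¹‖ * (Real.exp (|K| * ‖a‖) * Real.exp (|K| * n)) := by gcongr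
    _ = _ := by ring

theorem expTransform_count {γ F : ℕ → ℂ} (h : ExpIntegrable Measure.count γ F) (w : ℂ) :
    expTransform Measure.count γ F w = ∑' n, F n * Complex.exp (w * γ n) := by
  rw [expTransform, integral_countable (h.integrable w)]
  simp [measureReal_def]

/-- The power series is an exponential transform over counting measure with exponents `a + n`, so
the differentiation lemmas for integrals apply to it as well. -/
theorem hypTransform_eq (w₀ a b c d : ℂ) :
    hypTransform w₀ a b c d = expTransform (Measure.count : Measure ℕ) (fun n => a + n)
      (fun n => Complex.exp (-a * w₀) * (hypDenom (1 + a - b) (1 + a - c) (1 + a - d) n)⁻¹) := by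
  funext w
  rw [expTransform_count (expIntegrable_hyp _ _ _ _ _), hypTransform, hyp0F3, ← tsum_mul_left]
  refine tsum_congr fun n => ?_
  have h1 : Complex.exp (w * (a + n)) = Complex.exp (a * w) * Complex.exp w ^ n := by
    rw [← Complex.exp_nat_mul, ← Complex.exp_add]; ring_nf
  have h2 : Complex.exp (a * (w - w₀)) = Complex.exp (-a * w₀) * Complex.exp (a * w) := by
    rw [← Complex.exp_add]; ring_nf
  rw [h1, h2, hypDenom]
  ring

theorem differentiable_hypTransform (w₀ a b c d : ℂ) :
    Differentiable ℂ (hypTransform w₀ a b c d) := by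
  rw [hypTransform_eq]
  exact fun w => ((expIntegrable_hyp _ _ _ _ _).hasDerivAt w).differentiableAt

/-- The operators multiply the `n`-th term by `n (a + n - b)(a + n - c)(a + n - d)`. The term `n =
0` disappears, and in the others this factor cancels the last step of the denominator, which shifts
the series by one and releases `e^w`. -/
theorem derivSub_hypTransform {a b c d : ℂ} (hb : ∀ n : ℕ, 1 + a - b + n ≠ 0)
    (hc : ∀ n : ℕ, 1 + a - c + n ≠ 0) (hd : ∀ n : ℕ, 1 + a - d + n ≠ 0) {e : Fin 4 → ℂ}
    (he : ∀ x, (x - e 0) * (x - e 1) * (x - e 2) * (x - e 3) =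
      (x - a) * (x - b) * (x - c) * (x - d)) (w₀ w : ℂ) :
    derivSub (e 0) (derivSub (e 1) (derivSub (e 2) (derivSub (e 3) (hypTransform w₀ a b c d)))) w =
      Complex.exp w * hypTransform w₀ a b c d w := by
  have h0 := expIntegrable_hyp (Complex.exp (-a * w₀)) a (1 + a - b) (1 + a - c) (1 + a - d)
  have h3 := h0.sub_mul (e 3)
  have h2 := h3.sub_mul (e 2)
  have h1 := h2.sub_mul (e 1)
  have hf := h1.sub_mul (e 0)
  rw [hypTransform_eq, derivSub_expTransform h0, derivSub_expTransform h3,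
    derivSub_expTransform h2, derivSub_expTransform h1, expTransform_count hf,
    expTransform_count h0, ← tsum_mul_left]
  have hs := hf.integrable w
  rw [integrable_count_iff] at hs
  rw [hs.of_norm.tsum_eq_zero_add]
  have hz : ∀ n : ℕ, (a + n - e 0) * ((a + n - e 1) * ((a + n - e 2) * ((a + n - e 3)
      * (Complex.exp (-a * w₀) * (hypDenom (1 + a - b) (1 + a - c) (1 + a - d) n)⁻¹)))) =
      n * (a + n - b) * (a + n - c) * (a + n - d)
      * (Complex.exp (-a * w₀) * (hypDenom (1 + a - b) (1 + a - c) (1 + a - d) n)⁻¹) := fun n => by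
    linear_combination (Complex.exp (-a * w₀) * (hypDenom (1 + a - b) (1 + a - c) (1 + a - d) n)⁻¹)
      * he (a + n)
  simp only [hz]
  rw [Nat.cast_zero, zero_mul, zero_mul, zero_mul, zero_mul, zero_mul, zero_add]
  refine tsum_congr fun n => ?_
  have hexp : Complex.exp (w * (a + ↑(n + 1))) = Complex.exp w * Complex.exp (w * (a + n)) := by
    rw [← Complex.exp_add]; push_cast; ring_nf
  have hD := hypDenom_ne_zero hb hc hd n
  have hn : (n + 1 : ℂ) ≠ 0 := Nat.cast_add_one_ne_zero n
  have k1 := hb n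
  have k2 := hc n
  have k3 := hd n
  rw [hexp, hypDenom_succ]
  push_cast
  rw [show a + (n + 1 : ℂ) - b = 1 + a - b + n by ring,
    show a + (n + 1 : ℂ) - c = 1 + a - c + n by ring,
    show a + (n + 1 : ℂ) - d = 1 + a - d + n by ring]
  generalize 1 + a - b + (n : ℂ) = x1 at *
  generalize 1 + a - c + (n : ℂ) = x2 at *
  generalize 1 + a - d + (n : ℂ) = x3 at *
  field_simp

theorem monodromySub_hypTransform (w₀ a b c d : ℂ) :
    monodromySub (Complex.exp (2 * Real.pi * Complex.I * a)) (hypTransform w₀ a b c d) = 0 := by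
  funext w
  have h : Complex.exp (a * (w + 2 * Real.pi * Complex.I - w₀)) =
      Complex.exp (2 * Real.pi * Complex.I * a) * Complex.exp (a * (w - w₀)) := by
    rw [← Complex.exp_add]; ring_nf
  simp only [monodromySub, hypTransform, h, Complex.exp_periodic w, Pi.zero_apply]
  ring

/-- As `w → -∞` along the reals, the hypergeometric factor tends to its value `1` at the origin. -/
theorem exists_hypTransform_ne_zero (w₀ a b c d : ℂ) : ∃ w, hypTransform w₀ a b c d w ≠ 0 := by
  by_contra! hzero
  set A := 1 + a - b
  set B := 1 + a - c
  set C := 1 + a - d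
  have hz : ∀ w, hyp0F3 A B C (Complex.exp w) = 0 := fun w =>
    (mul_eq_zero.1 (hzero w)).resolve_left (Complex.exp_ne_zero _)
  have hsum : Summable fun n : ℕ => ‖(hypDenom A B C n)⁻¹‖ := by
    simpa using summable_inv_hypDenom_mul_exp A B C 0
  have hcont : ContinuousOn (hyp0F3 A B C) (Metric.closedBall 0 1) := by
    refine continuousOn_tsum (fun n => by fun_prop) hsum fun n z hz => ?_
    rw [mem_closedBall_zero_iff] at hz
    rw [div_eq_mul_inv, norm_mul, norm_pow]
    exact mul_le_of_le_one_left (norm_nonneg _) (pow_le_one₀ (norm_nonneg _) hz)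
  have h0 : hyp0F3 A B C 0 = 1 := by
    rw [hyp0F3, tsum_eq_single 0 (fun n hn => by simp [hn])]
    simp
  have hat := hcont.continuousAt (Metric.closedBall_mem_nhds 0 one_pos)
  have hlim : Tendsto (fun R : ℝ => Complex.exp (-R)) atTop (𝓝 0) := by
    rw [tendsto_zero_iff_norm_tendsto_zero]
    simpa [Complex.norm_exp] using Real.tendsto_exp_neg_atTop_nhds_zero
  have h1 := hat.tendsto.comp hlim
  rw [h0] at h1
  have h2 : (hyp0F3 A B C ∘ fun R : ℝ => Complex.exp (-R)) = fun _ => 0 := funext fun R => hz _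
  rw [h2] at h1
  exact zero_ne_one (tendsto_nhds_unique tendsto_const_nhds h1)

end EulerFour

/-! ### The equation on the half-line: uniqueness and dimension -/

namespace EulerFour

open Set Filter Topology

/-- On `(0,∞)`, the functions `u₁, …, u₄` are the first four derivatives of `u`. -/
structure HasJet (u u₁ u₂ u₃ u₄ : ℝ → ℂ) : Prop where
  d1 : ∀ r, 0 < r → HasDerivAt u (u₁ r) r
  d2 : ∀ r, 0 < r → HasDerivAt u₁ (u₂ r) r
  d3 : ∀ r, 0 < r → HasDerivAt u₂ (u₃ r) r
  d4 : ∀ r, 0 < r → HasDerivAt u₃ (u₄ r) r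

theorem deriv_eq_of_eqOn_Ioi {f g h : ℝ → ℂ} (hfg : ∀ r, 0 < r → f r = g r)
    (hg : ∀ r, 0 < r → HasDerivAt g (h r) r) (r : ℝ) (hr : 0 < r) : deriv f r = h r := by
  have he : f =ᶠ[𝓝 r] g := eventually_of_mem (Ioi_mem_nhds hr) fun x hx => hfg x hx
  rw [he.deriv_eq, (hg r hr).deriv]

theorem HasJet.iteratedDeriv_two {u u₁ u₂ u₃ u₄ : ℝ → ℂ} (h : HasJet u u₁ u₂ u₃ u₄) :
    ∀ r, 0 < r → iteratedDeriv 2 u r = u₂ r := by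
  rw [iteratedDeriv_succ, iteratedDeriv_one]
  exact deriv_eq_of_eqOn_Ioi (deriv_eq_of_eqOn_Ioi (fun _ _ => rfl) h.d1) h.d2

theorem HasJet.iteratedDeriv_four {u u₁ u₂ u₃ u₄ : ℝ → ℂ} (h : HasJet u u₁ u₂ u₃ u₄) :
    ∀ r, 0 < r → iteratedDeriv 4 u r = u₄ r := by
  rw [iteratedDeriv_succ, iteratedDeriv_succ]
  exact deriv_eq_of_eqOn_Ioi (deriv_eq_of_eqOn_Ioi h.iteratedDeriv_two h.d3) h.d4

theorem hasDerivAt_inv_pow {r : ℝ} (hr : 0 < r) (n : ℕ) :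
    HasDerivAt (fun t : ℝ => ((t : ℂ) ^ n)⁻¹) (-n * ((r : ℂ) ^ (n + 1))⁻¹) r := by
  have hr' : (r : ℂ) ≠ 0 := Complex.ofReal_ne_zero.2 hr.ne'
  have h1 : HasDerivAt (fun t : ℝ => (t : ℂ) ^ n) (n * (r : ℂ) ^ (n - 1)) r := by
    simpa using (Complex.ofRealCLM.hasDerivAt (x := r)).fun_pow n
  refine (h1.fun_inv (pow_ne_zero n hr')).congr_deriv ?_
  rcases n with _ | n
  · simp
  · simp only [Nat.add_sub_cancel]
    field_simp
    ring

theorem iteratedDeriv_two_inv_sq_mul {u u₁ u₂ : ℝ → ℂ}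
    (h1 : ∀ r, 0 < r → HasDerivAt u (u₁ r) r) (h2 : ∀ r, 0 < r → HasDerivAt u₁ (u₂ r) r)
    {r : ℝ} (hr : 0 < r) :
    iteratedDeriv 2 (fun t : ℝ => 1 / (t : ℂ) ^ 2 * u t) r =
      u₂ r / (r : ℂ) ^ 2 - 4 * u₁ r / (r : ℂ) ^ 3 + 6 * u r / (r : ℂ) ^ 4 := by
  rw [iteratedDeriv_succ, iteratedDeriv_one]
  have e1 : ∀ t : ℝ, 0 < t → HasDerivAt (fun t : ℝ => ((t : ℂ) ^ 2)⁻¹ * u t)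
      (-(2 : ℕ) * ((t : ℂ) ^ 3)⁻¹ * u t + ((t : ℂ) ^ 2)⁻¹ * u₁ t) t := fun t ht =>
    (hasDerivAt_inv_pow ht 2).mul (h1 t ht)
  have e2 : ∀ t : ℝ, 0 < t → HasDerivAt
      (fun t : ℝ => -(2 : ℕ) * ((t : ℂ) ^ 3)⁻¹ * u t + ((t : ℂ) ^ 2)⁻¹ * u₁ t)
      (-(2 : ℕ) * (-(3 : ℕ) * ((t : ℂ) ^ 4)⁻¹) * u t + -(2 : ℕ) * ((t : ℂ) ^ 3)⁻¹ * u₁ t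
        + (-(2 : ℕ) * ((t : ℂ) ^ 3)⁻¹ * u₁ t + ((t : ℂ) ^ 2)⁻¹ * u₂ t)) t := fun t ht =>
    (((hasDerivAt_inv_pow ht 3).const_mul _).mul (h1 t ht)).add
      ((hasDerivAt_inv_pow ht 2).mul (h2 t ht))
  rw [deriv_eq_of_eqOn_Ioi (deriv_eq_of_eqOn_Ioi (fun t _ => by rw [one_div]) e1) e2 r hr]
  push_cast
  ring

theorem HasJet.tau₂_eq {u u₁ u₂ u₃ u₄ : ℝ → ℂ} (h : HasJet u u₁ u₂ u₃ u₄) (c₁ c₂ : ℝ) {r : ℝ}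
    (hr : 0 < r) :
    tau₂ c₁ c₂ u r = u₄ r
      + c₁ * (2 * u₂ r / (r : ℂ) ^ 2 - 4 * u₁ r / (r : ℂ) ^ 3 + 6 * u r / (r : ℂ) ^ 4)
      + c₂ * u r / (r : ℂ) ^ 4 := by
  rw [tau₂, h.iteratedDeriv_four r hr, h.iteratedDeriv_two r hr,
    iteratedDeriv_two_inv_sq_mul h.d1 h.d2 hr]
  ring

theorem hasJet_of_contDiffOn {u : ℝ → ℂ} (h : ContDiffOn ℝ 4 u (Ioi 0)) :
    HasJet u (iteratedDeriv 1 u) (iteratedDeriv 2 u) (iteratedDeriv 3 u) (iteratedDeriv 4 u) := by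
  have key : ∀ k : ℕ, k < 4 → ∀ r : ℝ, 0 < r →
      HasDerivAt (iteratedDeriv k u) (iteratedDeriv (k + 1) u r) r := fun k hk r hr => by
    have hd : DifferentiableAt ℝ (iteratedDeriv k u) r := by
      have h1 := (h.differentiableOn_iteratedDerivWithin (m := k) (by exact_mod_cast hk)
        (uniqueDiffOn_Ioi 0)).congr fun x hx => (iteratedDerivWithin_of_isOpen isOpen_Ioi hx).symm
      exact h1.differentiableAt (Ioi_mem_nhds hr)
    rw [iteratedDeriv_succ]
    exact hd.hasDerivAt
  exact ⟨by simpa using key 0 (by norm_num), key 1 (by norm_num), key 2 (by norm_num),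
    key 3 (by norm_num)⟩

/-- Uniqueness for the companion first-order system, whose vector field is Lipschitz where the
coefficients are bounded. -/
theorem HasJet.eq_zero {u u₁ u₂ u₃ u₄ : ℝ → ℂ} (h : HasJet u u₁ u₂ u₃ u₄) {p₀ p₁ p₂ : ℝ → ℂ}
    (h0 : ContinuousOn p₀ (Ioi 0)) (h1 : ContinuousOn p₁ (Ioi 0)) (h2 : ContinuousOn p₂ (Ioi 0))
    (hode : ∀ r, 0 < r → u₄ r = p₀ r * u r + p₁ r * u₁ r + p₂ r * u₂ r)
    (i0 : u 1 = 0) (i1 : u₁ 1 = 0) (i2 : u₂ 1 = 0) (i3 : u₃ 1 = 0) (r : ℝ) (hr : 0 < r) :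
    u r = 0 := by
  -- An interval around both `1` and `r` whose closure stays inside `(0,∞)`.
  set a := min r 1 / 2 with ha
  set b := max r 1 + 1 with hb
  have hmin : 0 < min r 1 := lt_min hr one_pos
  have ha0 : 0 < a := by positivity
  have har : a < r := by linarith [min_le_left r 1]
  have ha1 : a < 1 := by linarith [min_le_right r 1]
  have hbr : r < b := by linarith [le_max_left r 1]
  have hb1 : 1 < b := by linarith [le_max_right r 1]
  have hsub : Icc a b ⊆ Ioi 0 := fun t ht => ha0.trans_le ht.1
  obtain ⟨C, hC⟩ := isCompact_Icc.exists_bound_of_continuousOn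
    ((((h0.norm.add h1.norm).add h2.norm)).mono hsub)
  set v : ℝ → (Fin 4 → ℂ) → (Fin 4 → ℂ) := fun t Y =>
    ![Y 1, Y 2, Y 3, p₀ t * Y 0 + p₁ t * Y 1 + p₂ t * Y 2] with hv
  have hlip : ∀ t ∈ Ioo a b, LipschitzOnWith (Real.toNNReal (max 1 C)) (v t) univ := fun t ht => by
    refine (LipschitzWith.of_dist_le_mul fun Y Z => ?_).lipschitzOnWith
    have hCt : ‖p₀ t‖ + ‖p₁ t‖ + ‖p₂ t‖ ≤ C :=
      (le_abs_self _).trans (hC t ⟨ht.1.le, ht.2.le⟩)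
    have hmax : (0 : ℝ) ≤ max 1 C := le_max_of_le_left zero_le_one
    rw [Real.coe_toNNReal _ hmax, dist_pi_le_iff (by positivity)]
    have hle : ∀ i, dist (Y i) (Z i) ≤ max 1 C * dist Y Z := fun i =>
      (dist_le_pi_dist Y Z i).trans (le_mul_of_one_le_left dist_nonneg (le_max_left _ _))
    have hq : dist (p₀ t * Y 0 + p₁ t * Y 1 + p₂ t * Y 2) (p₀ t * Z 0 + p₁ t * Z 1 + p₂ t * Z 2) ≤
        max 1 C * dist Y Z := by
      have hi : ∀ i, ‖Y i - Z i‖ ≤ dist Y Z := fun i => by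
        rw [← dist_eq_norm]; exact dist_le_pi_dist Y Z i
      have heq : p₀ t * Y 0 + p₁ t * Y 1 + p₂ t * Y 2 - (p₀ t * Z 0 + p₁ t * Z 1 + p₂ t * Z 2) =
          p₀ t * (Y 0 - Z 0) + p₁ t * (Y 1 - Z 1) + p₂ t * (Y 2 - Z 2) := by ring
      rw [dist_eq_norm, heq]
      calc _ ≤ ‖p₀ t‖ * ‖Y 0 - Z 0‖ + ‖p₁ t‖ * ‖Y 1 - Z 1‖ + ‖p₂ t‖ * ‖Y 2 - Z 2‖ := by
            simp only [← norm_mul]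
            exact norm_add₃_le
        _ ≤ ‖p₀ t‖ * dist Y Z + ‖p₁ t‖ * dist Y Z + ‖p₂ t‖ * dist Y Z := by
            gcongr <;> exact hi _
        _ = (‖p₀ t‖ + ‖p₁ t‖ + ‖p₂ t‖) * dist Y Z := by ring
        _ ≤ _ := by gcongr; exact hCt.trans (le_max_right _ _)
    intro i
    fin_cases i
    · exact hle 1
    · exact hle 2
    · exact hle 3
    · exact hq
  have hY : ∀ t ∈ Ioo a b, HasDerivAt (fun t => ![u t, u₁ t, u₂ t, u₃ t])
      (v t ![u t, u₁ t, u₂ t, u₃ t]) t ∧ ![u t, u₁ t, u₂ t, u₃ t] ∈ univ := fun t ht => by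
    have ht0 : 0 < t := ha0.trans ht.1
    refine ⟨hasDerivAt_pi.2 fun i => ?_, mem_univ _⟩
    fin_cases i
    · exact h.d1 t ht0
    · exact h.d2 t ht0
    · exact h.d3 t ht0
    · have := h.d4 t ht0
      rw [hode t ht0] at this
      exact this
  have hZ : ∀ t ∈ Ioo a b, HasDerivAt (fun _ : ℝ => (0 : Fin 4 → ℂ)) (v t 0) t ∧
      (0 : Fin 4 → ℂ) ∈ univ := fun t _ => by
    refine ⟨(hasDerivAt_const t (0 : Fin 4 → ℂ)).congr_deriv ?_, mem_univ _⟩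
    ext i
    fin_cases i <;> simp [hv]
  have := ODE_solution_unique_of_mem_Ioo (t₀ := 1) hlip ⟨ha1, hb1⟩ hY hZ (by
    ext i
    fin_cases i
    · exact i0
    · exact i1
    · exact i2
    · exact i3) ⟨har, hbr⟩
  exact congrFun this 0

theorem HasJet.sum {y y₁ y₂ y₃ y₄ : Fin 4 → ℝ → ℂ}
    (h : ∀ j, HasJet (y j) (y₁ j) (y₂ j) (y₃ j) (y₄ j)) (a : Fin 4 → ℂ) :
    HasJet (fun r => ∑ j, a j * y j r) (fun r => ∑ j, a j * y₁ j r) (fun r => ∑ j, a j * y₂ j r)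
      (fun r => ∑ j, a j * y₃ j r) (fun r => ∑ j, a j * y₄ j r) :=
  ⟨fun r hr => HasDerivAt.fun_sum fun j _ => ((h j).d1 r hr).const_mul _,
    fun r hr => HasDerivAt.fun_sum fun j _ => ((h j).d2 r hr).const_mul _,
    fun r hr => HasDerivAt.fun_sum fun j _ => ((h j).d3 r hr).const_mul _,
    fun r hr => HasDerivAt.fun_sum fun j _ => ((h j).d4 r hr).const_mul _⟩

theorem HasJet.sub {u u₁ u₂ u₃ u₄ v v₁ v₂ v₃ v₄ : ℝ → ℂ} (hu : HasJet u u₁ u₂ u₃ u₄)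
    (hv : HasJet v v₁ v₂ v₃ v₄) :
    HasJet (fun r => u r - v r) (fun r => u₁ r - v₁ r) (fun r => u₂ r - v₂ r)
      (fun r => u₃ r - v₃ r) (fun r => u₄ r - v₄ r) :=
  ⟨fun r hr => (hu.d1 r hr).sub (hv.d1 r hr), fun r hr => (hu.d2 r hr).sub (hv.d2 r hr),
    fun r hr => (hu.d3 r hr).sub (hv.d3 r hr), fun r hr => (hu.d4 r hr).sub (hv.d4 r hr)⟩

/-- Four linearly independent solutions span the space of solutions. -/
theorem isFundamentalSystem_of_linearIndependent {c₁ c₂ : ℝ} {lam : ℂ} {y : Fin 4 → ℝ → ℂ}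
    (hsol : ∀ j, IsSolution c₁ c₂ lam (y j))
    (hli : ∀ a : Fin 4 → ℂ, (∀ r : ℝ, 0 < r → ∑ j, a j * y j r = 0) → a = 0) :
    IsFundamentalSystem c₁ c₂ lam y := by
  -- Coefficients of the equation solved for the fourth derivative.
  set p₀ : ℝ → ℂ := fun r => lam - (6 * c₁ + c₂) / (r : ℂ) ^ 4 with hp₀
  set p₁ : ℝ → ℂ := fun r => 4 * c₁ / (r : ℂ) ^ 3 with hp₁
  set p₂ : ℝ → ℂ := fun r => -2 * c₁ / (r : ℂ) ^ 2 with hp₂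
  have hne : ∀ n : ℕ, ∀ r ∈ Ioi (0 : ℝ), (r : ℂ) ^ n ≠ 0 := fun n r hr =>
    pow_ne_zero n (Complex.ofReal_ne_zero.2 (ne_of_gt hr))
  have k0 : ContinuousOn p₀ (Ioi 0) := continuousOn_const.sub
    (continuousOn_const.div (by fun_prop) (hne 4))
  have k1 : ContinuousOn p₁ (Ioi 0) := continuousOn_const.div (by fun_prop) (hne 3)
  have k2 : ContinuousOn p₂ (Ioi 0) := continuousOn_const.div (by fun_prop) (hne 2)
  have hode : ∀ u, IsSolution c₁ c₂ lam u → ∀ r, 0 < r → iteratedDeriv 4 u r =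
      p₀ r * u r + p₁ r * iteratedDeriv 1 u r + p₂ r * iteratedDeriv 2 u r := fun u hu r hr => by
    have h1 := (hasJet_of_contDiffOn hu.1).tau₂_eq c₁ c₂ hr
    rw [hu.2 r hr] at h1
    simp only [hp₀, hp₁, hp₂]
    linear_combination -h1
  have hjet := fun j => hasJet_of_contDiffOn (hsol j).1
  have hsumode : ∀ a : Fin 4 → ℂ, ∀ r, 0 < r → ∑ j, a j * iteratedDeriv 4 (y j) r =
      p₀ r * ∑ j, a j * y j r + p₁ r * ∑ j, a j * iteratedDeriv 1 (y j) r
        + p₂ r * ∑ j, a j * iteratedDeriv 2 (y j) r := fun a r hr => by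
    simp only [Finset.mul_sum, ← Finset.sum_add_distrib]
    refine Finset.sum_congr rfl fun j _ => ?_
    rw [hode (y j) (hsol j) r hr]
    ring
  set V : Fin 4 → Fin 4 → ℂ := fun j =>
    ![y j 1, iteratedDeriv 1 (y j) 1, iteratedDeriv 2 (y j) 1, iteratedDeriv 3 (y j) 1] with hV
  -- By uniqueness, a relation among the Cauchy data at `1` is a relation among the solutions. Four
  -- independent vectors span `ℂ⁴`, so the data of any solution `u` are matched by a combination,
  -- which then equals `u`.
  have hVi : LinearIndependent ℂ V := by
    refine Fintype.linearIndependent_iff.2 fun a ha => congrFun (hli a ?_)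
    have hc : ∀ i, ∑ j, a j * V j i = 0 := fun i => by
      simpa using congrFun ha i
    exact (HasJet.sum hjet a).eq_zero k0 k1 k2 (hsumode a) (hc 0) (hc 1) (hc 2) (hc 3)
  have hspan : Submodule.span ℂ (range V) = ⊤ :=
    hVi.span_eq_top_of_card_eq_finrank (by simp)
  refine ⟨hsol, Fintype.linearIndependent_iff.2 fun a ha => congrFun (hli a fun r hr => ?_),
    fun u hu => ?_⟩
  · simpa using congrFun ha ⟨r, hr⟩
  · set U : Fin 4 → ℂ :=
      ![u 1, iteratedDeriv 1 u 1, iteratedDeriv 2 u 1, iteratedDeriv 3 u 1] with hU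
    obtain ⟨a, ha⟩ := (Submodule.mem_span_range_iff_exists_fun ℂ).1
      (hspan ▸ Submodule.mem_top : U ∈ Submodule.span ℂ (range V))
    have hc : ∀ i, U i - ∑ j, a j * V j i = 0 := fun i => by
      rw [← ha]; simp
    refine ⟨a, fun r hr => sub_eq_zero.1 ?_⟩
    refine ((hasJet_of_contDiffOn hu.1).sub (HasJet.sum hjet a)).eq_zero k0 k1 k2 (fun t ht => ?_)
      (hc 0) (hc 1) (hc 2) (hc 3) r hr
    rw [hode u hu t ht, hsumode a t ht]
    ring

end EulerFour

/-! ### Passage to the logarithmic variable -/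

namespace EulerFour

open Set Filter Topology

/-- `h` is entire and solves `∏ⱼ (d/dw - bⱼ) h = e^w h`. -/
structure SolvesMeijer (b : Fin 4 → ℂ) (h : ℂ → ℂ) : Prop where
  differentiable : Differentiable ℂ h
  ode : ∀ w, derivSub (b 0) (derivSub (b 1) (derivSub (b 2) (derivSub (b 3) h))) w =
    Complex.exp w * h w

/-- `α` lists the roots of `z(z-1)(z-2)(z-3) + c₁ [z(z-1) + (z-2)(z-3)] + c₂`. -/
structure IsCharExponents (c₁ c₂ : ℝ) (α : Fin 4 → ℂ) : Prop where
  e1 : α 0 + α 1 + α 2 + α 3 = 6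
  e2 : α 0 * α 1 + α 0 * α 2 + α 0 * α 3 + α 1 * α 2 + α 1 * α 3 + α 2 * α 3 = 11 + 2 * c₁
  e3 : α 0 * α 1 * α 2 + α 0 * α 1 * α 3 + α 0 * α 2 * α 3 + α 1 * α 2 * α 3 = 6 + 6 * c₁
  e4 : α 0 * α 1 * α 2 * α 3 = 6 * c₁ + c₂

theorem differentiable_deriv {h : ℂ → ℂ} (hd : Differentiable ℂ h) : Differentiable ℂ (deriv h) :=
  fun z => (hd.analyticAt z).deriv.differentiableAt

theorem differentiable_derivSub {h : ℂ → ℂ} (hd : Differentiable ℂ h) (c : ℂ) :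
    Differentiable ℂ (derivSub c h) :=
  (differentiable_deriv hd).sub (hd.const_mul c)

theorem deriv_derivSub {h : ℂ → ℂ} (hd : Differentiable ℂ h) (c : ℂ) :
    deriv (derivSub c h) = derivSub c (deriv h) := by
  funext w
  exact (((differentiable_deriv hd) w).hasDerivAt.sub ((hd w).hasDerivAt.const_mul c)).deriv

theorem derivSub_four {h : ℂ → ℂ} (hd : Differentiable ℂ h) (b₀ b₁ b₂ b₃ w : ℂ) :
    derivSub b₀ (derivSub b₁ (derivSub b₂ (derivSub b₃ h))) w =
      deriv (deriv (deriv (deriv h))) w - (b₀ + b₁ + b₂ + b₃) * deriv (deriv (deriv h)) w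
      + (b₀ * b₁ + b₀ * b₂ + b₀ * b₃ + b₁ * b₂ + b₁ * b₃ + b₂ * b₃) * deriv (deriv h) w
      - (b₀ * b₁ * b₂ + b₀ * b₁ * b₃ + b₀ * b₂ * b₃ + b₁ * b₂ * b₃) * deriv h w
      + b₀ * b₁ * b₂ * b₃ * h w := by
  have h1 := differentiable_deriv hd
  have h2 := differentiable_deriv h1
  have e1 : ∀ (f : ℂ → ℂ) (c z : ℂ), derivSub c f z = deriv f z - c * f z := fun _ _ _ => rfl
  rw [e1, deriv_derivSub (differentiable_derivSub (differentiable_derivSub hd _) _),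
    deriv_derivSub (differentiable_derivSub hd _), deriv_derivSub hd]
  rw [e1 _ b₁, e1 _ b₁, deriv_derivSub (differentiable_derivSub h1 _), deriv_derivSub h1,
    deriv_derivSub (differentiable_derivSub hd _), deriv_derivSub hd]
  rw [e1 _ b₂, e1 _ b₂, e1 _ b₂, deriv_derivSub h2, deriv_derivSub h1, deriv_derivSub hd]
  simp only [e1]
  ring

/-- The variable `w = log z_r` on the real half-line. -/
theorem hasDerivAt_comp_log {f : ℂ → ℂ} (hf : Differentiable ℂ f) (w₀ : ℂ) {r : ℝ} (hr : 0 < r) :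
    HasDerivAt (fun r : ℝ => f (w₀ + 4 * (Real.log r : ℂ)))
      (4 * deriv f (w₀ + 4 * (Real.log r : ℂ)) * (r : ℂ)⁻¹) r := by
  have h1 : HasDerivAt (fun r : ℝ => w₀ + 4 * (Real.log r : ℂ)) (4 * (r : ℂ)⁻¹) r := by
    have := (((Real.hasDerivAt_log hr.ne').ofReal_comp).const_mul (4 : ℂ)).const_add w₀
    simpa using this
  exact ((hf _).hasDerivAt.comp r h1).congr_deriv (by ring)

/-- The coefficients come from `rᵏ dᵏ/drᵏ = θ(θ - 1)⋯(θ - k + 1)` with `θ = 4 d/dw`. -/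
theorem hasJet_comp_log {h : ℂ → ℂ} (hd : Differentiable ℂ h) (w₀ : ℂ) :
    HasJet (fun r => h (w₀ + 4 * (Real.log r : ℂ)))
      (fun r => (4 * deriv h (w₀ + 4 * (Real.log r : ℂ))) * ((r : ℂ) ^ 1)⁻¹)
      (fun r => (16 * deriv (deriv h) (w₀ + 4 * (Real.log r : ℂ))
        - 4 * deriv h (w₀ + 4 * (Real.log r : ℂ))) * ((r : ℂ) ^ 2)⁻¹)
      (fun r => (64 * deriv (deriv (deriv h)) (w₀ + 4 * (Real.log r : ℂ))
        - 48 * deriv (deriv h) (w₀ + 4 * (Real.log r : ℂ))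
        + 8 * deriv h (w₀ + 4 * (Real.log r : ℂ))) * ((r : ℂ) ^ 3)⁻¹)
      (fun r => (256 * deriv (deriv (deriv (deriv h))) (w₀ + 4 * (Real.log r : ℂ))
        - 384 * deriv (deriv (deriv h)) (w₀ + 4 * (Real.log r : ℂ))
        + 176 * deriv (deriv h) (w₀ + 4 * (Real.log r : ℂ))
        - 24 * deriv h (w₀ + 4 * (Real.log r : ℂ))) * ((r : ℂ) ^ 4)⁻¹) := by
  have h1 := differentiable_deriv hd
  have h2 := differentiable_deriv h1
  have h3 := differentiable_deriv h2
  constructor <;> intro r hr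
  · exact (hasDerivAt_comp_log hd w₀ hr).congr_deriv (by rw [pow_one])
  all_goals have hr' : (r : ℂ) ≠ 0 := Complex.ofReal_ne_zero.2 hr.ne'
  · refine (((hasDerivAt_comp_log h1 w₀ hr).const_mul 4).mul
      (hasDerivAt_inv_pow hr 1)).congr_deriv ?_
    push_cast
    field_simp
    ring
  · refine ((((hasDerivAt_comp_log h2 w₀ hr).const_mul 16).fun_sub
      ((hasDerivAt_comp_log h1 w₀ hr).const_mul 4)).mul (hasDerivAt_inv_pow hr 2)).congr_deriv ?_
    push_cast
    field_simp
    ring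
  · refine (((((hasDerivAt_comp_log h3 w₀ hr).const_mul 64).fun_sub
      ((hasDerivAt_comp_log h2 w₀ hr).const_mul 48)).fun_add
      ((hasDerivAt_comp_log h1 w₀ hr).const_mul 8)).mul (hasDerivAt_inv_pow hr 3)).congr_deriv ?_
    push_cast
    field_simp
    ring

theorem exp_log_add {z : ℂ} (hz : z ≠ 0) {r : ℝ} (hr : 0 < r) :
    Complex.exp (Complex.log z + 4 * (Real.log r : ℂ)) = z * (r : ℂ) ^ 4 := by
  have h4 : (4 : ℂ) * (Real.log r : ℂ) = ((4 : ℕ) : ℂ) * (Real.log r : ℂ) := by norm_num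
  rw [Complex.exp_add, Complex.exp_log hz, h4, Complex.exp_nat_mul, ← Complex.ofReal_exp,
    Real.exp_log hr]

theorem HasJet.congr {u v u₁ u₂ u₃ u₄ : ℝ → ℂ} (h : HasJet v u₁ u₂ u₃ u₄)
    (huv : ∀ r, 0 < r → u r = v r) : HasJet u u₁ u₂ u₃ u₄ :=
  ⟨fun r hr => (h.d1 r hr).congr_of_eventuallyEq
    (eventually_of_mem (Ioi_mem_nhds hr) fun x hx => huv x hx), h.d2, h.d3, h.d4⟩

/-- `r⁴ τ₂` is `∏ⱼ (θ - αⱼ) = 256 ∏ⱼ (d/dw - αⱼ/4)` by Vieta, and `256 e^w = lam r⁴`. -/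
theorem SolvesMeijer.isSolution {c₁ c₂ : ℝ} {lam : ℂ} (hlam : lam ≠ 0) {α : Fin 4 → ℂ}
    (hα : IsCharExponents c₁ c₂ α) {h : ℂ → ℂ} (hh : SolvesMeijer (fun j => α j / 4) h)
    {y : ℝ → ℂ} (hy : ∀ r, 0 < r → y r = h (Complex.log (lam / 256) + 4 * (Real.log r : ℂ))) :
    IsSolution c₁ c₂ lam y := by
  have hd := hh.differentiable
  refine ⟨ContDiffOn.congr (fun r hr => ?_) hy, fun r hr => ?_⟩
  · have hr0 : r ≠ 0 := ne_of_gt hr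
    have h1 : ContDiffAt ℝ 4 h (Complex.log (lam / 256) + 4 * (Real.log r : ℂ)) :=
      (hd.contDiff (n := 4)).contDiffAt.restrict_scalars ℝ
    have h2 : ContDiffAt ℝ 4 (fun r : ℝ => Complex.log (lam / 256) + 4 * (Real.log r : ℂ)) r :=
      contDiffAt_const.add (contDiffAt_const.mul
        (Complex.ofRealCLM.contDiff.contDiffAt.comp r (Real.contDiffAt_log.2 hr0)))
    exact (h1.comp r h2).contDiffWithinAt
  · have hr' : (r : ℂ) ≠ 0 := Complex.ofReal_ne_zero.2 hr.ne'
    have hlam' : lam / 256 ≠ 0 := div_ne_zero hlam (by norm_num)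
    have hjet := ((hasJet_comp_log hd (Complex.log (lam / 256))).congr hy).tau₂_eq c₁ c₂ hr
    have hode := hh.ode (Complex.log (lam / 256) + 4 * (Real.log r : ℂ))
    rw [derivSub_four hd, exp_log_add hlam' hr, ← hy r hr] at hode
    rw [hjet]
    generalize deriv (deriv (deriv (deriv h))) (Complex.log (lam / 256) + 4 * (Real.log r : ℂ))
      = D4 at *
    generalize deriv (deriv (deriv h)) (Complex.log (lam / 256) + 4 * (Real.log r : ℂ)) = D3 at *
    generalize deriv (deriv h) (Complex.log (lam / 256) + 4 * (Real.log r : ℂ)) = D2 at *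
    generalize deriv h (Complex.log (lam / 256) + 4 * (Real.log r : ℂ)) = D1 at *
    field_simp
    linear_combination 256 * hode + 64 * D3 * hα.e1 - 16 * D2 * hα.e2 + 4 * D1 * hα.e3
      - y r * hα.e4

/-- The identity principle along the half-line. -/
theorem eq_zero_of_comp_log_eq_zero {f : ℂ → ℂ} (hf : Differentiable ℂ f) (w₀ : ℂ)
    (h : ∀ r : ℝ, 0 < r → f (w₀ + 4 * (Real.log r : ℂ)) = 0) : f = 0 := by
  refine AnalyticOnNhd.eq_of_frequently_eq (z₀ := w₀) (fun z _ => hf.analyticAt z)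
    (fun z _ => analyticAt_const) ?_
  have ht : Tendsto (fun x : ℝ => w₀ + (x : ℂ)) (𝓝[≠] 0) (𝓝[≠] w₀) := by
    refine tendsto_nhdsWithin_iff.2 ⟨?_, ?_⟩
    · have : Continuous fun x : ℝ => w₀ + (x : ℂ) := by fun_prop
      simpa using (this.tendsto 0).mono_left nhdsWithin_le_nhds
    · filter_upwards [self_mem_nhdsWithin] with x hx
      simpa using hx
  refine ht.frequently (Eventually.of_forall fun x => ?_).frequently
  -- This choice of `r` gives the point `w₀ + x`, so the zeros accumulate at `w₀`.
  have := h (Real.exp (x / 4)) (Real.exp_pos _)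
  rw [Real.log_exp] at this
  rw [Pi.zero_apply, ← this]
  congr 1
  push_cast
  ring

theorem isFundamentalSystem_of_solvesMeijer {c₁ c₂ : ℝ} {lam : ℂ} (hlam : lam ≠ 0)
    {α : Fin 4 → ℂ} (hα : IsCharExponents c₁ c₂ α) {h : Fin 4 → ℂ → ℂ}
    (hh : ∀ j, SolvesMeijer (fun j => α j / 4) (h j)) {y : Fin 4 → ℝ → ℂ}
    (hy : ∀ j, ∀ r, 0 < r → y j r = h j (Complex.log (lam / 256) + 4 * (Real.log r : ℂ)))
    (hli : ∀ a : Fin 4 → ℂ, (∀ w, ∑ j, a j * h j w = 0) → a = 0) :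
    IsFundamentalSystem c₁ c₂ lam y := by
  refine isFundamentalSystem_of_linearIndependent (fun j => (hh j).isSolution hlam hα (hy j))
    fun a ha => hli a fun w => ?_
  refine congrFun (eq_zero_of_comp_log_eq_zero (f := fun w => ∑ j, a j * h j w)
    (Differentiable.fun_sum fun j _ => (hh j).differentiable.const_mul _)
    (Complex.log (lam / 256)) fun r hr => ?_) w
  rw [← ha r hr]
  exact Finset.sum_congr rfl fun j _ => by rw [hy j r hr]

end EulerFour

/-! ### Monodromy and linear independence -/

namespace EulerFour

open Set Filter Topology

theorem monodromySub_zero (μ : ℂ) : monodromySub μ 0 = 0 := by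
  funext w
  simp [monodromySub]

theorem monodromySub_comm (μ ν : ℂ) (h : ℂ → ℂ) :
    monodromySub μ (monodromySub ν h) = monodromySub ν (monodromySub μ h) := by
  funext w
  simp only [monodromySub]
  ring

theorem monodromySub_iterate_comm (μ ν : ℂ) (n : ℕ) (h : ℂ → ℂ) :
    (monodromySub μ)^[n] (monodromySub ν h) = monodromySub ν ((monodromySub μ)^[n] h) :=
  (Function.Commute.iterate_left (fun g => monodromySub_comm μ ν g) n) h

theorem monodromySub_eq_add (μ ν : ℂ) (h : ℂ → ℂ) :
    monodromySub ν h = fun w => monodromySub μ h w + (μ - ν) * h w := by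
  funext w
  simp only [monodromySub]
  ring

/-- `h` is a generalized eigenvector of exact rank `n + 1` of the shift by `2πi`. -/
structure IsJordan (μ : ℂ) (n : ℕ) (h : ℂ → ℂ) : Prop where
  ne_zero' : (monodromySub μ)^[n] h ≠ 0
  eq_zero' : (monodromySub μ)^[n + 1] h = 0

namespace IsJordan

variable {μ ν : ℂ} {n : ℕ} {h : ℂ → ℂ}

theorem monodromySub_eq_zero (hj : IsJordan μ 0 h) : monodromySub μ h = 0 := hj.eq_zero'

theorem exists_ne_zero (hj : IsJordan μ 0 h) : ∃ w, h w ≠ 0 := Function.ne_iff.1 hj.ne_zero'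

theorem succ (hj : IsJordan μ n (monodromySub μ h)) : IsJordan μ (n + 1) h :=
  ⟨hj.ne_zero', hj.eq_zero'⟩

/-- On a generalized eigenvector for `μ`, the operator `T - ν` lowers the rank by one if `ν = μ`.
Otherwise it is `(T - μ) + (μ - ν)`, a nilpotent plus a nonzero scalar, and preserves the rank. -/
theorem step (hj : IsJordan μ (n + if ν = μ then 1 else 0) h) :
    IsJordan μ n (monodromySub ν h) := by
  split_ifs at hj with hν
  · subst hν
    exact ⟨hj.ne_zero', hj.eq_zero'⟩
  · refine ⟨fun h0 => hj.ne_zero' ?_, ?_⟩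
    · rw [monodromySub_iterate_comm, monodromySub_eq_add μ, ← Function.iterate_succ_apply' (monodromySub μ),
        hj.eq_zero'] at h0
      funext w
      have := congrFun h0 w
      simp only [Pi.zero_apply, zero_add, mul_eq_zero, sub_eq_zero] at this
      exact this.resolve_left fun h => hν h.symm
    · have := hj.eq_zero'
      rw [add_zero] at this
      rw [monodromySub_iterate_comm, this, monodromySub_zero]

end IsJordan

/-- Generalized eigenvectors whose ranks count the later equal eigenvalues are independent. -/
theorem eq_zero_of_isJordan {μ : Fin 4 → ℂ} {h : Fin 4 → ℂ → ℂ}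
    (h0 : IsJordan (μ 0) (0 + (if μ 1 = μ 0 then 1 else 0) + (if μ 2 = μ 0 then 1 else 0)
      + if μ 3 = μ 0 then 1 else 0) (h 0))
    (h1 : IsJordan (μ 1) (0 + (if μ 2 = μ 1 then 1 else 0) + if μ 3 = μ 1 then 1 else 0) (h 1))
    (h2 : IsJordan (μ 2) (0 + if μ 3 = μ 2 then 1 else 0) (h 2))
    (h3 : IsJordan (μ 3) 0 (h 3)) (a : Fin 4 → ℂ) (ha : ∀ w, ∑ j, a j * h j w = 0) : a = 0 := by
  have lin : ∀ (ν : ℂ) (c : Fin 4 → ℂ) (g : Fin 4 → ℂ → ℂ), (∀ w, ∑ j, c j * g j w = 0) →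
      ∀ w, ∑ j, c j * monodromySub ν (g j) w = 0 := fun ν c g hg w => by
    have e1 := hg (w + 2 * Real.pi * Complex.I)
    have e2 := hg w
    rw [Fin.sum_univ_four] at e1 e2 ⊢
    simp only [monodromySub]
    linear_combination e1 - ν * e2
  -- A triangular scheme: the successive factors annihilate `h 3`, `h 2`, `h 1`, while `h 0` keeps a
  -- nonzero image of rank one. Going back up determines the other coefficients.
  have s3 := lin (μ 3) a h ha
  have s2 := lin (μ 2) a _ s3
  have s1 := lin (μ 1) a _ s2
  have z3 := h3.monodromySub_eq_zero
  have z2 := h2.step.monodromySub_eq_zero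
  have z1 := h1.step.step.monodromySub_eq_zero
  have a0 : a 0 = 0 := by
    obtain ⟨w, hw⟩ := h0.step.step.step.exists_ne_zero
    have := s1 w
    simp only [Fin.sum_univ_four, z3, z2, z1, monodromySub_zero] at this
    simpa [hw] using this
  have a1 : a 1 = 0 := by
    obtain ⟨w, hw⟩ := h1.step.step.exists_ne_zero
    have := s2 w
    simp only [Fin.sum_univ_four, z3, z2, a0, monodromySub_zero] at this
    simpa [hw] using this
  have a2 : a 2 = 0 := by
    obtain ⟨w, hw⟩ := h2.step.exists_ne_zero
    have := s3 w
    rw [Fin.sum_univ_four, z3, a0, a1] at this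
    simpa [hw] using this
  have a3 : a 3 = 0 := by
    obtain ⟨w, hw⟩ := h3.exists_ne_zero
    have := ha w
    rw [Fin.sum_univ_four, a0, a1, a2] at this
    simpa [hw] using this
  funext j
  fin_cases j
  exacts [a0, a1, a2, a3]

/-- The eigenvalue of the shift by `2πi` on `e^{bw}`. -/
noncomputable def multiplier (b : ℂ) : ℂ := Complex.exp (2 * Real.pi * Complex.I * b)

theorem multiplier_eq_iff {a b : ℂ} : multiplier a = multiplier b ↔ ∃ n : ℤ, a = b + n := by
  have h2 : (2 * Real.pi * Complex.I : ℂ) ≠ 0 := Complex.two_pi_I_ne_zero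
  rw [multiplier, multiplier, Complex.exp_eq_exp_iff_exists_int]
  refine exists_congr fun n => ⟨fun h => mul_left_cancel₀ h2 ?_, fun h => ?_⟩
  · linear_combination h
  · rw [h]; ring

theorem isJordan_hypTransform (w₀ a b c d : ℂ) :
    IsJordan (multiplier a) 0 (hypTransform w₀ a b c d) :=
  ⟨Function.ne_iff.2 (exists_hypTransform_ne_zero w₀ a b c d), monodromySub_hypTransform w₀ a b c d⟩

theorem isJordan_meijerTransform_singleton {b : Fin 4 → ℂ} {p : Fin 4}
    (h : ∀ k, ∀ n : ℕ, b k ≠ b p + n + 1) {k : ℂ} (hk : k ≠ 0) (c : ℂ) :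
    IsJordan (multiplier (b p)) 0 (fun w => k * meijerTransform {p} b (w + c)) := by
  refine ⟨?_, ?_⟩
  · obtain ⟨w, hw⟩ := exists_meijerTransform_ne_zero h
    refine Function.ne_iff.2 ⟨w - c, mul_ne_zero hk ?_⟩
    simpa using hw
  · funext w
    have := monodromySub_meijerTransform (Finset.mem_singleton_self p) b (w + c)
    rw [Finset.erase_singleton, meijerTransform_empty] at this
    simp only [Pi.zero_apply, mul_zero, monodromySub] at this
    simp only [zero_add, Function.iterate_one, monodromySub, multiplier, Pi.zero_apply]
    rw [add_right_comm]
    linear_combination k * this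

/-- Applying `T - μ` removes `i` again and so lowers the rank by one. The assumption covers all
nonzero factors and all translations because each removal introduces a constant and a shift by `πi`.
-/
theorem isJordan_meijerTransform_insert {b : Fin 4 → ℂ} {μ : ℂ} {n : ℕ} {σ : Finset (Fin 4)}
    (h : ∀ k : ℂ, k ≠ 0 → ∀ c, IsJordan μ n (fun w => k * meijerTransform σ b (w + c)))
    {i : Fin 4} (hi : i ∉ σ) (hμ : multiplier (b i) = μ) {k : ℂ} (hk : k ≠ 0) (c : ℂ) :
    IsJordan μ (n + 1) (fun w => k * meijerTransform (insert i σ) b (w + c)) := by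
  refine IsJordan.succ ?_
  set e := -2 * Real.pi * Complex.I * Complex.exp (Real.pi * Complex.I * b i) with he
  have he0 : e ≠ 0 := by
    have := Complex.two_pi_I_ne_zero
    have h2 := Complex.exp_ne_zero (Real.pi * Complex.I * b i)
    rw [he, show -2 * Real.pi * Complex.I * Complex.exp (Real.pi * Complex.I * b i)
      = -((2 * Real.pi * Complex.I) * Complex.exp (Real.pi * Complex.I * b i)) by ring]
    exact neg_ne_zero.2 (mul_ne_zero this h2)
  have heq : monodromySub μ (fun w => k * meijerTransform (insert i σ) b (w + c)) =
      fun w => (k * e) * meijerTransform σ b (w + (c + Real.pi * Complex.I)) := by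
    funext w
    have := monodromySub_meijerTransform (Finset.mem_insert_self i σ) b (w + c)
    rw [Finset.erase_insert hi] at this
    simp only [monodromySub] at this
    simp only [monodromySub, ← hμ, multiplier, ← add_assoc]
    rw [add_right_comm]
    linear_combination k * this
  rw [heq]
  exact h _ (mul_ne_zero hk he0) _

theorem derivSub_comp_add (c ε : ℂ) (h : ℂ → ℂ) :
    derivSub c (fun w => h (w + ε)) = fun w => derivSub c h (w + ε) := by
  funext w
  simp only [derivSub, deriv_comp_add_const]

theorem derivSub_const_mul {h : ℂ → ℂ} (c k : ℂ) :
    derivSub c (fun w => k * h w) = fun w => k * derivSub c h w := by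
  funext w
  simp only [derivSub, deriv_const_mul_field]
  ring

/-- The translation `ε` absorbs the sign `(-1)^card σ`; this is why an odd number of numerator
factors calls for the argument `-z`. -/
theorem solvesMeijer_meijerTransform {b : Fin 4 → ℂ} {σ : Finset (Fin 4)} (k : ℂ) {ε : ℂ}
    (hε : (-1) ^ σ.card * Complex.exp ε = 1) :
    SolvesMeijer b (fun w => k * meijerTransform σ b (w + ε)) := by
  refine ⟨((differentiable_meijerTransform σ b).comp
    (differentiable_id.add_const ε)).const_mul k, fun w => ?_⟩
  simp only [derivSub_const_mul, derivSub_comp_add (h := meijerTransform σ b),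
    derivSub_comp_add, derivSub_meijerTransform, Complex.exp_add]
  linear_combination (k * Complex.exp w * meijerTransform σ b (w + ε)) * hε

theorem meijerG_eq (m : ℕ) (b : Fin 4 → ℂ) {z : ℂ} (hz : z ≠ 0) :
    meijerG m b z = (2 * Real.pi * Complex.I)⁻¹
      * meijerTransform (Finset.univ.filter fun j : Fin 4 => (j : ℕ) < m) b (Complex.log z) := by
  have h : ∀ s, meijerIntegrand m b z s =
      gammaWeight (Finset.univ.filter fun j : Fin 4 => (j : ℕ) < m) b s
        * Complex.exp (Complex.log z * s) := fun s => by
    simp only [meijerIntegrand, gammaWeight, Complex.cpow_def_of_ne_zero hz, Finset.mem_filter,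
      Finset.mem_univ, true_and]
  simp only [meijerG, meijerTransform, loopTransform, loopIntegral, h, Complex.ofReal_neg]

/-- Since `r⁴ > 0`, the principal logarithm of `z_r` splits without a branch jump. The two
hypotheses express that contour and weight do not depend on the order in which the exponents are
listed. -/
theorem meijerSol_eq {m : ℕ} {lam a b c d : ℂ} (hlam : lam ≠ 0) {β : Fin 4 → ℂ}
    {σ : Finset (Fin 4)} (hbound : meijerBound ![a / 4, b / 4, c / 4, d / 4] = meijerBound β)
    (hweight : gammaWeight (Finset.univ.filter fun j : Fin 4 => (j : ℕ) < m)
      ![a / 4, b / 4, c / 4, d / 4] = gammaWeight σ β) {r : ℝ} (hr : 0 < r) :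
    meijerSol m lam a b c d r = (2 * Real.pi * Complex.I)⁻¹
      * meijerTransform σ β (Complex.log (lam / 256) + 4 * (Real.log r : ℂ)) := by
  have hlam' : lam / 256 ≠ 0 := div_ne_zero hlam (by norm_num)
  have hz : lam * (r : ℂ) ^ 4 / 256 = (r ^ 4 : ℝ) * (lam / 256) := by push_cast; ring
  have hlog : Complex.log (lam * (r : ℂ) ^ 4 / 256) =
      Complex.log (lam / 256) + 4 * (Real.log r : ℂ) := by
    rw [hz, Complex.log_ofReal_mul (by positivity) hlam', Real.log_pow]
    push_cast
    ring
  have hne : lam * (r : ℂ) ^ 4 / 256 ≠ 0 := by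
    rw [hz]
    exact mul_ne_zero (Complex.ofReal_ne_zero.2 (by positivity)) hlam'
  rw [meijerSol, meijerG_eq _ _ hne, hlog, meijerTransform, meijerTransform, hbound, hweight]

theorem hypSol_eq {lam : ℂ} (hlam : lam ≠ 0) (a b c d : ℂ) {r : ℝ} (hr : 0 < r) :
    hypSol lam a b c d r = hypTransform (Complex.log (lam / 256)) (a / 4) (b / 4) (c / 4) (d / 4)
      (Complex.log (lam / 256) + 4 * (Real.log r : ℂ)) := by
  have hr' : (r : ℂ) ≠ 0 := Complex.ofReal_ne_zero.2 hr.ne'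
  rw [hypSol, hypTransform, exp_log_add (div_ne_zero hlam (by norm_num)) hr,
    Complex.cpow_def_of_ne_zero hr', Complex.ofReal_log hr.le]
  ring_nf

end EulerFour

/-! ### The five configurations of exponents -/

namespace EulerFour

open Set Filter Topology

/-- `y(r) = h(log z_r)` for an entire `h` that solves the equation of Meijer's function and is a
generalized eigenvector of rank `n + 1` of the shift by `2πi`. -/
def IsJordanSolution (lam : ℂ) (β : Fin 4 → ℂ) (μ : ℂ) (n : ℕ) (y : ℝ → ℂ) : Prop :=
  ∃ h, SolvesMeijer β h ∧ IsJordan μ n h ∧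
    ∀ r : ℝ, 0 < r → y r = h (Complex.log (lam / 256) + 4 * (Real.log r : ℂ))

theorem isFundamentalSystem_of_isJordanSolution {c₁ c₂ : ℝ} {lam : ℂ} (hlam : lam ≠ 0)
    {α : Fin 4 → ℂ} (hα : IsCharExponents c₁ c₂ α) {m₀ m₁ m₂ m₃ : ℂ} {y : Fin 4 → ℝ → ℂ}
    (h0 : IsJordanSolution lam (fun j => α j / 4) m₀
      (0 + (if m₁ = m₀ then 1 else 0) + (if m₂ = m₀ then 1 else 0)
      + if m₃ = m₀ then 1 else 0) (y 0))
    (h1 : IsJordanSolution lam (fun j => α j / 4) m₁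
      (0 + (if m₂ = m₁ then 1 else 0) + if m₃ = m₁ then 1 else 0) (y 1))
    (h2 : IsJordanSolution lam (fun j => α j / 4) m₂ (0 + if m₃ = m₂ then 1 else 0) (y 2))
    (h3 : IsJordanSolution lam (fun j => α j / 4) m₃ 0 (y 3)) :
    IsFundamentalSystem c₁ c₂ lam y := by
  obtain ⟨g0, s0, j0, e0⟩ := h0
  obtain ⟨g1, s1, j1, e1⟩ := h1
  obtain ⟨g2, s2, j2, e2⟩ := h2
  obtain ⟨g3, s3, j3, e3⟩ := h3
  refine isFundamentalSystem_of_solvesMeijer hlam hα (h := ![g0, g1, g2, g3]) (fun j => ?_)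
    (fun j => ?_) (eq_zero_of_isJordan (μ := ![m₀, m₁, m₂, m₃]) j0 j1 j2 j3)
  · fin_cases j
    exacts [s0, s1, s2, s3]
  · fin_cases j
    exacts [e0, e1, e2, e3]

/-- No `b k - b p` is a positive integer. -/
def IsTop (b : Fin 4 → ℂ) (p : Fin 4) : Prop := ∀ k, ∀ n : ℕ, b k ≠ b p + n + 1

theorem isTop_of_forall {b : Fin 4 → ℂ} {p : Fin 4}
    (h : ∀ k, (∃ m : ℕ, b p = b k + m) ∨ multiplier (b k) ≠ multiplier (b p)) : IsTop b p := by
  intro k n hk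
  rcases h k with ⟨m, hm⟩ | h
  · have h1 : ((m + n + 1 : ℕ) : ℂ) = 0 := by
      push_cast
      linear_combination -hk - hm
    exact absurd (Nat.cast_eq_zero.1 h1) (by omega)
  · exact h (multiplier_eq_iff.2 ⟨n + 1, by rw [hk]; push_cast; ring⟩)

/-- Maximality of `β p` is exactly what keeps the Pochhammer symbols in the denominators from
vanishing. -/
theorem isJordanSolution_hypSol {lam : ℂ} (hlam : lam ≠ 0) {β : Fin 4 → ℂ} {p i j k : Fin 4}
    (hp : IsTop β p) {a b c d : ℂ} (ha : β p = a / 4) (hb : β i = b / 4) (hc : β j = c / 4)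
    (hd : β k = d / 4) (hperm : ∀ x, (x - β 0) * (x - β 1) * (x - β 2) * (x - β 3) =
      (x - β p) * (x - β i) * (x - β j) * (x - β k)) :
    IsJordanSolution lam β (multiplier (β p)) 0 (hypSol lam a b c d) := by
  refine ⟨hypTransform (Complex.log (lam / 256)) (β p) (β i) (β j) (β k),
    ⟨differentiable_hypTransform _ _ _ _ _, fun w => ?_⟩, isJordan_hypTransform _ _ _ _ _,
    fun r hr => by rw [hypSol_eq hlam _ _ _ _ hr, ha, hb, hc, hd]⟩
  have hne : ∀ l, ∀ n : ℕ, 1 + β p - β l + n ≠ 0 := fun l n h0 =>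
    hp l n (by linear_combination -h0)
  exact derivSub_hypTransform (hne i) (hne j) (hne k) hperm _ w

theorem isJordanSolution_meijerSol {m n : ℕ} {lam lam' a b c d μ : ℂ} (hlam' : lam' ≠ 0)
    {β : Fin 4 → ℂ} {σ : Finset (Fin 4)}
    (hσ : (-1) ^ σ.card * Complex.exp (Complex.log (lam' / 256) - Complex.log (lam / 256)) = 1)
    (hj : ∀ k : ℂ, k ≠ 0 → ∀ c, IsJordan μ n (fun w => k * meijerTransform σ β (w + c)))
    (hbound : meijerBound ![a / 4, b / 4, c / 4, d / 4] = meijerBound β)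
    (hweight : gammaWeight (Finset.univ.filter fun j : Fin 4 => (j : ℕ) < m)
      ![a / 4, b / 4, c / 4, d / 4] = gammaWeight σ β) :
    IsJordanSolution lam β μ n (meijerSol m lam' a b c d) := by
  refine ⟨fun w => (2 * Real.pi * Complex.I)⁻¹ * meijerTransform σ β
    (w + (Complex.log (lam' / 256) - Complex.log (lam / 256))),
    solvesMeijer_meijerTransform _ hσ, hj _ (inv_ne_zero Complex.two_pi_I_ne_zero) _,
    fun r hr => ?_⟩
  rw [meijerSol_eq hlam' hbound hweight hr]
  congr 2
  ring

/-- Two congruent exponents in the numerator, one of them maximal: `T - μ` leads to the nonzero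
one-factor integral and then to zero. -/
theorem isJordanSolution_meijerSol_two {lam a b c d : ℂ} (hlam : lam ≠ 0)
    {β : Fin 4 → ℂ} {i p : Fin 4} (hip : i ≠ p) (hp : IsTop β p)
    (hμ : multiplier (β i) = multiplier (β p))
    (hbound : meijerBound ![a / 4, b / 4, c / 4, d / 4] = meijerBound β)
    (hweight : gammaWeight (Finset.univ.filter fun j : Fin 4 => (j : ℕ) < 2)
      ![a / 4, b / 4, c / 4, d / 4] = gammaWeight {i, p} β) :
    IsJordanSolution lam β (multiplier (β p)) 1 (meijerSol 2 lam a b c d) :=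
  isJordanSolution_meijerSol hlam (by simp [Finset.card_pair hip])
    (fun _ hk c => isJordan_meijerTransform_insert
      (fun _ hk c => isJordan_meijerTransform_singleton hp hk c) (by simpa using hip) hμ hk c)
    hbound hweight

theorem isTop_of_four {b : Fin 4 → ℂ} {p : Fin 4}
    (h0 : (∃ m : ℕ, b p = b 0 + m) ∨ multiplier (b 0) ≠ multiplier (b p))
    (h1 : (∃ m : ℕ, b p = b 1 + m) ∨ multiplier (b 1) ≠ multiplier (b p))
    (h2 : (∃ m : ℕ, b p = b 2 + m) ∨ multiplier (b 2) ≠ multiplier (b p))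
    (h3 : (∃ m : ℕ, b p = b 3 + m) ∨ multiplier (b 3) ≠ multiplier (b p)) : IsTop b p :=
  isTop_of_forall fun l => by
    fin_cases l
    exacts [h0, h1, h2, h3]

theorem multiplier_eq_of_add_nat {a b : ℂ} {k : ℕ} (h : a = b + k) :
    multiplier a = multiplier b :=
  multiplier_eq_iff.2 ⟨k, by rw [h]; push_cast; rfl⟩

section

variable {c₁ c₂ : ℝ} {lam : ℂ} {α : Fin 4 → ℂ}

/-- The classes modulo `4` are `{α 0, α 3}`, `{α 1}`, `{α 2}`. Only the first has two members, and
its Meijer function is listed before the series for its maximal member `α 3`. -/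
theorem isFundamentalSystem_line_outer (hlam : lam ≠ 0) (hα : IsCharExponents c₁ c₂ α) {k : ℕ}
    (h03 : α 3 / 4 = α 0 / 4 + k) (h10 : multiplier (α 1 / 4) ≠ multiplier (α 0 / 4))
    (h20 : multiplier (α 2 / 4) ≠ multiplier (α 0 / 4))
    (h21 : multiplier (α 2 / 4) ≠ multiplier (α 1 / 4)) :
    IsFundamentalSystem c₁ c₂ lam
      ![meijerSol 2 lam (α 0) (α 3) (α 1) (α 2), hypSol lam (α 1) (α 0) (α 2) (α 3),
        hypSol lam (α 2) (α 0) (α 1) (α 3), hypSol lam (α 3) (α 0) (α 1) (α 2)] := by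
  have m30 := multiplier_eq_of_add_nat h03
  have h13 : multiplier (α 1 / 4) ≠ multiplier (α 3 / 4) := by rwa [m30]
  have h23 : multiplier (α 2 / 4) ≠ multiplier (α 3 / 4) := by rwa [m30]
  have t1 : IsTop (fun j => α j / 4) 1 :=
    isTop_of_four (.inr h10.symm) (.inl ⟨0, by simp⟩) (.inr h21) (.inr h13.symm)
  have t2 : IsTop (fun j => α j / 4) 2 :=
    isTop_of_four (.inr h20.symm) (.inr h21.symm) (.inl ⟨0, by simp⟩) (.inr h23.symm)
  have t3 : IsTop (fun j => α j / 4) 3 :=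
    isTop_of_four (.inl ⟨k, h03⟩) (.inr h13) (.inr h23) (.inl ⟨0, by simp⟩)
  -- The eigenvalue of the first function is named after the top of its class, so that equality with
  -- the last eigenvalue holds by `rfl`.
  refine isFundamentalSystem_of_isJordanSolution hlam hα (m₀ := multiplier (α 3 / 4))
    (m₁ := multiplier (α 1 / 4)) (m₂ := multiplier (α 2 / 4)) (m₃ := multiplier (α 3 / 4))
    ?_ ?_ ?_ ?_
  · rw [if_neg h13, if_neg h23, if_pos rfl]
    refine isJordanSolution_meijerSol_two (i := 0) (p := 3) hlam (by decide) t3 m30.symm ?_ ?_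
    · simp [meijerBound, Fin.sum_univ_four]; ring
    · funext s; simp [gammaWeight, Fin.prod_univ_four, -mul_eq_mul_right_iff]; ring
  · rw [if_neg h21, if_neg h13.symm]
    exact isJordanSolution_hypSol (p := 1) (i := 0) (j := 2) (k := 3) hlam t1 rfl rfl rfl rfl
      (fun x => by ring)
  · rw [if_neg h23.symm]
    exact isJordanSolution_hypSol (p := 2) (i := 0) (j := 1) (k := 3) hlam t2 rfl rfl rfl rfl
      (fun x => by ring)
  · exact isJordanSolution_hypSol (p := 3) (i := 0) (j := 1) (k := 2) hlam t3 rfl rfl rfl rfl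
      (fun x => by ring)

theorem isFundamentalSystem_line_inner (hlam : lam ≠ 0) (hα : IsCharExponents c₁ c₂ α) {k : ℕ}
    (h12 : α 2 / 4 = α 1 / 4 + k) (h10 : multiplier (α 1 / 4) ≠ multiplier (α 0 / 4))
    (h30 : multiplier (α 3 / 4) ≠ multiplier (α 0 / 4))
    (h31 : multiplier (α 3 / 4) ≠ multiplier (α 1 / 4)) :
    IsFundamentalSystem c₁ c₂ lam
      ![hypSol lam (α 0) (α 1) (α 2) (α 3), meijerSol 2 lam (α 1) (α 2) (α 0) (α 3),
        hypSol lam (α 2) (α 0) (α 1) (α 3), hypSol lam (α 3) (α 0) (α 1) (α 2)] := by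
  have m21 := multiplier_eq_of_add_nat h12
  have h20 : multiplier (α 2 / 4) ≠ multiplier (α 0 / 4) := by rwa [m21]
  have h32 : multiplier (α 3 / 4) ≠ multiplier (α 2 / 4) := by rwa [m21]
  have t0 : IsTop (fun j => α j / 4) 0 :=
    isTop_of_four (.inl ⟨0, by simp⟩) (.inr h10) (.inr h20) (.inr h30)
  have t2 : IsTop (fun j => α j / 4) 2 :=
    isTop_of_four (.inr h20.symm) (.inl ⟨k, h12⟩) (.inl ⟨0, by simp⟩) (.inr h32)
  have t3 : IsTop (fun j => α j / 4) 3 :=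
    isTop_of_four (.inr h30.symm) (.inr h31.symm) (.inr h32.symm) (.inl ⟨0, by simp⟩)
  refine isFundamentalSystem_of_isJordanSolution hlam hα (m₀ := multiplier (α 0 / 4))
    (m₁ := multiplier (α 2 / 4)) (m₂ := multiplier (α 2 / 4)) (m₃ := multiplier (α 3 / 4))
    ?_ ?_ ?_ ?_
  · rw [if_neg h20, if_neg h30]
    exact isJordanSolution_hypSol (p := 0) (i := 1) (j := 2) (k := 3) hlam t0 rfl rfl rfl rfl
      (fun x => by ring)
  · rw [if_pos rfl, if_neg h32]
    refine isJordanSolution_meijerSol_two (i := 1) (p := 2) hlam (by decide) t2 m21.symm ?_ ?_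
    · simp [meijerBound, Fin.sum_univ_four]; ring
    · funext s; simp [gammaWeight, Fin.prod_univ_four, -mul_eq_mul_right_iff]; ring
  · rw [if_neg h32]
    exact isJordanSolution_hypSol (p := 2) (i := 0) (j := 1) (k := 3) hlam t2 rfl rfl rfl rfl
      (fun x => by ring)
  · exact isJordanSolution_hypSol (p := 3) (i := 0) (j := 1) (k := 2) hlam t3 rfl rfl rfl rfl
      (fun x => by ring)

/-- Two classes of two, `{α 0, α 2}` and `{α 1, α 3}`: both Meijer functions have rank two and
precede the two series of rank one. -/
theorem isFundamentalSystem_parabola_outer (hlam : lam ≠ 0) (hα : IsCharExponents c₁ c₂ α)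
    {k l : ℕ} (h02 : α 2 / 4 = α 0 / 4 + k) (h13 : α 3 / 4 = α 1 / 4 + l)
    (h10 : multiplier (α 1 / 4) ≠ multiplier (α 0 / 4)) :
    IsFundamentalSystem c₁ c₂ lam
      ![meijerSol 2 lam (α 0) (α 2) (α 1) (α 3), meijerSol 2 lam (α 1) (α 3) (α 0) (α 2),
        hypSol lam (α 2) (α 0) (α 1) (α 3), hypSol lam (α 3) (α 0) (α 1) (α 2)] := by
  have m20 := multiplier_eq_of_add_nat h02
  have m31 := multiplier_eq_of_add_nat h13
  have h12 : multiplier (α 1 / 4) ≠ multiplier (α 2 / 4) := by rwa [m20]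
  have h30 : multiplier (α 3 / 4) ≠ multiplier (α 0 / 4) := by rwa [m31]
  have h32 : multiplier (α 3 / 4) ≠ multiplier (α 2 / 4) := by rwa [m20]
  have t2 : IsTop (fun j => α j / 4) 2 :=
    isTop_of_four (.inl ⟨k, h02⟩) (.inr h12) (.inl ⟨0, by simp⟩) (.inr h32)
  have t3 : IsTop (fun j => α j / 4) 3 :=
    isTop_of_four (.inr h30.symm) (.inl ⟨l, h13⟩) (.inr h32.symm) (.inl ⟨0, by simp⟩)
  refine isFundamentalSystem_of_isJordanSolution hlam hα (m₀ := multiplier (α 2 / 4))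
    (m₁ := multiplier (α 3 / 4)) (m₂ := multiplier (α 2 / 4)) (m₃ := multiplier (α 3 / 4))
    ?_ ?_ ?_ ?_
  · rw [if_neg h32, if_pos rfl]
    refine isJordanSolution_meijerSol_two (i := 0) (p := 2) hlam (by decide) t2 m20.symm ?_ ?_
    · simp [meijerBound, Fin.sum_univ_four]; ring
    · funext s; simp [gammaWeight, Fin.prod_univ_four, -mul_eq_mul_right_iff]; ring
  · rw [if_pos rfl, if_neg h32.symm]
    refine isJordanSolution_meijerSol_two (i := 1) (p := 3) hlam (by decide) t3 m31.symm ?_ ?_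
    · simp [meijerBound, Fin.sum_univ_four]; ring
    · funext s; simp [gammaWeight, Fin.prod_univ_four, -mul_eq_mul_right_iff]; ring
  · rw [if_neg h32]
    exact isJordanSolution_hypSol (p := 2) (i := 0) (j := 1) (k := 3) hlam t2 rfl rfl rfl rfl
      (fun x => by ring)
  · exact isJordanSolution_hypSol (p := 3) (i := 0) (j := 1) (k := 2) hlam t3 rfl rfl rfl rfl
      (fun x => by ring)

theorem isFundamentalSystem_parabola_inner (hlam : lam ≠ 0) (hα : IsCharExponents c₁ c₂ α)
    {k l : ℕ} (h01 : α 1 / 4 = α 0 / 4 + k) (h23 : α 3 / 4 = α 2 / 4 + l)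
    (h20 : multiplier (α 2 / 4) ≠ multiplier (α 0 / 4)) :
    IsFundamentalSystem c₁ c₂ lam
      ![meijerSol 2 lam (α 0) (α 1) (α 2) (α 3), hypSol lam (α 1) (α 0) (α 2) (α 3),
        meijerSol 2 lam (α 2) (α 3) (α 0) (α 1), hypSol lam (α 3) (α 0) (α 1) (α 2)] := by
  have m10 := multiplier_eq_of_add_nat h01
  have m32 := multiplier_eq_of_add_nat h23
  have h21 : multiplier (α 2 / 4) ≠ multiplier (α 1 / 4) := by rwa [m10]
  have h30 : multiplier (α 3 / 4) ≠ multiplier (α 0 / 4) := by rwa [m32]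
  have h31 : multiplier (α 3 / 4) ≠ multiplier (α 1 / 4) := by rwa [m10]
  have t1 : IsTop (fun j => α j / 4) 1 :=
    isTop_of_four (.inl ⟨k, h01⟩) (.inl ⟨0, by simp⟩) (.inr h21) (.inr h31)
  have t3 : IsTop (fun j => α j / 4) 3 :=
    isTop_of_four (.inr h30.symm) (.inr h31.symm) (.inl ⟨l, h23⟩) (.inl ⟨0, by simp⟩)
  refine isFundamentalSystem_of_isJordanSolution hlam hα (m₀ := multiplier (α 1 / 4))
    (m₁ := multiplier (α 1 / 4)) (m₂ := multiplier (α 3 / 4)) (m₃ := multiplier (α 3 / 4))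
    ?_ ?_ ?_ ?_
  · rw [if_pos rfl, if_neg h31]
    refine isJordanSolution_meijerSol_two (i := 0) (p := 1) hlam (by decide) t1 m10.symm ?_ ?_
    · simp [meijerBound, Fin.sum_univ_four]
    · funext s; simp [gammaWeight, Fin.prod_univ_four]
  · rw [if_neg h31]
    exact isJordanSolution_hypSol (p := 1) (i := 0) (j := 2) (k := 3) hlam t1 rfl rfl rfl rfl
      (fun x => by ring)
  · rw [if_pos rfl]
    refine isJordanSolution_meijerSol_two (i := 2) (p := 3) hlam (by decide) t3 m32.symm ?_ ?_
    · simp [meijerBound, Fin.sum_univ_four]; ring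
    · funext s; simp [gammaWeight, Fin.prod_univ_four, -mul_eq_mul_right_iff]; ring
  · exact isJordanSolution_hypSol (p := 3) (i := 0) (j := 1) (k := 2) hlam t3 rfl rfl rfl rfl
      (fun x => by ring)

theorem isFundamentalSystem_two_lines (hlam : lam ≠ 0) (hα : IsCharExponents c₁ c₂ α)
    {k l : ℕ} (h03 : α 3 / 4 = α 0 / 4 + k) (h12 : α 2 / 4 = α 1 / 4 + l)
    (h10 : multiplier (α 1 / 4) ≠ multiplier (α 0 / 4)) :
    IsFundamentalSystem c₁ c₂ lam
      ![meijerSol 2 lam (α 0) (α 3) (α 1) (α 2), meijerSol 2 lam (α 1) (α 2) (α 0) (α 3),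
        hypSol lam (α 2) (α 0) (α 1) (α 3), hypSol lam (α 3) (α 0) (α 1) (α 2)] := by
  have m30 := multiplier_eq_of_add_nat h03
  have m21 := multiplier_eq_of_add_nat h12
  have h13 : multiplier (α 1 / 4) ≠ multiplier (α 3 / 4) := by rwa [m30]
  have h20 : multiplier (α 2 / 4) ≠ multiplier (α 0 / 4) := by rwa [m21]
  have h23 : multiplier (α 2 / 4) ≠ multiplier (α 3 / 4) := by rwa [m30]
  have t2 : IsTop (fun j => α j / 4) 2 :=
    isTop_of_four (.inr h20.symm) (.inl ⟨l, h12⟩) (.inl ⟨0, by simp⟩) (.inr h23.symm)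
  have t3 : IsTop (fun j => α j / 4) 3 :=
    isTop_of_four (.inl ⟨k, h03⟩) (.inr h13) (.inr h23) (.inl ⟨0, by simp⟩)
  refine isFundamentalSystem_of_isJordanSolution hlam hα (m₀ := multiplier (α 3 / 4))
    (m₁ := multiplier (α 2 / 4)) (m₂ := multiplier (α 2 / 4)) (m₃ := multiplier (α 3 / 4))
    ?_ ?_ ?_ ?_
  · rw [if_neg h23, if_pos rfl]
    refine isJordanSolution_meijerSol_two (i := 0) (p := 3) hlam (by decide) t3 m30.symm ?_ ?_
    · simp [meijerBound, Fin.sum_univ_four]; ring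
    · funext s; simp [gammaWeight, Fin.prod_univ_four, -mul_eq_mul_right_iff]; ring
  · rw [if_pos rfl, if_neg h23.symm]
    refine isJordanSolution_meijerSol_two (i := 1) (p := 2) hlam (by decide) t2 m21.symm ?_ ?_
    · simp [meijerBound, Fin.sum_univ_four]; ring
    · funext s; simp [gammaWeight, Fin.prod_univ_four, -mul_eq_mul_right_iff]; ring
  · rw [if_neg h23.symm]
    exact isJordanSolution_hypSol (p := 2) (i := 0) (j := 1) (k := 3) hlam t2 rfl rfl rfl rfl
      (fun x => by ring)
  · exact isJordanSolution_hypSol (p := 3) (i := 0) (j := 1) (k := 2) hlam t3 rfl rfl rfl rfl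
      (fun x => by ring)

/-- All four eigenvalues coincide, so ranks four, three, two and one are needed; the numerator sets
shrink by one exponent at a time down to the maximal `α 3`. -/
theorem isFundamentalSystem_line_parabola (hlam : lam ≠ 0) (hα : IsCharExponents c₁ c₂ α)
    {k l m : ℕ} (h03 : α 3 / 4 = α 0 / 4 + k) (h13 : α 3 / 4 = α 1 / 4 + l)
    (h23 : α 3 / 4 = α 2 / 4 + m) :
    IsFundamentalSystem c₁ c₂ lam
      ![meijerSol 4 lam (α 0) (α 1) (α 2) (α 3), meijerSol 3 (-lam) (α 1) (α 2) (α 3) (α 0),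
        meijerSol 2 lam (α 2) (α 3) (α 0) (α 1), hypSol lam (α 3) (α 0) (α 1) (α 2)] := by
  have m0 := (multiplier_eq_of_add_nat h03).symm
  have m1 := (multiplier_eq_of_add_nat h13).symm
  have m2 := (multiplier_eq_of_add_nat h23).symm
  have t3 : IsTop (fun j => α j / 4) 3 :=
    isTop_of_four (.inl ⟨k, h03⟩) (.inl ⟨l, h13⟩) (.inl ⟨m, h23⟩) (.inl ⟨0, by simp⟩)
  have j2 : ∀ x : ℂ, x ≠ 0 → ∀ c, IsJordan (multiplier (α 3 / 4)) 1
      (fun w => x * meijerTransform {2, 3} (fun j => α j / 4) (w + c)) := fun x hx c =>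
    isJordan_meijerTransform_insert (i := 2) (σ := {3})
      (fun _ hk c => isJordan_meijerTransform_singleton t3 hk c) (by decide) m2 hx c
  have j1 : ∀ x : ℂ, x ≠ 0 → ∀ c, IsJordan (multiplier (α 3 / 4)) 2
      (fun w => x * meijerTransform {1, 2, 3} (fun j => α j / 4) (w + c)) := fun x hx c =>
    isJordan_meijerTransform_insert (i := 1) (σ := {2, 3}) j2 (by decide) m1 hx c
  have j0 : ∀ x : ℂ, x ≠ 0 → ∀ c, IsJordan (multiplier (α 3 / 4)) 3
      (fun w => x * meijerTransform {0, 1, 2, 3} (fun j => α j / 4) (w + c)) := fun x hx c =>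
    isJordan_meijerTransform_insert (i := 0) (σ := {1, 2, 3}) j1 (by decide) m0 hx c
  -- Whichever way the principal logarithm of `-lam / 256` falls, the translation has exponential
  -- `-1`, as three numerator factors require.
  have hexp : Complex.exp (Complex.log (-lam / 256) - Complex.log (lam / 256)) = -1 := by
    rw [Complex.exp_sub, Complex.exp_log (div_ne_zero (neg_ne_zero.2 hlam) (by norm_num)),
      Complex.exp_log (div_ne_zero hlam (by norm_num))]
    field_simp
  refine isFundamentalSystem_of_isJordanSolution hlam hα (m₀ := multiplier (α 3 / 4))
    (m₁ := multiplier (α 3 / 4)) (m₂ := multiplier (α 3 / 4)) (m₃ := multiplier (α 3 / 4))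
    ?_ ?_ ?_ ?_
  · rw [if_pos rfl]
    refine isJordanSolution_meijerSol hlam ?_ j0 ?_ ?_
    · rw [show ({0, 1, 2, 3} : Finset (Fin 4)).card = 4 by decide]
      norm_num
    · simp [meijerBound, Fin.sum_univ_four]
    · funext s; simp [gammaWeight, Fin.prod_univ_four]
  · rw [if_pos rfl]
    refine isJordanSolution_meijerSol (neg_ne_zero.2 hlam) ?_ j1 ?_ ?_
    · rw [show ({1, 2, 3} : Finset (Fin 4)).card = 3 by decide, hexp]
      norm_num
    · simp [meijerBound, Fin.sum_univ_four]; ring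
    · funext s; simp [gammaWeight, Fin.prod_univ_four, -mul_eq_mul_right_iff]; ring
  · rw [if_pos rfl]
    refine isJordanSolution_meijerSol_two (i := 2) (p := 3) hlam (by decide) t3 m2 ?_ ?_
    · simp [meijerBound, Fin.sum_univ_four]; ring
    · funext s; simp [gammaWeight, Fin.prod_univ_four, -mul_eq_mul_right_iff]; ring
  · exact isJordanSolution_hypSol (p := 3) (i := 0) (j := 1) (k := 2) hlam t3 rfl rfl rfl rfl
      (fun x => by ring)

end

end EulerFour

/-! ### Principal square roots, lines and parabolas -/

namespace EulerFour

theorem csqrt_sq (z : ℂ) : csqrt z ^ 2 = z := by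
  rw [csqrt, ← Complex.cpow_nat_mul]
  norm_num

theorem csqrt_re_nonneg (z : ℂ) : 0 ≤ (csqrt z).re := by
  rcases eq_or_ne z 0 with rfl | hz
  · simp [csqrt]
  rw [csqrt, Complex.cpow_def_of_ne_zero hz, Complex.exp_re]
  refine mul_nonneg (Real.exp_pos _).le (Real.cos_nonneg_of_mem_Icc ?_)
  have h : (Complex.log z * (1 / 2)).im = z.arg / 2 := by
    rw [show Complex.log z * (1 / 2) = Complex.log z / (2 : ℝ) by push_cast; ring,
      Complex.div_ofReal_im, Complex.log_im]
  rw [h]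
  constructor <;> linarith [Complex.neg_pi_lt_arg z, Complex.arg_le_pi z]

/-- A principal root has nonnegative real part, which decides between `v` and `-v` off the imaginary
axis. -/
theorem eq_csqrt {v z : ℂ} (h : v ^ 2 = z) (hv : 0 < v.re ∨ v = 0) : csqrt z = v := by
  have h1 : csqrt z = v ∨ csqrt z = -v := sq_eq_sq_iff_eq_or_eq_neg.1 (by rw [csqrt_sq, h])
  rcases h1 with h1 | h1
  · exact h1
  · rcases hv with hv | hv
    · have := csqrt_re_nonneg z
      rw [h1, Complex.neg_re] at this
      linarith
    · rw [h1, hv, neg_zero]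

/-- The difference `alpha₄ - alpha₁`. -/
noncomputable def rootOuter (c₁ c₂ : ℝ) : ℂ := csqrt (5 - 4 * c₁ + 4 * innerRoot c₁ c₂)

/-- The difference `alpha₃ - alpha₂`. -/
noncomputable def rootInner (c₁ c₂ : ℝ) : ℂ := csqrt (5 - 4 * c₁ - 4 * innerRoot c₁ c₂)

variable {c₁ c₂ : ℝ}

theorem innerRoot_sq : innerRoot c₁ c₂ ^ 2 = 1 - 4 * c₁ + c₁ ^ 2 - c₂ := csqrt_sq _

theorem rootOuter_sq : rootOuter c₁ c₂ ^ 2 = 5 - 4 * c₁ + 4 * innerRoot c₁ c₂ := csqrt_sq _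

theorem rootInner_sq : rootInner c₁ c₂ ^ 2 = 5 - 4 * c₁ - 4 * innerRoot c₁ c₂ := csqrt_sq _

theorem isCharExponents (c₁ c₂ : ℝ) :
    IsCharExponents c₁ c₂ ![alpha₁ c₁ c₂, alpha₂ c₁ c₂, alpha₃ c₁ c₂, alpha₄ c₁ c₂] := by
  have hA := rootOuter_sq (c₁ := c₁) (c₂ := c₂)
  have hB := rootInner_sq (c₁ := c₁) (c₂ := c₂)
  have hI := innerRoot_sq (c₁ := c₁) (c₂ := c₂)
  simp only [rootOuter, rootInner] at hA hB
  constructor <;> simp only [Matrix.cons_val, alpha₁, alpha₂, alpha₃, alpha₄]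
  all_goals
    generalize csqrt (5 - 4 * c₁ + 4 * innerRoot c₁ c₂) = A at *
    generalize csqrt (5 - 4 * c₁ - 4 * innerRoot c₁ c₂) = B at *
    generalize innerRoot c₁ c₂ = R at *
  · ring
  · linear_combination (-1 / 4 : ℂ) * hA - 1 / 4 * hB
  · linear_combination (-3 / 4 : ℂ) * hA - 3 / 4 * hB
  · linear_combination (-9 / 16 + B ^ 2 / 16 : ℂ) * hA
      + (-9 / 16 + (5 - 4 * c₁ + 4 * R) / 16 : ℂ) * hB - hI

theorem mem_lineL_iff_sq {k : ℕ} :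
    (c₁, c₂) ∈ lineL k ↔ (4 * innerRoot c₁ c₂) ^ 2 = (16 * (k : ℂ) ^ 2 - 5 + 4 * c₁) ^ 2 := by
  have hI := innerRoot_sq (c₁ := c₁) (c₂ := c₂)
  have h : (4 * innerRoot c₁ c₂) ^ 2 - (16 * (k : ℂ) ^ 2 - 5 + 4 * c₁) ^ 2 =
      ((-16 * (c₂ - (-9 - 24 * c₁ - 128 * c₁ * k ^ 2 + 160 * k ^ 2 - 256 * k ^ 4) / 16) : ℝ) : ℂ) := by
    push_cast
    linear_combination 16 * hI
  rw [← sub_eq_zero, h, Complex.ofReal_eq_zero, mul_eq_zero, sub_eq_zero]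
  simp [lineL]

theorem mem_parabolaP_iff_sq {k : ℕ} :
    (c₁, c₂) ∈ parabolaP k ↔
      innerRoot c₁ c₂ ^ 2 = 4 * (k : ℂ) ^ 2 * (5 - 4 * c₁ - 16 * (k : ℂ) ^ 2) := by
  have hI := innerRoot_sq (c₁ := c₁) (c₂ := c₂)
  have h : innerRoot c₁ c₂ ^ 2 - 4 * (k : ℂ) ^ 2 * (5 - 4 * c₁ - 16 * (k : ℂ) ^ 2) =
      ((-(c₂ - (1 - 4 * c₁ + c₁ ^ 2 + 16 * c₁ * k ^ 2 - 20 * k ^ 2 + 64 * k ^ 4)) : ℝ) : ℂ) := by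
    push_cast
    linear_combination hI
  rw [← sub_eq_zero, h, Complex.ofReal_eq_zero, neg_eq_zero, sub_eq_zero]
  simp [parabolaP]

theorem cast_natAbs_sq (n : ℤ) : ((n.natAbs : ℕ) : ℂ) ^ 2 = (n : ℂ) ^ 2 := by
  rw [← Int.cast_natCast (R := ℂ), ← Int.cast_pow, Int.natAbs_sq, Int.cast_pow]

theorem mem_lineL_of_rootOuter {n : ℤ} (h : rootOuter c₁ c₂ = 4 * n) :
    (c₁, c₂) ∈ lineL n.natAbs := by
  have hA := rootOuter_sq (c₁ := c₁) (c₂ := c₂)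
  rw [h] at hA
  rw [mem_lineL_iff_sq, cast_natAbs_sq]
  congr 1
  linear_combination -hA

theorem mem_lineL_of_rootInner {n : ℤ} (h : rootInner c₁ c₂ = 4 * n) :
    (c₁, c₂) ∈ lineL n.natAbs := by
  have hB := rootInner_sq (c₁ := c₁) (c₂ := c₂)
  rw [h] at hB
  rw [mem_lineL_iff_sq, cast_natAbs_sq, ← neg_sq]
  congr 1
  linear_combination -hB

/-- With `A`, `B`, `R` for the outer, inner and innermost root, `A² + B² = 10 - 8c₁` and `A² - B² =
8R`. Hence the product over both signs of `(A ± B)² - (8n)²` is `64` times the defining relation of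
the parabola. -/
theorem mem_parabolaP_of_sq {n : ℤ}
    (h : (rootOuter c₁ c₂ - rootInner c₁ c₂) ^ 2 = (8 * n) ^ 2 ∨
      (rootOuter c₁ c₂ + rootInner c₁ c₂) ^ 2 = (8 * n) ^ 2) :
    (c₁, c₂) ∈ parabolaP n.natAbs := by
  have hA := rootOuter_sq (c₁ := c₁) (c₂ := c₂)
  have hB := rootInner_sq (c₁ := c₁) (c₂ := c₂)
  rw [mem_parabolaP_iff_sq, cast_natAbs_sq]
  generalize rootOuter c₁ c₂ = A at *
  generalize rootInner c₁ c₂ = B at *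
  generalize innerRoot c₁ c₂ = R at *
  have hprod : ((A - B) ^ 2 - (8 * n) ^ 2) * ((A + B) ^ 2 - (8 * n) ^ 2) = 0 := by
    rcases h with h | h <;> simp [h]
  have hid : ((A - B) ^ 2 - (8 * n) ^ 2) * ((A + B) ^ 2 - (8 * n) ^ 2) =
      (A ^ 2 - B ^ 2) ^ 2 - 2 * (8 * n) ^ 2 * (A ^ 2 + B ^ 2) + (8 * n) ^ 4 := by ring
  rw [hid, hA, hB] at hprod
  linear_combination (1 / 64 : ℂ) * hprod

theorem mem_parabolaP_of_sub {n : ℤ} (h : rootOuter c₁ c₂ - rootInner c₁ c₂ = 8 * n) :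
    (c₁, c₂) ∈ parabolaP n.natAbs := mem_parabolaP_of_sq (.inl (by rw [h]))

theorem mem_parabolaP_of_add {n : ℤ} (h : rootOuter c₁ c₂ + rootInner c₁ c₂ = 8 * n) :
    (c₁, c₂) ∈ parabolaP n.natAbs := mem_parabolaP_of_sq (.inr (by rw [h]))

/-- On the line, `4R = ±(16k² - 5 + 4c₁)` for the innermost root `R`. As `Re R ≥ 0`, the sign of the
real number in parentheses settles which of the two radicands is `16k²`. -/
theorem root_eq_of_mem_lineL {k : ℕ} (h : (c₁, c₂) ∈ lineL k) :
    (5 / 4 - 4 * (k : ℝ) ^ 2 ≤ c₁ → rootOuter c₁ c₂ = 4 * k) ∧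
      (c₁ ≤ 5 / 4 - 4 * (k : ℝ) ^ 2 → rootInner c₁ c₂ = 4 * k) := by
  have hI := sq_eq_sq_iff_eq_or_eq_neg.1 (mem_lineL_iff_sq.1 h)
  have hre : 0 ≤ (innerRoot c₁ c₂).re := csqrt_re_nonneg _
  have hcast : (16 * (k : ℂ) ^ 2 - 5 + 4 * c₁) = ((16 * (k : ℝ) ^ 2 - 5 + 4 * c₁ : ℝ) : ℂ) := by
    push_cast; ring
  have hv : 0 < ((4 * k : ℂ)).re ∨ (4 * k : ℂ) = 0 := by
    rcases Nat.eq_zero_or_pos k with rfl | hk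
    · simp
    · left
      have : (0 : ℝ) < k := by exact_mod_cast hk
      simpa using this
  have key : (5 / 4 - 4 * (k : ℝ) ^ 2 ≤ c₁ → 4 * innerRoot c₁ c₂ = 16 * (k : ℂ) ^ 2 - 5 + 4 * c₁) ∧
      (c₁ ≤ 5 / 4 - 4 * (k : ℝ) ^ 2 →
        4 * innerRoot c₁ c₂ = -(16 * (k : ℂ) ^ 2 - 5 + 4 * c₁)) := by
    refine ⟨fun hc => hI.elim id fun h1 => ?_, fun hc => hI.elim (fun h1 => ?_) id⟩
    all_goals
      have h2 := congrArg Complex.re h1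
      rw [hcast] at h2 ⊢
      simp only [Complex.mul_re, Complex.neg_re, Complex.ofReal_re, Complex.re_ofNat,
        Complex.im_ofNat, zero_mul, sub_zero] at h2
      -- The opposite sign is compatible with `Re R ≥ 0` only if both sides are zero.
      have h3 : 16 * (k : ℝ) ^ 2 - 5 + 4 * c₁ = 0 := by linarith
      rw [hcast, h3] at h1
      rw [h1, h3]
      simp
  refine ⟨fun hc => eq_csqrt ?_ hv, fun hc => eq_csqrt ?_ hv⟩
  · linear_combination -(key.1 hc)
  · linear_combination (key.2 hc)

/-- With `w = 5 - 4c₁ - 16k²` and `s = √w`, the innermost root is `±2ks`, so the two radicands are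
`(s + 4k)²` and `(s - 4k)²`. The principal root of the latter is `4k - s` or `s - 4k` according to
whether `w ≤ 16k²`, which is the threshold on `c₁`. -/
theorem root_relation_of_mem_parabolaP {k : ℕ} (h : (c₁, c₂) ∈ parabolaP k) :
    (k ≠ 0 ∧ 5 / 4 - 8 * (k : ℝ) ^ 2 ≤ c₁ → rootOuter c₁ c₂ + rootInner c₁ c₂ = 8 * k) ∧
      (k = 0 ∨ c₁ < 5 / 4 - 8 * (k : ℝ) ^ 2 → rootOuter c₁ c₂ - rootInner c₁ c₂ = 8 * k) := by
  rw [mem_parabolaP_iff_sq] at h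
  set w : ℝ := 5 - 4 * c₁ - 16 * (k : ℝ) ^ 2 with hw
  have hwc : (5 - 4 * c₁ - 16 * (k : ℂ) ^ 2) = (w : ℂ) := by rw [hw]; push_cast; ring
  rw [hwc] at h
  set s := csqrt (w : ℂ) with hs
  have hs2 : s ^ 2 = w := csqrt_sq _
  have hsre : 0 ≤ s.re := csqrt_re_nonneg _
  have hI : innerRoot c₁ c₂ = 2 * k * s ∨ innerRoot c₁ c₂ = -(2 * k * s) :=
    sq_eq_sq_iff_eq_or_eq_neg.1 (by rw [h]; linear_combination (-4 * (k : ℂ) ^ 2) * hs2)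
  have h1 := congrArg Complex.re hs2
  have h2 := congrArg Complex.im hs2
  simp only [pow_two, Complex.mul_re, Complex.mul_im, Complex.ofReal_re, Complex.ofReal_im] at h1 h2
  -- As `w` is real, `s` is real or purely imaginary.
  have h2' : s.re * s.im = 0 := by linarith
  have hkc : (k : ℂ).re = k ∧ (k : ℂ).im = 0 := ⟨by simp, by simp⟩
  have outer : ∀ v : ℂ, (0 < v.re ∨ v = 0) → v ^ 2 = w + 16 * (k : ℂ) ^ 2 + 4 * innerRoot c₁ c₂ →
      rootOuter c₁ c₂ = v := fun v hv hv2 => eq_csqrt (by rw [hv2, ← hwc]; ring) hv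
  have inner : ∀ v : ℂ, (0 < v.re ∨ v = 0) → v ^ 2 = w + 16 * (k : ℂ) ^ 2 - 4 * innerRoot c₁ c₂ →
      rootInner c₁ c₂ = v := fun v hv hv2 => eq_csqrt (by rw [hv2, ← hwc]; ring) hv
  refine ⟨fun ⟨hk, hc⟩ => ?_, fun hk => ?_⟩
  · have hk0 : (0 : ℝ) < k := by exact_mod_cast Nat.pos_of_ne_zero hk
    have hwlt : w ≤ 16 * (k : ℝ) ^ 2 := by linarith
    have p2 : 0 < (4 * (k : ℂ) - s).re ∨ 4 * (k : ℂ) - s = 0 := by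
      rcases mul_eq_zero.1 h2' with h0 | h0
      · left
        simpa [h0] using hk0
      · rw [h0] at h1
        have hle : s.re ≤ 4 * k := by nlinarith
        rcases hle.lt_or_eq with hlt | heq
        · left
          simpa using hlt
        · right
          apply Complex.ext <;> simp [h0, heq]
    have p1 : 0 < (4 * (k : ℂ) + s).re := by simp; linarith
    rcases hI with hI | hI
    · rw [outer (4 * k + s) (.inl p1) (by rw [hI]; linear_combination hs2),
        inner (4 * k - s) p2 (by rw [hI]; linear_combination hs2)]
      ring
    · rw [outer (4 * k - s) p2 (by rw [hI]; linear_combination hs2),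
        inner (4 * k + s) (.inl p1) (by rw [hI]; linear_combination hs2)]
      ring
  · rcases Nat.eq_zero_or_pos k with rfl | hkpos
    · have hI0 : innerRoot c₁ c₂ = 0 := by rcases hI with hI | hI <;> simpa using hI
      rw [rootOuter, rootInner, hI0]
      simp
    · have hc := hk.resolve_left hkpos.ne'
      have hk0 : (0 : ℝ) < k := by exact_mod_cast hkpos
      have hwgt : 16 * (k : ℝ) ^ 2 < w := by linarith
      have hsim : s.im = 0 := by
        rcases mul_eq_zero.1 h2' with h0 | h0
        · rw [h0] at h1
          nlinarith [sq_nonneg (k : ℝ), sq_nonneg s.im]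
        · exact h0
      rw [hsim] at h1
      have hgt : 4 * (k : ℝ) < s.re := by nlinarith
      -- For a difference of roots the order matters; it is fixed by the nonnegative real part of
      -- `innerRoot`. In the other case the sum is symmetric and either sign will do.
      have hIp : innerRoot c₁ c₂ = 2 * k * s := by
        rcases hI with hI | hI
        · exact hI
        · have hre : 0 ≤ (innerRoot c₁ c₂).re := csqrt_re_nonneg _
          rw [hI] at hre
          simp at hre
          nlinarith
      have p1 : 0 < (s + 4 * (k : ℂ)).re := by simp; linarith
      have p2 : 0 < (s - 4 * (k : ℂ)).re := by simp; linarith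
      rw [outer (s + 4 * k) (.inl p1) (by rw [hIp]; linear_combination hs2),
        inner (s - 4 * k) (.inl p2) (by rw [hIp]; linear_combination hs2)]
      ring

end EulerFour

/-! ### Integrality of the exponent differences -/

namespace EulerFour

variable {c₁ c₂ : ℝ}

theorem alpha₂_div_eq : alpha₂ c₁ c₂ / 4 =
    alpha₁ c₁ c₂ / 4 + (rootOuter c₁ c₂ - rootInner c₁ c₂) / 8 := by
  rw [alpha₁, alpha₂, rootOuter, rootInner]; ring

theorem alpha₃_div_eq : alpha₃ c₁ c₂ / 4 =
    alpha₁ c₁ c₂ / 4 + (rootOuter c₁ c₂ + rootInner c₁ c₂) / 8 := by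
  rw [alpha₁, alpha₃, rootOuter, rootInner]; ring

theorem alpha₄_div_eq : alpha₄ c₁ c₂ / 4 = alpha₁ c₁ c₂ / 4 + rootOuter c₁ c₂ / 4 := by
  rw [alpha₁, alpha₄, rootOuter]; ring

theorem multiplier_ne {a b d : ℂ} (h : a = b + d) (hd : ∀ n : ℤ, d ≠ n) :
    multiplier a ≠ multiplier b := fun he => by
  obtain ⟨n, hn⟩ := multiplier_eq_iff.1 he
  exact hd n (by linear_combination hn - h)

theorem multiplier_ne_of_div_eight {a b D : ℂ} (h : a = b + D / 8) (hD : ∀ n : ℤ, D ≠ 8 * n) :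
    multiplier a ≠ multiplier b :=
  multiplier_ne h fun n hn => hD n (by linear_combination 8 * hn)

theorem multiplier_ne_of_div_four {a b D : ℂ} (h : a = b + D / 4) (hD : ∀ n : ℤ, D ≠ 4 * n) :
    multiplier a ≠ multiplier b :=
  multiplier_ne h fun n hn => hD n (by linear_combination 4 * hn)

theorem cast_eq_or_eq_neg_of_natAbs_eq {n : ℤ} {k : ℕ} (h : n.natAbs = k) :
    (n : ℂ) = k ∨ (n : ℂ) = -k := by
  rcases Int.natAbs_eq n with h1 | h1 <;> rw [h] at h1 <;> rw [h1] <;> simp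

/-- On the intersection of a line and a parabola, all exponents differ by multiples of `4`. -/
theorem exists_nat_of_mem_lineL_of_mem_parabolaP {h k : ℕ} (hl : (c₁, c₂) ∈ lineL h)
    (hp : (c₁, c₂) ∈ parabolaP k) :
    ∃ u v : ℕ, rootOuter c₁ c₂ = 4 * (u + v) ∧ rootInner c₁ c₂ = 4 * (u - v) := by
  have hline : rootOuter c₁ c₂ = 4 * h ∨ rootInner c₁ c₂ = 4 * h :=
    (le_total (5 / 4 - 4 * (h : ℝ) ^ 2) c₁).imp (root_eq_of_mem_lineL hl).1
      (root_eq_of_mem_lineL hl).2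
  have hpar : rootOuter c₁ c₂ + rootInner c₁ c₂ = 8 * k ∨
      rootOuter c₁ c₂ - rootInner c₁ c₂ = 8 * k := by
    rcases Nat.eq_zero_or_pos k with hk | hk
    · exact .inr ((root_relation_of_mem_parabolaP hp).2 (.inl hk))
    · rcases lt_or_ge c₁ (5 / 4 - 8 * (k : ℝ) ^ 2) with hc | hc
      · exact .inr ((root_relation_of_mem_parabolaP hp).2 (.inr hc))
      · exact .inl ((root_relation_of_mem_parabolaP hp).1 ⟨hk.ne', hc⟩)
  -- Here `u` and `v` are `(α₄ - α₂)/4` and `(α₄ - α₃)/4`; their nonnegativity says that `α₄` is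
  -- maximal.
  obtain ⟨u, v, hA, hB⟩ : ∃ u v : ℤ, rootOuter c₁ c₂ = ((4 * (u + v) : ℤ) : ℂ) ∧
      rootInner c₁ c₂ = ((4 * (u - v) : ℤ) : ℂ) := by
    rcases hline with h1 | h1 <;> rcases hpar with h2 | h2
    · exact ⟨k, h - k, by push_cast; linear_combination h1,
        by push_cast; linear_combination h2 - h1⟩
    · exact ⟨h - k, k, by push_cast; linear_combination h1,
        by push_cast; linear_combination h1 - h2⟩
    · exact ⟨k, k - h, by push_cast; linear_combination h2 - h1,
        by push_cast; linear_combination h1⟩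
    · exact ⟨h + k, k, by push_cast; linear_combination h2 + h1,
        by push_cast; linear_combination h1⟩
  have rA : (0 : ℤ) ≤ 4 * (u + v) := by
    have : 0 ≤ (rootOuter c₁ c₂).re := csqrt_re_nonneg _
    rw [hA, Complex.intCast_re] at this
    exact_mod_cast this
  have rB : (0 : ℤ) ≤ 4 * (u - v) := by
    have : 0 ≤ (rootInner c₁ c₂).re := csqrt_re_nonneg _
    rw [hB, Complex.intCast_re] at this
    exact_mod_cast this
  -- The innermost root is `(A² - B²)/8 = 8uv`. A negative `v` would force `u = 0`, contradicting `u
  -- + v ≥ 0`.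
  have rI : (0 : ℤ) ≤ 8 * u * v := by
    have h1 : innerRoot c₁ c₂ = ((8 * u * v : ℤ) : ℂ) := by
      have hA2 := rootOuter_sq (c₁ := c₁) (c₂ := c₂)
      have hB2 := rootInner_sq (c₁ := c₁) (c₂ := c₂)
      rw [hA] at hA2
      rw [hB] at hB2
      push_cast at hA2 hB2 ⊢
      linear_combination (-1 / 8 : ℂ) * hA2 + 1 / 8 * hB2
    have : 0 ≤ (innerRoot c₁ c₂).re := csqrt_re_nonneg _
    rw [h1, Complex.intCast_re] at this
    exact_mod_cast this
  have hu : 0 ≤ u := by omega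
  have hv : 0 ≤ v := by
    by_contra! hneg
    nlinarith
  lift u to ℕ using hu
  lift v to ℕ using hv
  exact ⟨u, v, by rw [hA]; push_cast; ring, by rw [hB]; push_cast; ring⟩

end EulerFour

/-! ### The theorem: reduction of the four cases to the exponent configurations -/

theorem theoremA3 (c₁ c₂ : ℝ) (lam : ℂ) (hlam : lam ≠ 0)
    (α₁ α₂ α₃ α₄ : ℂ)
    (hα₁ : α₁ = EulerFour.alpha₁ c₁ c₂) (hα₂ : α₂ = EulerFour.alpha₂ c₁ c₂)
    (hα₃ : α₃ = EulerFour.alpha₃ c₁ c₂) (hα₄ : α₄ = EulerFour.alpha₄ c₁ c₂) :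
    -- exactly one line, no parabola
    (∀ k : ℕ, (∀ j : ℕ, (c₁, c₂) ∈ EulerFour.lineL j ↔ j = k) →
      (∀ j : ℕ, (c₁, c₂) ∉ EulerFour.parabolaP j) →
      (5 / 4 - 4 * (k : ℝ) ^ 2 < c₁ →
        EulerFour.IsFundamentalSystem c₁ c₂ lam
          ![EulerFour.meijerSol 2 lam α₁ α₄ α₂ α₃,
            EulerFour.hypSol lam α₂ α₁ α₃ α₄,
            EulerFour.hypSol lam α₃ α₁ α₂ α₄,
            EulerFour.hypSol lam α₄ α₁ α₂ α₃]) ∧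
      (c₁ < 5 / 4 - 4 * (k : ℝ) ^ 2 →
        EulerFour.IsFundamentalSystem c₁ c₂ lam
          ![EulerFour.hypSol lam α₁ α₂ α₃ α₄,
            EulerFour.meijerSol 2 lam α₂ α₃ α₁ α₄,
            EulerFour.hypSol lam α₃ α₁ α₂ α₄,
            EulerFour.hypSol lam α₄ α₁ α₂ α₃])) ∧
    -- exactly one parabola, no line
    (∀ k : ℕ, (∀ j : ℕ, (c₁, c₂) ∈ EulerFour.parabolaP j ↔ j = k) →
      (∀ j : ℕ, (c₁, c₂) ∉ EulerFour.lineL j) →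
      (k ≠ 0 ∧ 5 / 4 - 8 * (k : ℝ) ^ 2 < c₁ →
        EulerFour.IsFundamentalSystem c₁ c₂ lam
          ![EulerFour.meijerSol 2 lam α₁ α₃ α₂ α₄,
            EulerFour.meijerSol 2 lam α₂ α₄ α₁ α₃,
            EulerFour.hypSol lam α₃ α₁ α₂ α₄,
            EulerFour.hypSol lam α₄ α₁ α₂ α₃]) ∧
      (k = 0 ∨ c₁ < 5 / 4 - 8 * (k : ℝ) ^ 2 →
        EulerFour.IsFundamentalSystem c₁ c₂ lam
          ![EulerFour.meijerSol 2 lam α₁ α₂ α₃ α₄,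
            EulerFour.hypSol lam α₂ α₁ α₃ α₄,
            EulerFour.meijerSol 2 lam α₃ α₄ α₁ α₂,
            EulerFour.hypSol lam α₄ α₁ α₂ α₃])) ∧
    -- exactly two lines, no parabola
    (∀ h k : ℕ, h ≠ k → (∀ j : ℕ, (c₁, c₂) ∈ EulerFour.lineL j ↔ j = h ∨ j = k) →
      (∀ j : ℕ, (c₁, c₂) ∉ EulerFour.parabolaP j) →
      EulerFour.IsFundamentalSystem c₁ c₂ lam
        ![EulerFour.meijerSol 2 lam α₁ α₄ α₂ α₃,
          EulerFour.meijerSol 2 lam α₂ α₃ α₁ α₄,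
          EulerFour.hypSol lam α₃ α₁ α₂ α₄,
          EulerFour.hypSol lam α₄ α₁ α₂ α₃]) ∧
    -- at least one line and at least one parabola
    ((∃ h : ℕ, (c₁, c₂) ∈ EulerFour.lineL h) → (∃ k : ℕ, (c₁, c₂) ∈ EulerFour.parabolaP k) →
      EulerFour.IsFundamentalSystem c₁ c₂ lam
        ![EulerFour.meijerSol 4 lam α₁ α₂ α₃ α₄,
          EulerFour.meijerSol 3 (-lam) α₂ α₃ α₄ α₁,
          EulerFour.meijerSol 2 lam α₃ α₄ α₁ α₂,
          EulerFour.hypSol lam α₄ α₁ α₂ α₃]) := by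
  have hexp : EulerFour.IsCharExponents c₁ c₂ ![α₁, α₂, α₃, α₄] := by
    rw [hα₁, hα₂, hα₃, hα₄]
    exact EulerFour.isCharExponents c₁ c₂
  have e2 : α₂ / 4 = α₁ / 4 + (EulerFour.rootOuter c₁ c₂ - EulerFour.rootInner c₁ c₂) / 8 := by
    rw [hα₁, hα₂, EulerFour.alpha₂_div_eq]
  have e3 : α₃ / 4 = α₁ / 4 + (EulerFour.rootOuter c₁ c₂ + EulerFour.rootInner c₁ c₂) / 8 := by
    rw [hα₁, hα₃, EulerFour.alpha₃_div_eq]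
  have e4 : α₄ / 4 = α₁ / 4 + EulerFour.rootOuter c₁ c₂ / 4 := by
    rw [hα₁, hα₄, EulerFour.alpha₄_div_eq]
  have e32 : α₃ / 4 = α₂ / 4 + EulerFour.rootInner c₁ c₂ / 4 := by linear_combination e3 - e2
  have e42 : α₄ / 4 = α₂ / 4 + (EulerFour.rootOuter c₁ c₂ + EulerFour.rootInner c₁ c₂) / 8 := by
    linear_combination e4 - e2
  have e43 : α₄ / 4 = α₃ / 4 + (EulerFour.rootOuter c₁ c₂ - EulerFour.rootInner c₁ c₂) / 8 := by
    linear_combination e4 - e3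
  clear hα₁ hα₂ hα₃ hα₄
  obtain ⟨α, hα, rfl, rfl, rfl, rfl⟩ : ∃ α : Fin 4 → ℂ, EulerFour.IsCharExponents c₁ c₂ α ∧
      α 0 = α₁ ∧ α 1 = α₂ ∧ α 2 = α₃ ∧ α 3 = α₄ := ⟨_, hexp, rfl, rfl, rfl, rfl⟩
  refine ⟨fun k hk hP => ?_, fun k hk hL => ?_, fun h k hne hk hP => ?_, fun ⟨h, hh⟩ ⟨k, hk⟩ => ?_⟩
  · have hD : ∀ n : ℤ, EulerFour.rootOuter c₁ c₂ - EulerFour.rootInner c₁ c₂ ≠ 8 * n :=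
      fun n hn => hP _ (EulerFour.mem_parabolaP_of_sub hn)
    have hS : ∀ n : ℤ, EulerFour.rootOuter c₁ c₂ + EulerFour.rootInner c₁ c₂ ≠ 8 * n :=
      fun n hn => hP _ (EulerFour.mem_parabolaP_of_add hn)
    have hroot := EulerFour.root_eq_of_mem_lineL ((hk k).2 rfl)
    refine ⟨fun hc => ?_, fun hc => ?_⟩
    · have hA := hroot.1 hc.le
      -- If the inner root were also `4n`, uniqueness of the line would give `|n| = k`. The roots
      -- would then agree up to sign, which places the point on the excluded parabola with index
      -- `0`.
      have hB : ∀ n : ℤ, EulerFour.rootInner c₁ c₂ ≠ 4 * n := fun n hn => by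
        rcases EulerFour.cast_eq_or_eq_neg_of_natAbs_eq
          ((hk _).1 (EulerFour.mem_lineL_of_rootInner hn)) with h1 | h1 <;> rw [h1] at hn
        · exact hD 0 (by rw [hA, hn]; simp)
        · exact hS 0 (by rw [hA, hn]; simp)
      refine EulerFour.isFundamentalSystem_line_outer hlam hα (k := k) ?_
        (EulerFour.multiplier_ne_of_div_eight e2 hD) (EulerFour.multiplier_ne_of_div_eight e3 hS)
        (EulerFour.multiplier_ne_of_div_four e32 hB)
      linear_combination e4 + (1 / 4 : ℂ) * hA
    · have hB := hroot.2 hc.le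
      have hA : ∀ n : ℤ, EulerFour.rootOuter c₁ c₂ ≠ 4 * n := fun n hn => by
        rcases EulerFour.cast_eq_or_eq_neg_of_natAbs_eq
          ((hk _).1 (EulerFour.mem_lineL_of_rootOuter hn)) with h1 | h1 <;> rw [h1] at hn
        · exact hD 0 (by rw [hB, hn]; simp)
        · exact hS 0 (by rw [hB, hn]; simp)
      refine EulerFour.isFundamentalSystem_line_inner hlam hα (k := k) ?_
        (EulerFour.multiplier_ne_of_div_eight e2 hD) (EulerFour.multiplier_ne_of_div_four e4 hA)
        (EulerFour.multiplier_ne_of_div_eight e42 hS)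
      linear_combination e32 + (1 / 4 : ℂ) * hB
  · have hA : ∀ n : ℤ, EulerFour.rootOuter c₁ c₂ ≠ 4 * n :=
      fun n hn => hL _ (EulerFour.mem_lineL_of_rootOuter hn)
    have hB : ∀ n : ℤ, EulerFour.rootInner c₁ c₂ ≠ 4 * n :=
      fun n hn => hL _ (EulerFour.mem_lineL_of_rootInner hn)
    have hroot := EulerFour.root_relation_of_mem_parabolaP ((hk k).2 rfl)
    refine ⟨fun hc => ?_, fun hc => ?_⟩
    · have hS := hroot.1 ⟨hc.1, hc.2.le⟩
      -- Uniqueness of the parabola would give a difference `±8k` next to the sum `8k`. One root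
      -- would vanish and the point would lie on the line with index `0`.
      have hD : ∀ n : ℤ, EulerFour.rootOuter c₁ c₂ - EulerFour.rootInner c₁ c₂ ≠ 8 * n :=
        fun n hn => by
          rcases EulerFour.cast_eq_or_eq_neg_of_natAbs_eq
            ((hk _).1 (EulerFour.mem_parabolaP_of_sub hn)) with h1 | h1 <;> rw [h1] at hn
          · exact hB 0 (by push_cast; linear_combination (1 / 2 : ℂ) * hS - 1 / 2 * hn)
          · exact hA 0 (by push_cast; linear_combination (1 / 2 : ℂ) * hS + 1 / 2 * hn)
      refine EulerFour.isFundamentalSystem_parabola_outer hlam hα (k := k) (l := k) ?_ ?_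
        (EulerFour.multiplier_ne_of_div_eight e2 hD)
      · linear_combination e3 + (1 / 8 : ℂ) * hS
      · linear_combination e42 + (1 / 8 : ℂ) * hS
    · have hD := hroot.2 hc
      have hS : ∀ n : ℤ, EulerFour.rootOuter c₁ c₂ + EulerFour.rootInner c₁ c₂ ≠ 8 * n :=
        fun n hn => by
          rcases EulerFour.cast_eq_or_eq_neg_of_natAbs_eq
            ((hk _).1 (EulerFour.mem_parabolaP_of_add hn)) with h1 | h1 <;> rw [h1] at hn
          · exact hB 0 (by push_cast; linear_combination (1 / 2 : ℂ) * hn - 1 / 2 * hD)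
          · exact hA 0 (by push_cast; linear_combination (1 / 2 : ℂ) * hn + 1 / 2 * hD)
      refine EulerFour.isFundamentalSystem_parabola_inner hlam hα (k := k) (l := k) ?_ ?_
        (EulerFour.multiplier_ne_of_div_eight e3 hS)
      · linear_combination e2 + (1 / 8 : ℂ) * hD
      · linear_combination e43 + (1 / 8 : ℂ) * hD
  · have hD : ∀ n : ℤ, EulerFour.rootOuter c₁ c₂ - EulerFour.rootInner c₁ c₂ ≠ 8 * n :=
      fun n hn => hP _ (EulerFour.mem_parabolaP_of_sub hn)
    -- Each line fixes one of the two roots; since `h ≠ k` they cannot fix the same one.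
    obtain ⟨p, q, hA, hB⟩ : ∃ p q : ℕ, EulerFour.rootOuter c₁ c₂ = 4 * p ∧
        EulerFour.rootInner c₁ c₂ = 4 * q := by
      have r1 := EulerFour.root_eq_of_mem_lineL ((hk h).2 (.inl rfl))
      have r2 := EulerFour.root_eq_of_mem_lineL ((hk k).2 (.inr rfl))
      have hcancel : ∀ a b : ℕ, (4 * a : ℂ) = 4 * b → a = b := fun a b hab =>
        Nat.cast_injective (mul_left_cancel₀ (by norm_num) hab)
      rcases le_total (5 / 4 - 4 * (h : ℝ) ^ 2) c₁ with h1 | h1 <;>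
        rcases le_total (5 / 4 - 4 * (k : ℝ) ^ 2) c₁ with h2 | h2
      · exact absurd (hcancel _ _ ((r1.1 h1).symm.trans (r2.1 h2))) hne
      · exact ⟨h, k, r1.1 h1, r2.2 h2⟩
      · exact ⟨k, h, r2.1 h2, r1.2 h1⟩
      · exact absurd (hcancel _ _ ((r1.2 h1).symm.trans (r2.2 h2))) hne
    refine EulerFour.isFundamentalSystem_two_lines hlam hα (k := p) (l := q) ?_ ?_
      (EulerFour.multiplier_ne_of_div_eight e2 hD)
    · linear_combination e4 + (1 / 4 : ℂ) * hA
    · linear_combination e32 + (1 / 4 : ℂ) * hB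
  · obtain ⟨u, v, hA, hB⟩ := EulerFour.exists_nat_of_mem_lineL_of_mem_parabolaP hh hk
    refine EulerFour.isFundamentalSystem_line_parabola hlam hα (k := u + v) (l := u) (m := v)
      ?_ ?_ ?_
    · push_cast
      linear_combination e4 + (1 / 4 : ℂ) * hA
    · linear_combination e42 + (1 / 8 : ℂ) * hA + 1 / 8 * hB
    · linear_combination e43 + (1 / 8 : ℂ) * hA - 1 / 8 * hB
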